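/- Let $n\ge 6$. A state of the $2\otimes 3\otimes n$ system is a nonzero vector $\psi\in\mathbb C^2\otimes\mathbb C^3\otimes\mathbb C^n$ (normalization is irrelevant), shared by three parties Alice, Bob and Charlie. Two states are SLOCC equivalent if each can be converted into a nonzero multiple of the other, with nonzero probability, by a finite protocol of local operations (local measurements, in which a party's system may change its size) and classical communication. The state $\psi=|0\rangle\otimes|R\rangle+|1\rangle\otimes|S\rangle$, where $|R\rangle=\sum_{i,j}R_{ij}|i\rangle|j\rangle$ and $|S\rangle=\sum_{i,j}S_{ij}|i\rangle|j\rangle$, is identified with the $3\times n$ pencil $\mu R+\lambda S$. The local ranks of $\psi$ are the ranks of its three reduced density operators (Alice, Bob, Charlie). Its tensor rank is the least number of product states $u\otimes v\otimes w$ whose linear span contains $\psi$. Let $L_\epsilon$ be the $\epsilon\times(\epsilon+1)$ pencil with $\lambda$ on the diagonal, $\mu$ on the superdiagonal and zeros elsewhere; let $L_\nu^T$ be the transpose of $L_\nu$; and let $M^e(x)=(\mu x+\lambda)I_e+\mu H_e$, where $H_e$ is the $e\times e$ matrix with ones on the superdiagonal and zeros elsewhere. For a list of such blocks of total size $r\times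 c$ with $r\le 3$, $c\le n$, take the $3\times n$ block diagonal pencil consisting of the $(3-r)\times(n-c)$ zero block followed by these blocks. **Theorem.** There are exactly 26 SLOCC equivalence classes of $2\otimes 3\otimes n$ states. Every state is SLOCC equivalent to exactly one of the 26 (nonzero) Kronecker-form representatives below, and every state of a class has the local ranks and the tensor rank listed for it. | Class | Blocks of the representative | Local ranks | Tensor rank | |---|---|---|---| | A:B:C | $M^1(0)$ | (1,1,1) | 1 | | AB:C | $L_1^T$ | (2,2,1) | 2 | | AC:B | $L_1$ | (2,1,2) | 2 | | A:BC-1 | $M^1(0),M^1(0)$ | (1,2,2) | 2 | | ABC-1 | $M^1(0),M^1(1)$ | (2,2,2) | 2 | | ABC-2 | $M^2(0)$ | (2,2,2) | 3 | | ABC-3 | $L_1,M^1(0)$ | (2,2,3) | 3 | | ABC-4 | $L_2$ | (2,2,3) | 3 | | ABC-5 | $L_1,L_1$ | (2,2,4) | 4 | | ABC-6 | $L_1^T,M^1(0)$ | (2,3,2) | 3 | | ABC-7 | $L_2^T$ | (2,3,2) | 3 | | ABC-8 | $M^1(0),M^1(1),M^1(2)$ | (2,3,3) | 3 | | ABC-9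 | $M^1(0),M^1(0),M^1(1)$ | (2,3,3) | 3 | | A:BC-2 | $M^1(0),M^1(0),M^1(0)$ | (1,3,3) | 3 | | ABC-10 | $L_1,L_1^T$ | (2,3,3) | 4 | | ABC-11 | $M^2(0),M^1(0)$ | (2,3,3) | 4 | | ABC-12 | $M^2(0),M^1(1)$ | (2,3,3) | 4 | | ABC-13 | $M^3(0)$ | (2,3,3) | 4 | | ABC-14 | $L_1,M^1(0),M^1(0)$ | (2,3,4) | 4 | | ABC-15 | $L_1,M^1(0),M^1(1)$ | (2,3,4) | 4 | | ABC-16 | $L_1,M^2(0)$ | (2,3,4) | 5 | | ABC-17 | $L_2,M^1(0)$ | (2,3,4) | 4 | | ABC-18 | $L_3$ | (2,3,4) | 4 | | ABC-19 | $L_1,L_1,M^1(0)$ | (2,3,5) | 5 | | ABC-20 | $L_1,L_2$ | (2,3,5) | 5 | | ABC-21 | $L_1,L_1,L_1$ | (2,3,6) | 6 | -/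

import Mathlib

open scoped Matrix

noncomputable section

namespace SLOCC

/-! Tripartite pure states of `ℂ^a ⊗ ℂ^b ⊗ ℂ^c`, in coordinates with respect to fixed
orthonormal product bases; the three parties are Alice, Bob and Charlie. -/

/-- Vectors of `ℂ^a ⊗ ℂ^b ⊗ ℂ^c`. -/
abbrev Tensor (a b c : ℕ) : Type := Fin a → Fin b → Fin c → ℂ

/-- Pure states, as nonzero (not necessarily normalized) vectors. -/
abbrev State (a b c : ℕ) : Type := {ψ : Tensor a b c // ψ ≠ 0}

/-- The action of the local operator `A ⊗ B ⊗ C`. -/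
def localOp {a b c d e f : ℕ} (A : Matrix (Fin d) (Fin a) ℂ) (B : Matrix (Fin e) (Fin b) ℂ)
    (C : Matrix (Fin f) (Fin c) ℂ) (ψ : Tensor a b c) : Tensor d e f :=
  fun i j k => ∑ x, ∑ y, ∑ z, A i x * B j y * C k z * ψ x y z

/-- A finite family of Kraus operators of a quantum measurement from `ℂ^d` to `ℂ^e`. -/
def IsMeasurement {d e r : ℕ} (M : Fin r → Matrix (Fin e) (Fin d) ℂ) : Prop :=
  ∑ s, (M s)ᴴ * M s = 1

/-- `LOCCBranch ψ φ`: the vector `φ` is the unnormalized state left along one branch of a finite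
LOCC protocol started in `ψ`. In every round one party measures its own system (the size of which
may change, so ancillas are included), the outcome is announced to everybody, and the rest of the
protocol may depend on it; a branch is thus a sequence of local measurements, each with one of
its outcomes. The squared norm of `φ` divided by the squared norm of `ψ` is the probability of
the branch, so a branch has nonzero probability if and only if its final vector is nonzero. -/
inductive LOCCBranch {a b c : ℕ} (ψ : Tensor a b c) :
    {d e f : ℕ} → Tensor d e f → Prop
  | start : LOCCBranch ψ ψ
  | alice {d e f g r : ℕ} {φ : Tensor d e f} (M : Fin r → Matrix (Fin g) (Fin d) ℂ)
      (hM : IsMeasurement M) (s : Fin r) (h : LOCCBranch ψ φ) :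
      LOCCBranch ψ (localOp (M s) (1 : Matrix (Fin e) (Fin e) ℂ) (1 : Matrix (Fin f) (Fin f) ℂ) φ)
  | bob {d e f g r : ℕ} {φ : Tensor d e f} (M : Fin r → Matrix (Fin g) (Fin e) ℂ)
      (hM : IsMeasurement M) (s : Fin r) (h : LOCCBranch ψ φ) :
      LOCCBranch ψ (localOp (1 : Matrix (Fin d) (Fin d) ℂ) (M s) (1 : Matrix (Fin f) (Fin f) ℂ) φ)
  | charlie {d e f g r : ℕ} {φ : Tensor d e f} (M : Fin r → Matrix (Fin g) (Fin f) ℂ)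
      (hM : IsMeasurement M) (s : Fin r) (h : LOCCBranch ψ φ) :
      LOCCBranch ψ (localOp (1 : Matrix (Fin d) (Fin d) ℂ) (1 : Matrix (Fin e) (Fin e) ℂ) (M s) φ)

/-- `ψ` can be converted to `φ` by LOCC with nonzero probability (for nonzero `φ`): some branch
ends in a nonzero multiple of `φ`. -/
def Convertible {a b c d e f : ℕ} (ψ : Tensor a b c) (φ : Tensor d e f) : Prop :=
  ∃ z : ℂ, z ≠ 0 ∧ LOCCBranch ψ (z • φ)

/-- SLOCC equivalence: convertibility in both directions. -/
def Equivalent {a b c : ℕ} (ψ φ : Tensor a b c) : Prop :=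
  Convertible ψ φ ∧ Convertible φ ψ

theorem localOp_smul {a b c d e f : ℕ} (A : Matrix (Fin d) (Fin a) ℂ)
    (B : Matrix (Fin e) (Fin b) ℂ) (C : Matrix (Fin f) (Fin c) ℂ) (z : ℂ) (ψ : Tensor a b c) :
    localOp A B C (z • ψ) = z • localOp A B C ψ := by
  funext i j k
  simp only [localOp, Pi.smul_apply, smul_eq_mul, Finset.mul_sum]
  refine Finset.sum_congr rfl fun x _ => Finset.sum_congr rfl fun y _ =>
    Finset.sum_congr rfl fun w _ => ?_
  ring

theorem LOCCBranch.smul {a b c d e f : ℕ} {ψ : Tensor a b c} {φ : Tensor d e f} (z : ℂ)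
    (h : LOCCBranch ψ φ) : LOCCBranch (z • ψ) (z • φ) := by
  induction h with
  | start => exact .start
  | alice M hM s _ ih => rw [← localOp_smul]; exact .alice M hM s ih
  | bob M hM s _ ih => rw [← localOp_smul]; exact .bob M hM s ih
  | charlie M hM s _ ih => rw [← localOp_smul]; exact .charlie M hM s ih

theorem LOCCBranch.trans {a b c d e f g k l : ℕ} {ψ : Tensor a b c} {φ : Tensor d e f}
    {χ : Tensor g k l} (h : LOCCBranch ψ φ) (h₂ : LOCCBranch φ χ) : LOCCBranch ψ χ := by
  induction h₂ with
  | start => exact h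
  | alice M hM s _ ih => exact .alice M hM s ih
  | bob M hM s _ ih => exact .bob M hM s ih
  | charlie M hM s _ ih => exact .charlie M hM s ih

theorem Convertible.refl {a b c : ℕ} (ψ : Tensor a b c) : Convertible ψ ψ :=
  ⟨1, one_ne_zero, by rw [one_smul]; exact .start⟩

theorem Convertible.trans {a b c d e f g k l : ℕ} {ψ : Tensor a b c} {φ : Tensor d e f}
    {χ : Tensor g k l} (h : Convertible ψ φ) (h₂ : Convertible φ χ) : Convertible ψ χ := by
  obtain ⟨z, hz, hb⟩ := h
  obtain ⟨w, hw, hb₂⟩ := h₂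
  refine ⟨z * w, mul_ne_zero hz hw, ?_⟩
  rw [mul_smul]
  exact hb.trans (hb₂.smul z)

/-- SLOCC equivalence as an equivalence relation on states. -/
def setoid (a b c : ℕ) : Setoid (State a b c) where
  r ψ φ := Equivalent ψ.1 φ.1
  iseqv :=
    { refl := fun ψ => ⟨.refl ψ.1, .refl ψ.1⟩
      symm := fun h => ⟨h.2, h.1⟩
      trans := fun h h₂ => ⟨h.1.trans h₂.1, h₂.2.trans h.2⟩ }

/-- The reduced density operator of Alice, up to normalization. -/
def rhoA {a b c : ℕ} (ψ : Tensor a b c) : Matrix (Fin a) (Fin a) ℂ :=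
  Matrix.of fun i x => ∑ j, ∑ k, ψ i j k * star (ψ x j k)

/-- The reduced density operator of Bob, up to normalization. -/
def rhoB {a b c : ℕ} (ψ : Tensor a b c) : Matrix (Fin b) (Fin b) ℂ :=
  Matrix.of fun j y => ∑ i, ∑ k, ψ i j k * star (ψ i y k)

/-- The reduced density operator of Charlie, up to normalization. -/
def rhoC {a b c : ℕ} (ψ : Tensor a b c) : Matrix (Fin c) (Fin c) ℂ :=
  Matrix.of fun k z => ∑ i, ∑ j, ψ i j k * star (ψ i j z)

/-- The local ranks of Alice, Bob and Charlie. -/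
def localRanks {a b c : ℕ} (ψ : Tensor a b c) : ℕ × ℕ × ℕ :=
  ((rhoA ψ).rank, (rhoB ψ).rank, (rhoC ψ).rank)

/-- Product states `u ⊗ v ⊗ w`. -/
def IsProductState {a b c : ℕ} (ψ : Tensor a b c) : Prop :=
  ψ ≠ 0 ∧ ∃ (u : Fin a → ℂ) (v : Fin b → ℂ) (w : Fin c → ℂ), ∀ i j k, ψ i j k = u i * v j * w k

/-- The tensor rank of `ψ` is `r`: the least number of product states whose linear span
contains `ψ` is `r`. -/
def HasTensorRank {a b c : ℕ} (ψ : Tensor a b c) (r : ℕ) : Prop :=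
  IsLeast {s : ℕ | ∃ p : Fin s → Tensor a b c,
    (∀ t, IsProductState (p t)) ∧ ψ ∈ Submodule.span ℂ (Set.range p)} r

/-! A state `|0⟩|R⟩ + |1⟩|S⟩` of `ℂ^2 ⊗ ℂ^b ⊗ ℂ^c` is the same as the pencil `μ R + λ S` of
`b × c` matrices: the entries with first index `0` are the coefficients of `μ`, those with first
index `1` the coefficients of `λ`. -/

/-- The blocks of the Kronecker canonical form. -/
inductive Block : Type
  /-- the `h × g` zero block -/
  | zero (h g : ℕ)
  /-- the `ε × (ε + 1)` block with `λ` on the diagonal and `μ` on the superdiagonal -/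
  | L (ε : ℕ)
  /-- the transpose of `L ν` -/
  | LT (ν : ℕ)
  /-- the `e × e` block `μ I + λ H`, with ones on the superdiagonal of `H` and zeros elsewhere -/
  | N (e : ℕ)
  /-- the `e × e` block `(x μ + λ) I + μ H` -/
  | M (x : ℂ) (e : ℕ)

namespace Block

def rows : Block → ℕ
  | zero h _ => h
  | L ε => ε
  | LT ν => ν + 1
  | N e => e
  | M _ e => e

def cols : Block → ℕ
  | zero _ g => g
  | L ε => ε + 1
  | LT ν => ν
  | N e => e
  | M _ e => e

/-- The coefficient of `μ` in the entry `(i, j)`, for `i < rows` and `j < cols`. -/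
def coeffMu : Block → ℕ → ℕ → ℂ
  | zero _ _, _, _ => 0
  | L _, i, j => if j = i + 1 then 1 else 0
  | LT _, i, j => if i = j + 1 then 1 else 0
  | N _, i, j => if j = i then 1 else 0
  | M x _, i, j => if j = i then x else if j = i + 1 then 1 else 0

/-- The coefficient of `λ` in the entry `(i, j)`, for `i < rows` and `j < cols`. -/
def coeffLambda : Block → ℕ → ℕ → ℂ
  | zero _ _, _, _ => 0
  | L _, i, j => if j = i then 1 else 0
  | LT _, i, j => if j = i then 1 else 0
  | N _, i, j => if j = i + 1 then 1 else 0
  | M _ _, i, j => if j = i then 1 else 0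

/-- The coefficient of `μ` for `s = 0`, that of `λ` for `s = 1`. -/
def coeff (B : Block) (s : Fin 2) : ℕ → ℕ → ℂ :=
  if s = 0 then B.coeffMu else B.coeffLambda

end Block

/-- The entries of the block diagonal pencil with the given blocks, from the top left to the
bottom right. -/
def blockDiagonal : List Block → Fin 2 → ℕ → ℕ → ℂ
  | [], _, _, _ => 0
  | B :: Bs, s, i, j =>
    if i < B.rows ∧ j < B.cols then B.coeff s i j
    else if B.rows ≤ i ∧ B.cols ≤ j then blockDiagonal Bs s (i - B.rows) (j - B.cols)
    else 0

/-- The vector of `ℂ^2 ⊗ ℂ^b ⊗ ℂ^c` whose pencil is block diagonal with a zero block that fills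
up the size to `b × c`, followed by the given blocks. -/
def kroneckerForm (b c : ℕ) (Bs : List Block) : Tensor 2 b c :=
  fun s i j => blockDiagonal
    (Block.zero (b - (Bs.map Block.rows).sum) (c - (Bs.map Block.cols).sum) :: Bs) s i j

/-- The names of the 26 classes. -/
inductive ClassName : Type
  | A_B_C | AB_C | AC_B | A_BC1
  | ABC1 | ABC2 | ABC3 | ABC4 | ABC5 | ABC6 | ABC7 | ABC8 | ABC9
  | A_BC2
  | ABC10 | ABC11 | ABC12 | ABC13 | ABC14 | ABC15 | ABC16 | ABC17 | ABC18 | ABC19 | ABC20 | ABC21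

namespace ClassName

open Block in
/-- The nonzero blocks of the representative of each class. -/
def blocks : ClassName → List Block
  | A_B_C => [M 0 1]
  | AB_C => [LT 1]
  | AC_B => [L 1]
  | A_BC1 => [M 0 1, M 0 1]
  | ABC1 => [M 0 1, M 1 1]
  | ABC2 => [M 0 2]
  | ABC3 => [L 1, M 0 1]
  | ABC4 => [L 2]
  | ABC5 => [L 1, L 1]
  | ABC6 => [LT 1, M 0 1]
  | ABC7 => [LT 2]
  | ABC8 => [M 0 1, M 1 1, M 2 1]
  | ABC9 => [M 0 1, M 0 1, M 1 1]
  | A_BC2 => [M 0 1, M 0 1, M 0 1]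
  | ABC10 => [L 1, LT 1]
  | ABC11 => [M 0 2, M 0 1]
  | ABC12 => [M 0 2, M 1 1]
  | ABC13 => [M 0 3]
  | ABC14 => [L 1, M 0 1, M 0 1]
  | ABC15 => [L 1, M 0 1, M 1 1]
  | ABC16 => [L 1, M 0 2]
  | ABC17 => [L 2, M 0 1]
  | ABC18 => [L 3]
  | ABC19 => [L 1, L 1, M 0 1]
  | ABC20 => [L 1, L 2]
  | ABC21 => [L 1, L 1, L 1]

/-- The representative of each class in `ℂ^2 ⊗ ℂ^3 ⊗ ℂ^n`. -/
def representative (t : ClassName) (n : ℕ) : Tensor 2 3 n :=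
  kroneckerForm 3 n t.blocks

/-- The local ranks listed for each class. -/
def ranks : ClassName → ℕ × ℕ × ℕ
  | A_B_C => (1, 1, 1)
  | AB_C => (2, 2, 1)
  | AC_B => (2, 1, 2)
  | A_BC1 => (1, 2, 2)
  | ABC1 => (2, 2, 2)
  | ABC2 => (2, 2, 2)
  | ABC3 => (2, 2, 3)
  | ABC4 => (2, 2, 3)
  | ABC5 => (2, 2, 4)
  | ABC6 => (2, 3, 2)
  | ABC7 => (2, 3, 2)
  | ABC8 => (2, 3, 3)
  | ABC9 => (2, 3, 3)
  | A_BC2 => (1, 3, 3)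
  | ABC10 => (2, 3, 3)
  | ABC11 => (2, 3, 3)
  | ABC12 => (2, 3, 3)
  | ABC13 => (2, 3, 3)
  | ABC14 => (2, 3, 4)
  | ABC15 => (2, 3, 4)
  | ABC16 => (2, 3, 4)
  | ABC17 => (2, 3, 4)
  | ABC18 => (2, 3, 4)
  | ABC19 => (2, 3, 5)
  | ABC20 => (2, 3, 5)
  | ABC21 => (2, 3, 6)

/-- The tensor rank listed for each class. -/
def tensorRank : ClassName → ℕ
  | A_B_C => 1
  | AB_C => 2
  | AC_B => 2
  | A_BC1 => 2
  | ABC1 => 2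
  | ABC2 => 3
  | ABC3 => 3
  | ABC4 => 3
  | ABC5 => 4
  | ABC6 => 3
  | ABC7 => 3
  | ABC8 => 3
  | ABC9 => 3
  | A_BC2 => 3
  | ABC10 => 4
  | ABC11 => 4
  | ABC12 => 4
  | ABC13 => 4
  | ABC14 => 4
  | ABC15 => 4
  | ABC16 => 5
  | ABC17 => 4
  | ABC18 => 4
  | ABC19 => 5
  | ABC20 => 5
  | ABC21 => 6

end ClassName

end SLOCC

end

/-!
A matrix can be completed, after multiplication with a nonzero scalar, to a measurement
(`exists_isMeasurement_smul`). Therefore `ψ` can be converted into a nonzero `φ` with nonzero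
probability if and only if `φ = (A ⊗ B ⊗ C) ψ` for some, possibly singular, local operators. This
relation, `Restricts`, makes sense between systems of different sizes, and mutual restriction of
nonzero vectors of the same system is SLOCC equivalence. Local ranks and tensor rank do not increase
under restriction, and padding with zeros is a mutual restriction
(`mutuallyRestrict_of_padding`). Hence each representative can be replaced by its core, the tensor
of full local ranks that is left when the zero block is removed.

*Ranks of the representatives.* The upper bounds for the tensor rank are explicit decompositions.
The largest local rank is a lower bound. It is not attained for the classes `ABC2`, `ABC10`,
`ABC11`, `ABC12`, `ABC13` and `ABC16`: a tensor whose tensor rank is the rank of Charlie has a space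
of slices that is spanned by product vectors, and for these six the product vectors in it lie in
a hyperplane (`ConciseC.lt_of_isSumOfProducts`).

*Every state is in a class.* Up to mutual restriction a state is determined by the space
`V ⊆ ℂ² ⊗ ℂ³` spanned by its slices with respect to a basis of Charlie, up to the action of
`GL₂ × GL₃`. Let `d ≤ 6` be the dimension of `V`. For `d = 3` the pencil is square, and so has
a singular point over `ℂ`; this gives a product vector in `V`, and with the same argument for the
remaining `2 × 2` pencil a triangular form (`exists_sameOrbit_tri`), which row and column operations
bring to one of the representatives. For `d ≤ 2` there is a similar elementary reduction. For
`d ≥ 4` the orthogonal complement of `V` with respect to a bilinear form has dimension `6 - d ≤ 2`;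
since the group acts contragrediently on complements, its normal form determines that of `V`
(`IsDual.mutuallyRestrict`).

*Different classes are inequivalent.* Local ranks and tensor rank separate all but 16 pairs. In each
of these the two cores have the same format, and restrictions between them act on the product
vectors in the complement of the space of slices (`Restricts.exists_annihilates_equiv`). How many
such product vectors there are, and in which position, tells the two classes apart.
-/

open scoped Matrix

namespace SLOCC

/-! ### Local operators and conversions -/

theorem localOp_localOp {a b c d e f g h l : ℕ} (A' : Matrix (Fin g) (Fin d) ℂ)
    (B' : Matrix (Fin h) (Fin e) ℂ) (C' : Matrix (Fin l) (Fin f) ℂ)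
    (A : Matrix (Fin d) (Fin a) ℂ) (B : Matrix (Fin e) (Fin b) ℂ) (C : Matrix (Fin f) (Fin c) ℂ)
    (ψ : Tensor a b c) :
    localOp A' B' C' (localOp A B C ψ) = localOp (A' * A) (B' * B) (C' * C) ψ := by
  have key (F : Fin d → Fin e → Fin f → Fin a → Fin b → Fin c → ℂ) :
      ∑ x, ∑ y, ∑ z, ∑ x', ∑ y', ∑ z', F x y z x' y' z' =
        ∑ x', ∑ y', ∑ z', ∑ x, ∑ y, ∑ z, F x y z x' y' z' := by
    calc _ = ∑ p : Fin d × Fin e × Fin f, ∑ q : Fin a × Fin b × Fin c,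
          F p.1 p.2.1 p.2.2 q.1 q.2.1 q.2.2 := by simp only [Fintype.sum_prod_type]
      _ = ∑ q : Fin a × Fin b × Fin c, ∑ p : Fin d × Fin e × Fin f,
          F p.1 p.2.1 p.2.2 q.1 q.2.1 q.2.2 := Finset.sum_comm
      _ = _ := by simp only [Fintype.sum_prod_type]
  funext i j k
  simp only [localOp, Finset.mul_sum]
  rw [key]
  refine Finset.sum_congr rfl fun x' _ => Finset.sum_congr rfl fun y' _ =>
    Finset.sum_congr rfl fun z' _ => ?_
  rw [Matrix.mul_apply, Matrix.mul_apply, Matrix.mul_apply, Finset.sum_mul_sum, Finset.sum_mul,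
    Finset.sum_mul]
  refine Finset.sum_congr rfl fun x _ => ?_
  rw [Finset.sum_mul_sum, Finset.sum_mul]
  refine Finset.sum_congr rfl fun y _ => ?_
  rw [Finset.sum_mul]
  refine Finset.sum_congr rfl fun z _ => ?_
  ring

theorem localOp_one {a b c : ℕ} (ψ : Tensor a b c) : localOp 1 1 1 ψ = ψ := by
  funext i j k
  simp [localOp, Matrix.one_apply]

theorem localOp_zero {a b c d e f : ℕ} (A : Matrix (Fin d) (Fin a) ℂ)
    (B : Matrix (Fin e) (Fin b) ℂ) (C : Matrix (Fin f) (Fin c) ℂ) : localOp A B C 0 = 0 := by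
  funext i j k
  simp [localOp]

/-- `φ` is a restriction of `ψ`: it is the image of `ψ` under some local operators, between
systems of arbitrary sizes. -/
def Restricts {a b c d e f : ℕ} (ψ : Tensor a b c) (φ : Tensor d e f) : Prop :=
  ∃ A B C, φ = localOp A B C ψ

theorem Restricts.refl {a b c : ℕ} (ψ : Tensor a b c) : Restricts ψ ψ :=
  ⟨1, 1, 1, (localOp_one ψ).symm⟩

theorem Restricts.trans {a b c d e f g k l : ℕ} {ψ : Tensor a b c} {φ : Tensor d e f}
    {χ : Tensor g k l} (h : Restricts ψ φ) (h₂ : Restricts φ χ) : Restricts ψ χ := by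
  obtain ⟨A, B, C, rfl⟩ := h
  obtain ⟨A', B', C', rfl⟩ := h₂
  exact ⟨_, _, _, localOp_localOp ..⟩

/-- Mutual restriction. For nonzero vectors this is SLOCC equivalence, but it also compares
vectors of systems of different sizes. -/
def MutuallyRestrict {a b c d e f : ℕ} (ψ : Tensor a b c) (φ : Tensor d e f) : Prop :=
  Restricts ψ φ ∧ Restricts φ ψ

theorem MutuallyRestrict.symm {a b c d e f : ℕ} {ψ : Tensor a b c} {φ : Tensor d e f}
    (h : MutuallyRestrict ψ φ) : MutuallyRestrict φ ψ := ⟨h.2, h.1⟩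

theorem MutuallyRestrict.trans {a b c d e f g k l : ℕ} {ψ : Tensor a b c} {φ : Tensor d e f}
    {χ : Tensor g k l} (h : MutuallyRestrict ψ φ) (h₂ : MutuallyRestrict φ χ) :
    MutuallyRestrict ψ χ := ⟨h.1.trans h₂.1, h₂.2.trans h.2⟩

open scoped ComplexOrder MatrixOrder Matrix.Norms.L2Operator in
/-- After rescaling `A` to a contraction, the defect `1 - Aᴴ A` is positive semidefinite, and `N` is
a square root of it in the sense `Nᴴ N = 1 - Aᴴ A`. -/
theorem exists_smul_conjTranspose_mul_self_add_eq_one {d e : ℕ} (A : Matrix (Fin e) (Fin d) ℂ) :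
    ∃ z : ℂ, z ≠ 0 ∧ ∃ N : Matrix (Fin d) (Fin d) ℂ, (z • A)ᴴ * (z • A) + Nᴴ * N = 1 := by
  set P : Matrix (Fin d) (Fin d) ℂ := Aᴴ * A
  have hle : P ≤ algebraMap ℝ _ ‖P‖ :=
    IsSelfAdjoint.le_algebraMap_norm_self (Matrix.isHermitian_conjTranspose_mul_self A)
  set x : ℝ := ‖P‖ + 1
  have hx : 0 < x := by positivity
  have hle' : P ≤ algebraMap ℝ _ x := hle.trans (by
    rw [map_add, map_one]
    exact le_add_of_nonneg_right zero_le_one)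
  have hpsd : ((x⁻¹ : ℝ) • (algebraMap ℝ _ x - P)).PosSemidef :=
    (Matrix.le_iff.1 hle').smul (by positivity)
  obtain ⟨N, hN⟩ := CStarAlgebra.nonneg_iff_eq_star_mul_self.1 hpsd.nonneg
  refine ⟨((Real.sqrt x)⁻¹ : ℝ), ?_, N, ?_⟩
  · have := Real.sqrt_pos.2 hx
    exact_mod_cast (inv_pos.2 this).ne'
  · rw [← Matrix.star_eq_conjTranspose N, ← hN, Matrix.conjTranspose_smul, Matrix.smul_mul,
      Matrix.mul_smul, smul_smul]
    have h1 : star (((Real.sqrt x)⁻¹ : ℝ) : ℂ) * (((Real.sqrt x)⁻¹ : ℝ) : ℂ) = ((x⁻¹ : ℝ) : ℂ) := by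
      rw [Complex.star_def, Complex.conj_ofReal, ← Complex.ofReal_mul, ← mul_inv,
        Real.mul_self_sqrt hx.le]
    rw [h1, smul_sub, Algebra.algebraMap_eq_smul_one, smul_smul, inv_mul_cancel₀ hx.ne', one_smul]
    change ((x⁻¹ : ℝ) : ℂ) • P + (1 - (x⁻¹ : ℝ) • P) = 1
    rw [show ((x⁻¹ : ℝ) : ℂ) • P = (x⁻¹ : ℝ) • P from Complex.coe_smul _ _]
    abel

/-- Up to a scalar, every matrix with at least one row is a Kraus operator of a measurement. -/
theorem exists_isMeasurement_smul {d e : ℕ} [NeZero e] (A : Matrix (Fin e) (Fin d) ℂ) :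
    ∃ z : ℂ, z ≠ 0 ∧ ∃ M : Fin (d + 1) → Matrix (Fin e) (Fin d) ℂ,
      IsMeasurement M ∧ M 0 = z • A := by
  obtain ⟨z, hz, N, hN⟩ := exists_smul_conjTranspose_mul_self_add_eq_one A
  -- The defect `Nᴴ * N` is split into the rank-one terms that belong to the rows of `N`.
  refine ⟨z, hz, Fin.cons (z • A) fun i => Matrix.of fun p q => if p = 0 then N i q else 0, ?_,
    rfl⟩
  rw [IsMeasurement, Fin.sum_univ_succ, ← hN]
  congr 1
  ext p q
  simp [Matrix.sum_apply, Matrix.mul_apply, Matrix.conjTranspose_apply]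

theorem LOCCBranch.restricts {a b c d e f : ℕ} {ψ : Tensor a b c} {φ : Tensor d e f}
    (h : LOCCBranch ψ φ) : Restricts ψ φ := by
  induction h with
  | start => exact .refl ψ
  | alice M _ s _ ih => exact ih.trans ⟨_, _, _, rfl⟩
  | bob M _ s _ ih => exact ih.trans ⟨_, _, _, rfl⟩
  | charlie M _ s _ ih => exact ih.trans ⟨_, _, _, rfl⟩

theorem Convertible.restricts {a b c d e f : ℕ} {ψ : Tensor a b c} {φ : Tensor d e f}
    (h : Convertible ψ φ) : Restricts ψ φ := by
  obtain ⟨z, hz, h⟩ := h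
  obtain ⟨A, B, C, h⟩ := h.restricts
  refine ⟨z⁻¹ • A, B, C, ?_⟩
  have h2 : φ = z⁻¹ • localOp A B C ψ := by rw [← h, smul_smul, inv_mul_cancel₀ hz, one_smul]
  rw [h2]
  funext i j k
  simp only [localOp, Pi.smul_apply, Matrix.smul_apply, smul_eq_mul, Finset.mul_sum]
  refine Finset.sum_congr rfl fun x _ => Finset.sum_congr rfl fun y _ =>
    Finset.sum_congr rfl fun w _ => ?_
  ring

/-- The local operators of a restriction with nonzero result can be carried out, one party after
the other, as outcomes of local measurements. -/
theorem Restricts.convertible {a b c d e f : ℕ} {ψ : Tensor a b c} {φ : Tensor d e f}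
    (h : Restricts ψ φ) (hφ : φ ≠ 0) : Convertible ψ φ := by
  obtain ⟨A, B, C, rfl⟩ := h
  have hd : d ≠ 0 := by rintro rfl; exact hφ (funext fun i => i.elim0)
  have he : e ≠ 0 := by rintro rfl; exact hφ (funext₂ fun _ i => i.elim0)
  have hf : f ≠ 0 := by rintro rfl; exact hφ (funext₃ fun _ _ i => i.elim0)
  have := NeZero.mk hd
  have := NeZero.mk he
  have := NeZero.mk hf
  obtain ⟨x, hx, M, hM, hMA⟩ := exists_isMeasurement_smul A
  obtain ⟨y, hy, M', hM', hMB⟩ := exists_isMeasurement_smul B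
  obtain ⟨z, hz, M'', hM'', hMC⟩ := exists_isMeasurement_smul C
  refine ⟨x * y * z, by simp [hx, hy, hz], ?_⟩
  have key := LOCCBranch.charlie M'' hM'' 0 (.bob M' hM' 0 (.alice M hM 0 (.start (ψ := ψ))))
  rw [hMA, hMB, hMC, localOp_localOp, localOp_localOp] at key
  convert key using 1
  funext i j k
  simp only [localOp, Pi.smul_apply, smul_eq_mul, Finset.mul_sum, Matrix.one_mul,
    Matrix.mul_one, Matrix.smul_apply]
  refine Finset.sum_congr rfl fun x _ => Finset.sum_congr rfl fun y _ =>
    Finset.sum_congr rfl fun w _ => ?_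
  ring

theorem Equivalent.mutuallyRestrict {a b c : ℕ} {ψ φ : Tensor a b c} (h : Equivalent ψ φ) :
    MutuallyRestrict ψ φ := ⟨h.1.restricts, h.2.restricts⟩

theorem Restricts.ne_zero {a b c d e f : ℕ} {ψ : Tensor a b c} {φ : Tensor d e f}
    (h : Restricts ψ φ) (hφ : φ ≠ 0) : ψ ≠ 0 := by
  rintro rfl
  obtain ⟨A, B, C, rfl⟩ := h
  exact hφ (localOp_zero A B C)

theorem MutuallyRestrict.equivalent {a b c : ℕ} {ψ φ : Tensor a b c} (h : MutuallyRestrict ψ φ)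
    (hφ : φ ≠ 0) : Equivalent ψ φ := ⟨h.1.convertible hφ, h.2.convertible (h.1.ne_zero hφ)⟩

/-! ### Local ranks -/

/-- The flattening of `ψ` whose rows are indexed by Alice. -/
def flatA {a b c : ℕ} (ψ : Tensor a b c) : Matrix (Fin a) (Fin b × Fin c) ℂ :=
  Matrix.of fun i p => ψ i p.1 p.2

/-- The flattening of `ψ` whose rows are indexed by Bob. -/
def flatB {a b c : ℕ} (ψ : Tensor a b c) : Matrix (Fin b) (Fin a × Fin c) ℂ :=
  Matrix.of fun j p => ψ p.1 j p.2

/-- The flattening of `ψ` whose rows are indexed by Charlie. -/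
def flatC {a b c : ℕ} (ψ : Tensor a b c) : Matrix (Fin c) (Fin a × Fin b) ℂ :=
  Matrix.of fun k p => ψ p.1 p.2 k

open scoped ComplexOrder in
theorem rank_rhoA {a b c : ℕ} (ψ : Tensor a b c) : (rhoA ψ).rank = (flatA ψ).rank := by
  rw [← Matrix.rank_self_mul_conjTranspose (flatA ψ)]
  congr 1
  ext i x
  simp [rhoA, flatA, Matrix.mul_apply, Fintype.sum_prod_type]

open scoped ComplexOrder in
theorem rank_rhoB {a b c : ℕ} (ψ : Tensor a b c) : (rhoB ψ).rank = (flatB ψ).rank := by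
  rw [← Matrix.rank_self_mul_conjTranspose (flatB ψ)]
  congr 1
  ext i x
  simp [rhoB, flatB, Matrix.mul_apply, Fintype.sum_prod_type]

open scoped ComplexOrder in
theorem rank_rhoC {a b c : ℕ} (ψ : Tensor a b c) : (rhoC ψ).rank = (flatC ψ).rank := by
  rw [← Matrix.rank_self_mul_conjTranspose (flatC ψ)]
  congr 1
  ext i x
  simp [rhoC, flatC, Matrix.mul_apply, Fintype.sum_prod_type]

theorem rank_flatA_localOp_le {a b c d e f : ℕ} (A : Matrix (Fin d) (Fin a) ℂ)
    (B : Matrix (Fin e) (Fin b) ℂ) (C : Matrix (Fin f) (Fin c) ℂ) (ψ : Tensor a b c) :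
    (flatA (localOp A B C ψ)).rank ≤ (flatA ψ).rank := by
  have : flatA (localOp A B C ψ) = A * (flatA ψ * (Matrix.of fun p q => B q.1 p.1 * C q.2 p.2 :
      Matrix (Fin b × Fin c) (Fin e × Fin f) ℂ)) := by
    ext i q
    simp only [flatA, localOp, Matrix.mul_apply, Matrix.of_apply, Fintype.sum_prod_type,
      Finset.mul_sum]
    refine Finset.sum_congr rfl fun x _ => Finset.sum_congr rfl fun y _ =>
      Finset.sum_congr rfl fun w _ => ?_
    ring
  rw [this]
  exact (Matrix.rank_mul_le_right _ _).trans (Matrix.rank_mul_le_left _ _)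

theorem rank_flatB_localOp_le {a b c d e f : ℕ} (A : Matrix (Fin d) (Fin a) ℂ)
    (B : Matrix (Fin e) (Fin b) ℂ) (C : Matrix (Fin f) (Fin c) ℂ) (ψ : Tensor a b c) :
    (flatB (localOp A B C ψ)).rank ≤ (flatB ψ).rank := by
  have : flatB (localOp A B C ψ) = B * (flatB ψ * (Matrix.of fun p q => A q.1 p.1 * C q.2 p.2 :
      Matrix (Fin a × Fin c) (Fin d × Fin f) ℂ)) := by
    ext i q
    simp only [flatB, localOp, Matrix.mul_apply, Matrix.of_apply, Fintype.sum_prod_type,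
      Finset.mul_sum]
    rw [Finset.sum_comm]
    refine Finset.sum_congr rfl fun x _ => Finset.sum_congr rfl fun y _ =>
      Finset.sum_congr rfl fun w _ => ?_
    ring
  rw [this]
  exact (Matrix.rank_mul_le_right _ _).trans (Matrix.rank_mul_le_left _ _)

theorem rank_flatC_localOp_le {a b c d e f : ℕ} (A : Matrix (Fin d) (Fin a) ℂ)
    (B : Matrix (Fin e) (Fin b) ℂ) (C : Matrix (Fin f) (Fin c) ℂ) (ψ : Tensor a b c) :
    (flatC (localOp A B C ψ)).rank ≤ (flatC ψ).rank := by
  have : flatC (localOp A B C ψ) = C * (flatC ψ * (Matrix.of fun p q => A q.1 p.1 * B q.2 p.2 :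
      Matrix (Fin a × Fin b) (Fin d × Fin e) ℂ)) := by
    ext i q
    simp only [flatC, localOp, Matrix.mul_apply, Matrix.of_apply, Finset.mul_sum]
    conv_rhs => rw [Finset.sum_comm]
    rw [Fintype.sum_prod_type]
    refine Finset.sum_congr rfl fun x _ => Finset.sum_congr rfl fun y _ =>
      Finset.sum_congr rfl fun w _ => ?_
    ring
  rw [this]
  exact (Matrix.rank_mul_le_right _ _).trans (Matrix.rank_mul_le_left _ _)

theorem MutuallyRestrict.localRanks_eq {a b c d e f : ℕ} {ψ : Tensor a b c} {φ : Tensor d e f}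
    (h : MutuallyRestrict ψ φ) : localRanks ψ = localRanks φ := by
  obtain ⟨⟨A, B, C, h⟩, ⟨A', B', C', h'⟩⟩ := h
  simp only [localRanks, rank_rhoA, rank_rhoB, rank_rhoC, Prod.mk.injEq]
  refine ⟨le_antisymm ?_ ?_, le_antisymm ?_ ?_, le_antisymm ?_ ?_⟩
  · rw [h']; exact rank_flatA_localOp_le ..
  · rw [h]; exact rank_flatA_localOp_le ..
  · rw [h']; exact rank_flatB_localOp_le ..
  · rw [h]; exact rank_flatB_localOp_le ..
  · rw [h']; exact rank_flatC_localOp_le ..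
  · rw [h]; exact rank_flatC_localOp_le ..

/-- The reduced density operator of Alice has full rank. -/
def ConciseA {a b c : ℕ} (ψ : Tensor a b c) : Prop :=
  ∀ x : Fin a → ℂ, (∀ j k, ∑ i, x i * ψ i j k = 0) → x = 0

/-- The reduced density operator of Bob has full rank. -/
def ConciseB {a b c : ℕ} (ψ : Tensor a b c) : Prop :=
  ∀ y : Fin b → ℂ, (∀ i k, ∑ j, y j * ψ i j k = 0) → y = 0

/-- The reduced density operator of Charlie has full rank. -/
def ConciseC {a b c : ℕ} (ψ : Tensor a b c) : Prop :=
  ∀ z : Fin c → ℂ, (∀ i j, ∑ k, z k * ψ i j k = 0) → z = 0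

theorem localRanks_eq_of_concise {a b c : ℕ} {ψ : Tensor a b c} (hA : ConciseA ψ)
    (hB : ConciseB ψ) (hC : ConciseC ψ) : localRanks ψ = (a, b, c) := by
  simp only [localRanks, rank_rhoA, rank_rhoB, rank_rhoC, Prod.mk.injEq]
  refine ⟨?_, ?_, ?_⟩
  · have : LinearIndependent ℂ (flatA ψ).row := by
      refine Fintype.linearIndependent_iff.2 fun x hx => congrFun (hA x fun j k => ?_)
      simpa [flatA, Finset.sum_apply] using congrFun hx (j, k)
    simpa using this.rank_matrix
  · have : LinearIndependent ℂ (flatB ψ).row := by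
      refine Fintype.linearIndependent_iff.2 fun x hx => congrFun (hB x fun j k => ?_)
      simpa [flatB, Finset.sum_apply] using congrFun hx (j, k)
    simpa using this.rank_matrix
  · have : LinearIndependent ℂ (flatC ψ).row := by
      refine Fintype.linearIndependent_iff.2 fun x hx => congrFun (hC x fun j k => ?_)
      simpa [flatC, Finset.sum_apply] using congrFun hx (j, k)
    simpa using this.rank_matrix

/-! ### Tensor rank -/

/-- `ψ` is a sum of `s` product vectors, some of which may be zero. -/
def IsSumOfProducts {a b c : ℕ} (ψ : Tensor a b c) (s : ℕ) : Prop :=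
  ∃ (u : Fin s → Fin a → ℂ) (v : Fin s → Fin b → ℂ) (w : Fin s → Fin c → ℂ),
    ∀ i j k, ψ i j k = ∑ t, u t i * v t j * w t k

theorem IsSumOfProducts.localOp {a b c d e f s : ℕ} {ψ : Tensor a b c} (h : IsSumOfProducts ψ s)
    (A : Matrix (Fin d) (Fin a) ℂ) (B : Matrix (Fin e) (Fin b) ℂ) (C : Matrix (Fin f) (Fin c) ℂ) :
    IsSumOfProducts (localOp A B C ψ) s := by
  obtain ⟨u, v, w, h⟩ := h
  refine ⟨fun t => A *ᵥ u t, fun t => B *ᵥ v t, fun t => C *ᵥ w t, fun i j k => ?_⟩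
  simp only [SLOCC.localOp, h, Matrix.mulVec, dotProduct]
  calc
    _ = ∑ p : Fin a × Fin b × Fin c, ∑ t : Fin s, A i p.1 * B j p.2.1 * C k p.2.2 *
        (u t p.1 * v t p.2.1 * w t p.2.2) := by
      simp only [Fintype.sum_prod_type, Finset.mul_sum]
    _ = ∑ t : Fin s, ∑ p : Fin a × Fin b × Fin c, A i p.1 * B j p.2.1 * C k p.2.2 *
        (u t p.1 * v t p.2.1 * w t p.2.2) := Finset.sum_comm
    _ = _ := by
      simp only [Fintype.sum_prod_type]
      refine Finset.sum_congr rfl fun t _ => ?_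
      rw [Finset.sum_mul_sum, Finset.sum_mul]
      refine Finset.sum_congr rfl fun x _ => ?_
      rw [Finset.sum_mul]
      refine Finset.sum_congr rfl fun y _ => ?_
      rw [Finset.mul_sum]
      refine Finset.sum_congr rfl fun w _ => ?_
      ring

theorem mem_span_range_iff_isSumOfProducts {a b c : ℕ} {ψ : Tensor a b c} (hψ : ψ ≠ 0) (s : ℕ) :
    (∃ p : Fin s → Tensor a b c, (∀ t, IsProductState (p t)) ∧
      ψ ∈ Submodule.span ℂ (Set.range p)) ↔ IsSumOfProducts ψ s := by
  constructor
  · rintro ⟨p, hp, hmem⟩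
    obtain ⟨x, rfl⟩ := (Submodule.mem_span_range_iff_exists_fun ℂ).1 hmem
    choose u v w h using fun t => (hp t).2
    refine ⟨fun t => x t • u t, v, w, fun i j k => ?_⟩
    simp only [Finset.sum_apply, Pi.smul_apply, smul_eq_mul, h]
    refine Finset.sum_congr rfl fun t _ => ?_
    ring
  · rintro ⟨u, v, w, h⟩
    obtain ⟨i₀, hi⟩ := Function.ne_iff.1 hψ
    obtain ⟨j₀, hj⟩ := Function.ne_iff.1 hi
    obtain ⟨k₀, -⟩ := Function.ne_iff.1 hj
    -- Vanishing terms are replaced by a fixed product state.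
    let e : Tensor a b c := fun i j k => Pi.single (M := fun _ => ℂ) i₀ 1 i *
      Pi.single (M := fun _ => ℂ) j₀ 1 j * Pi.single (M := fun _ => ℂ) k₀ 1 k
    have he : e ≠ 0 := fun h0 => by
      simpa [e] using congrFun (congrFun (congrFun h0 i₀) j₀) k₀
    let q : Fin s → Tensor a b c := fun t i j k => u t i * v t j * w t k
    classical
    refine ⟨fun t => if q t = 0 then e else q t, fun t => ?_, ?_⟩
    · by_cases hq : q t = 0
      · simp only [hq, if_true]
        exact ⟨he, _, _, _, fun i j k => rfl⟩
      · simp only [hq, if_false]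
        exact ⟨hq, _, _, _, fun i j k => rfl⟩
    · have hsum : ψ = ∑ t, q t := by
        funext i j k
        simp [h, q, Finset.sum_apply]
      rw [hsum]
      refine Submodule.sum_mem _ fun t _ => ?_
      by_cases hq : q t = 0
      · rw [hq]; exact Submodule.zero_mem _
      · exact Submodule.subset_span ⟨t, by simp [hq]⟩

theorem hasTensorRank_iff {a b c : ℕ} {ψ : Tensor a b c} (hψ : ψ ≠ 0) (r : ℕ) :
    HasTensorRank ψ r ↔ IsLeast {s | IsSumOfProducts ψ s} r := by
  simp only [HasTensorRank, mem_span_range_iff_isSumOfProducts hψ]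

theorem MutuallyRestrict.hasTensorRank {a b c d e f r : ℕ} {ψ : Tensor a b c} {φ : Tensor d e f}
    (h : MutuallyRestrict ψ φ) (hφ : φ ≠ 0) (hr : HasTensorRank φ r) : HasTensorRank ψ r := by
  rw [hasTensorRank_iff (h.1.ne_zero hφ)]
  rw [hasTensorRank_iff hφ] at hr
  obtain ⟨⟨A, B, C, h⟩, ⟨A', B', C', h'⟩⟩ := h
  refine ⟨?_, fun s hs => hr.2 ?_⟩
  · rw [h']; exact hr.1.localOp _ _ _
  · change IsSumOfProducts φ s
    rw [h]; exact IsSumOfProducts.localOp hs _ _ _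

theorem ConciseA.le_of_isSumOfProducts {a b c s : ℕ} {ψ : Tensor a b c} (hψ : ConciseA ψ)
    (h : IsSumOfProducts ψ s) : a ≤ s := by
  obtain ⟨u, v, w, h⟩ := h
  have hinj : Function.Injective (Matrix.of u).mulVecLin := by
    rw [injective_iff_map_eq_zero]
    refine fun x hx => hψ x fun j k => ?_
    have hx' (t) : ∑ i, u t i * x i = 0 := congrFun hx t
    simp only [h, Finset.mul_sum]
    rw [Finset.sum_comm]
    refine Finset.sum_eq_zero fun t _ => ?_
    calc _ = (∑ i, u t i * x i) * (v t j * w t k) := by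
          rw [Finset.sum_mul]; exact Finset.sum_congr rfl fun i _ => by ring
      _ = 0 := by rw [hx', zero_mul]
  simpa using LinearMap.finrank_le_finrank_of_injective hinj

theorem ConciseB.le_of_isSumOfProducts {a b c s : ℕ} {ψ : Tensor a b c} (hψ : ConciseB ψ)
    (h : IsSumOfProducts ψ s) : b ≤ s := by
  obtain ⟨u, v, w, h⟩ := h
  have hinj : Function.Injective (Matrix.of v).mulVecLin := by
    rw [injective_iff_map_eq_zero]
    refine fun x hx => hψ x fun j k => ?_
    have hx' (t) : ∑ i, v t i * x i = 0 := congrFun hx t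
    simp only [h, Finset.mul_sum]
    rw [Finset.sum_comm]
    refine Finset.sum_eq_zero fun t _ => ?_
    calc _ = (∑ i, v t i * x i) * (u t j * w t k) := by
          rw [Finset.sum_mul]; exact Finset.sum_congr rfl fun i _ => by ring
      _ = 0 := by rw [hx', zero_mul]
  simpa using LinearMap.finrank_le_finrank_of_injective hinj

theorem ConciseC.mulVecLin_injective {a b c s : ℕ} {ψ : Tensor a b c} (hψ : ConciseC ψ)
    {u : Fin s → Fin a → ℂ} {v : Fin s → Fin b → ℂ} {w : Fin s → Fin c → ℂ}
    (h : ∀ i j k, ψ i j k = ∑ t, u t i * v t j * w t k) :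
    Function.Injective (Matrix.of w).mulVecLin := by
  rw [injective_iff_map_eq_zero]
  refine fun x hx => hψ x fun j k => ?_
  have hx' (t) : ∑ i, w t i * x i = 0 := congrFun hx t
  simp only [h, Finset.mul_sum]
  rw [Finset.sum_comm]
  refine Finset.sum_eq_zero fun t _ => ?_
  calc _ = (∑ i, w t i * x i) * (u t j * v t k) := by
        rw [Finset.sum_mul]; exact Finset.sum_congr rfl fun i _ => by ring
    _ = 0 := by rw [hx', zero_mul]

theorem ConciseC.le_of_isSumOfProducts {a b c s : ℕ} {ψ : Tensor a b c} (hψ : ConciseC ψ)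
    (h : IsSumOfProducts ψ s) : c ≤ s := by
  obtain ⟨u, v, w, h⟩ := h
  simpa using LinearMap.finrank_le_finrank_of_injective (hψ.mulVecLin_injective h)

/-- If the tensor rank of `ψ` equals the rank `c` of Charlie, then the space spanned by the `c`
slices of `ψ` is spanned by product vectors. Hence the tensor rank is larger than `c` as soon as
all product vectors in this space lie in a hyperplane, here a coordinate hyperplane with respect
to the basis of the slices. -/
theorem ConciseC.lt_of_isSumOfProducts {a b c s : ℕ} {ψ : Tensor a b c} (hψ : ConciseC ψ)
    (k₀ : Fin c) (hk : ∀ (z : Fin c → ℂ) (x : Fin a → ℂ) (y : Fin b → ℂ),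
      (∀ i j, ∑ k, z k * ψ i j k = x i * y j) → z k₀ = 0)
    (h : IsSumOfProducts ψ s) : c < s := by
  by_contra! hs
  have hcs := le_antisymm (hψ.le_of_isSumOfProducts h) hs
  obtain ⟨u, v, w, h⟩ := h
  have hinj := hψ.mulVecLin_injective h
  have hsurj := (LinearMap.injective_iff_surjective_of_finrank_eq_finrank (by simpa)).1 hinj
  choose z hz using fun t : Fin s => hsurj (Pi.single t 1)
  have hz0 (t : Fin s) : z t k₀ = 0 := by
    refine hk (z t) (u t) (v t) fun i j => ?_
    have hz' (t') : ∑ k, w t' k * z t k = if t' = t then 1 else 0 := by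
      simpa [Matrix.mulVec, dotProduct, Pi.single_apply] using congrFun (hz t) t'
    simp only [h, Finset.mul_sum]
    rw [Finset.sum_comm]
    calc _ = ∑ t', (∑ k, w t' k * z t k) * (u t' i * v t' j) := by
          refine Finset.sum_congr rfl fun t' _ => ?_
          rw [Finset.sum_mul]; exact Finset.sum_congr rfl fun k _ => by ring
      _ = _ := by simp [hz']
  have : Pi.single k₀ 1 = ∑ t, w t k₀ • z t := hinj (by
    rw [map_sum]
    simp only [map_smul, hz]
    funext t
    simp [Finset.sum_apply, Pi.single_apply])
  simpa [Finset.sum_apply, hz0] using congrFun this k₀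

/-! ### Removal of superfluous dimensions -/

/-- Padding with zeros does not change a tensor up to mutual restriction. -/
theorem mutuallyRestrict_of_padding {a b c d e f : ℕ} {ψ : Tensor a b c} {φ : Tensor d e f}
    {σ : Fin a → Fin d} {τ : Fin b → Fin e} {ρ : Fin c → Fin f} (hσ : σ.Injective)
    (hτ : τ.Injective) (hρ : ρ.Injective) (hφ : ∀ i j k, φ (σ i) (τ j) (ρ k) = ψ i j k)
    (hφ₀ : ∀ x y z, φ x y z ≠ 0 → (∃ i, σ i = x) ∧ (∃ j, τ j = y) ∧ ∃ k, ρ k = z) :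
    MutuallyRestrict φ ψ := by
  refine ⟨⟨Matrix.of fun i x => if σ i = x then 1 else 0, Matrix.of fun j y => if τ j = y then 1
    else 0, Matrix.of fun k z => if ρ k = z then 1 else 0, ?_⟩,
    ⟨Matrix.of fun x i => if σ i = x then 1 else 0, Matrix.of fun y j => if τ j = y then 1
    else 0, Matrix.of fun z k => if ρ k = z then 1 else 0, ?_⟩⟩
  · funext i j k
    simp [localOp, hφ]
  · funext x y z
    by_cases h : (∃ i, σ i = x) ∧ (∃ j, τ j = y) ∧ ∃ k, ρ k = z
    · obtain ⟨⟨i, rfl⟩, ⟨j, rfl⟩, ⟨k, rfl⟩⟩ := h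
      simp [localOp, hφ, hσ.eq_iff, hτ.eq_iff, hρ.eq_iff]
    · rw [not_imp_comm.1 (hφ₀ x y z) h, localOp]
      refine (Finset.sum_eq_zero fun i _ => Finset.sum_eq_zero fun j _ =>
        Finset.sum_eq_zero fun k _ => ?_).symm
      by_contra h0
      refine h ⟨⟨i, ?_⟩, ⟨j, ?_⟩, ⟨k, ?_⟩⟩ <;> by_contra h1 <;> simp [h1] at h0

/-- The block diagonal pencil without the leading zero block, as a tensor of format
`a × b × c`. For `a = 1` only the coefficients of `λ` are kept. -/
def core (a b c : ℕ) (Bs : List Block) : Tensor a b c :=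
  fun i j k => blockDiagonal Bs (Fin.ofNat 2 (2 - a + i)) j k

theorem mutuallyRestrict_kroneckerForm_core_two {b c m n : ℕ} {Bs : List Block}
    (hb : (Bs.map Block.rows).sum = b) (hc : (Bs.map Block.cols).sum = c) (hm : b ≤ m)
    (hn : c ≤ n) : MutuallyRestrict (kroneckerForm m n Bs) (core 2 b c Bs) := by
  refine mutuallyRestrict_of_padding (σ := id) (τ := fun j => ⟨m - b + j, by omega⟩)
    (ρ := fun k => ⟨n - c + k, by omega⟩) Function.injective_id ?_ ?_ ?_ ?_
  · intro j j' h
    simpa [Fin.ext_iff] using h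
  · intro j j' h
    simpa [Fin.ext_iff] using h
  · intro i j k
    have hi : Fin.ofNat 2 i = i := Fin.ofNat_val_eq_self i
    simp [kroneckerForm, core, hb, hc, blockDiagonal, Block.rows, Block.cols]
  · intro x y z h
    refine ⟨⟨x, rfl⟩, ?_⟩
    simp only [kroneckerForm, hb, hc, blockDiagonal, Block.rows, Block.cols] at h
    split_ifs at h with h1 h2
    · refine absurd ?_ h
      unfold Block.coeff
      split_ifs <;> rfl
    · exact ⟨⟨⟨y - (m - b), by omega⟩, by ext; simp; omega⟩,
        ⟨⟨z - (n - c), by omega⟩, by ext; simp; omega⟩⟩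
    · exact absurd rfl h

theorem mutuallyRestrict_core_two_core_one {b c : ℕ} {Bs : List Block}
    (h : ∀ (j : Fin b) (k : Fin c), blockDiagonal Bs 0 j k = 0) :
    MutuallyRestrict (core 2 b c Bs) (core 1 b c Bs) := by
  refine mutuallyRestrict_of_padding (σ := fun _ => 1) (τ := id) (ρ := id)
    (fun _ _ _ => Subsingleton.elim _ _) Function.injective_id Function.injective_id ?_ ?_
  · intro i j k
    rw [Subsingleton.elim i 0]
    rfl
  · intro x y z hx
    refine ⟨⟨0, ?_⟩, ⟨y, rfl⟩, ⟨z, rfl⟩⟩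
    by_contra h1
    obtain rfl : x = 0 := by omega
    exact hx (h y z)

/-- A tensor with reduced density operators of full rank and with tensor rank `r`. -/
structure IsCore {a b c : ℕ} (ψ : Tensor a b c) (r : ℕ) : Prop where
  conciseA : ConciseA ψ
  conciseB : ConciseB ψ
  conciseC : ConciseC ψ
  isSumOfProducts : IsSumOfProducts ψ r
  le_of_isSumOfProducts : ∀ s, IsSumOfProducts ψ s → r ≤ s

theorem IsCore.ne_zero {a b c r : ℕ} {ψ : Tensor (a + 1) b c} (h : IsCore ψ r) : ψ ≠ 0 := by
  rintro rfl
  simpa using congrFun (h.conciseA (fun _ => 1) (by simp)) 0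

theorem IsCore.hasTensorRank {a b c r : ℕ} {ψ : Tensor (a + 1) b c} (h : IsCore ψ r) :
    HasTensorRank ψ r :=
  (hasTensorRank_iff h.ne_zero r).2 ⟨h.isSumOfProducts, fun s hs => h.le_of_isSumOfProducts s hs⟩

/-- The `2 × 2` minors of a product vector vanish. -/
theorem minor_eq_of_eq_mul {a b : ℕ} {M : Fin a → Fin b → ℂ} {x : Fin a → ℂ} {y : Fin b → ℂ}
    (h : ∀ i j, M i j = x i * y j) (i i' : Fin a) (j j' : Fin b) :
    M i j * M i' j' = M i j' * M i' j := by
  rw [h, h, h, h]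
  ring

/-! ### The representatives without superfluous dimensions -/

/-- The tensor `core 1 1 1` of the class `A_B_C`, entry by entry. -/
def coreA_B_C : Tensor 1 1 1 :=
  ![![![1]]]

theorem isCore_coreA_B_C : IsCore coreA_B_C 1 := by
  have hA : ConciseA coreA_B_C := by
    intro x h
    ext i
    simpa [coreA_B_C, Subsingleton.elim i 0] using h 0 0
  have hB : ConciseB coreA_B_C := by
    intro x h
    ext i
    simpa [coreA_B_C, Subsingleton.elim i 0] using h 0 0
  have hC : ConciseC coreA_B_C := by
    intro x h
    ext i
    simpa [coreA_B_C, Subsingleton.elim i 0] using h 0 0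
  refine ⟨hA, hB, hC, ⟨![![1]], ![![1]], ![![1]],
    by simp [coreA_B_C]⟩, fun s hs => ?_⟩
  exact hA.le_of_isSumOfProducts hs

/-- The tensor `core 2 2 1` of the class `AB_C`, entry by entry. -/
def coreAB_C : Tensor 2 2 1 :=
  ![![![0], ![1]], ![![1], ![0]]]

theorem isCore_coreAB_C : IsCore coreAB_C 2 := by
  have hA : ConciseA coreAB_C := by
    intro x h
    simp [coreAB_C, Fin.forall_fin_succ, Fin.sum_univ_succ] at h
    ext i; fin_cases i <;> simp_all
  have hB : ConciseB coreAB_C := by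
    intro x h
    simp [coreAB_C, Fin.forall_fin_succ, Fin.sum_univ_succ] at h
    ext i; fin_cases i <;> simp_all
  have hC : ConciseC coreAB_C := by
    intro x h
    ext i
    simpa [coreAB_C, Subsingleton.elim i 0] using h 1 0
  refine ⟨hA, hB, hC, ⟨![![0, 1], ![1, 0]], ![![1, 0], ![0, 1]], ![![1], ![1]],
    by simp [coreAB_C, Fin.forall_fin_succ, Fin.sum_univ_succ]⟩, fun s hs => ?_⟩
  exact hA.le_of_isSumOfProducts hs

/-- The tensor `core 2 1 2` of the class `AC_B`, entry by entry. -/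
def coreAC_B : Tensor 2 1 2 :=
  ![![![0, 1]], ![![1, 0]]]

theorem isCore_coreAC_B : IsCore coreAC_B 2 := by
  have hA : ConciseA coreAC_B := by
    intro x h
    simp [coreAC_B, Fin.forall_fin_succ, Fin.sum_univ_succ] at h
    ext i; fin_cases i <;> simp_all
  have hB : ConciseB coreAC_B := by
    intro x h
    ext i
    simpa [coreAC_B, Subsingleton.elim i 0] using h 1 0
  have hC : ConciseC coreAC_B := by
    intro x h
    simp [coreAC_B, Fin.forall_fin_succ, Fin.sum_univ_succ] at h
    ext i; fin_cases i <;> simp_all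
  refine ⟨hA, hB, hC, ⟨![![0, 1], ![1, 0]], ![![1], ![1]], ![![1, 0], ![0, 1]],
    by simp [coreAC_B, Fin.forall_fin_succ, Fin.sum_univ_succ]⟩, fun s hs => ?_⟩
  exact hA.le_of_isSumOfProducts hs

/-- The tensor `core 1 2 2` of the class `A_BC1`, entry by entry. -/
def coreA_BC1 : Tensor 1 2 2 :=
  ![![![1, 0], ![0, 1]]]

theorem isCore_coreA_BC1 : IsCore coreA_BC1 2 := by
  have hA : ConciseA coreA_BC1 := by
    intro x h
    ext i
    simpa [coreA_BC1, Subsingleton.elim i 0] using h 0 0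
  have hB : ConciseB coreA_BC1 := by
    intro x h
    simp [coreA_BC1, Fin.forall_fin_succ, Fin.sum_univ_succ] at h
    ext i; fin_cases i <;> simp_all
  have hC : ConciseC coreA_BC1 := by
    intro x h
    simp [coreA_BC1, Fin.forall_fin_succ, Fin.sum_univ_succ] at h
    ext i; fin_cases i <;> simp_all
  refine ⟨hA, hB, hC, ⟨![![1], ![1]], ![![1, 0], ![0, 1]], ![![1, 0], ![0, 1]],
    by simp [coreA_BC1, Fin.forall_fin_succ, Fin.sum_univ_succ]⟩, fun s hs => ?_⟩
  exact hB.le_of_isSumOfProducts hs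

/-- The tensor `core 2 2 2` of the class `ABC1`, entry by entry. -/
def coreABC1 : Tensor 2 2 2 :=
  ![![![0, 0], ![0, 1]], ![![1, 0], ![0, 1]]]

theorem isCore_coreABC1 : IsCore coreABC1 2 := by
  have hA : ConciseA coreABC1 := by
    intro x h
    simp [coreABC1, Fin.forall_fin_succ, Fin.sum_univ_succ] at h
    ext i; fin_cases i
    exacts [(by linear_combination h.2 - h.1 : x 0 = 0), h.1]
  have hB : ConciseB coreABC1 := by
    intro x h
    simp [coreABC1, Fin.forall_fin_succ, Fin.sum_univ_succ] at h
    ext i; fin_cases i <;> simp_all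
  have hC : ConciseC coreABC1 := by
    intro x h
    simp [coreABC1, Fin.forall_fin_succ, Fin.sum_univ_succ] at h
    ext i; fin_cases i <;> simp_all
  refine ⟨hA, hB, hC, ⟨![![0, 1], ![1, 1]], ![![1, 0], ![0, 1]], ![![1, 0], ![0, 1]],
    by simp [coreABC1, Fin.forall_fin_succ, Fin.sum_univ_succ]⟩, fun s hs => ?_⟩
  exact hA.le_of_isSumOfProducts hs

/-- The tensor `core 2 2 2` of the class `ABC2`, entry by entry. -/
def coreABC2 : Tensor 2 2 2 :=
  ![![![0, 1], ![0, 0]], ![![1, 0], ![0, 1]]]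

theorem isCore_coreABC2 : IsCore coreABC2 3 := by
  have hA : ConciseA coreABC2 := by
    intro x h
    simp [coreABC2, Fin.forall_fin_succ, Fin.sum_univ_succ] at h
    ext i; fin_cases i <;> simp_all
  have hB : ConciseB coreABC2 := by
    intro x h
    simp [coreABC2, Fin.forall_fin_succ, Fin.sum_univ_succ] at h
    ext i; fin_cases i <;> simp_all
  have hC : ConciseC coreABC2 := by
    intro x h
    simp [coreABC2, Fin.forall_fin_succ, Fin.sum_univ_succ] at h
    ext i; fin_cases i <;> simp_all
  refine ⟨hA, hB, hC, ⟨![![0, 1], ![1, 0], ![0, 1]], ![![1, 0], ![1, 0], ![0, 1]], ![![1, 0],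
      ![0, 1], ![0, 1]],
    by simp [coreABC2, Fin.forall_fin_succ, Fin.sum_univ_succ]⟩, fun s hs => ?_⟩
  -- Some `2 × 2` minor of the combination of the slices with coefficients `z` is `± z 1 ^ 2`.
  refine hC.lt_of_isSumOfProducts 1 (fun z x y h => ?_) hs
  simpa [coreABC2, Fin.sum_univ_succ] using minor_eq_of_eq_mul h 0 1 0 1

/-- The tensor `core 2 2 3` of the class `ABC3`, entry by entry. -/
def coreABC3 : Tensor 2 2 3 :=
  ![![![0, 1, 0], ![0, 0, 0]], ![![1, 0, 0], ![0, 0, 1]]]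

theorem isCore_coreABC3 : IsCore coreABC3 3 := by
  have hA : ConciseA coreABC3 := by
    intro x h
    simp [coreABC3, Fin.forall_fin_succ, Fin.sum_univ_succ] at h
    ext i; fin_cases i <;> simp_all
  have hB : ConciseB coreABC3 := by
    intro x h
    simp [coreABC3, Fin.forall_fin_succ, Fin.sum_univ_succ] at h
    ext i; fin_cases i <;> simp_all
  have hC : ConciseC coreABC3 := by
    intro x h
    simp [coreABC3, Fin.forall_fin_succ, Fin.sum_univ_succ] at h
    ext i; fin_cases i <;> simp_all
  refine ⟨hA, hB, hC, ⟨![![0, 1], ![1, 0], ![0, 1]], ![![1, 0], ![1, 0], ![0, 1]], ![![1, 0, 0],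
      ![0, 1, 0], ![0, 0, 1]],
    by simp [coreABC3, Fin.forall_fin_succ, Fin.sum_univ_succ]⟩, fun s hs => ?_⟩
  exact hC.le_of_isSumOfProducts hs

/-- The tensor `core 2 2 3` of the class `ABC4`, entry by entry. -/
def coreABC4 : Tensor 2 2 3 :=
  ![![![0, 1, 0], ![0, 0, 1]], ![![1, 0, 0], ![0, 1, 0]]]

theorem isCore_coreABC4 : IsCore coreABC4 3 := by
  have hA : ConciseA coreABC4 := by
    intro x h
    simp [coreABC4, Fin.forall_fin_succ, Fin.sum_univ_succ] at h
    ext i; fin_cases i <;> simp_all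
  have hB : ConciseB coreABC4 := by
    intro x h
    simp [coreABC4, Fin.forall_fin_succ, Fin.sum_univ_succ] at h
    ext i; fin_cases i <;> simp_all
  have hC : ConciseC coreABC4 := by
    intro x h
    simp [coreABC4, Fin.forall_fin_succ, Fin.sum_univ_succ] at h
    ext i; fin_cases i <;> simp_all
  refine ⟨hA, hB, hC, ⟨![![0, 1], ![1, 0], ![1, 1]], ![![1, 0], ![0, 1], ![1, 1]], ![![1, -1,
      0], ![0, -1, 1], ![0, 1, 0]],
    by simp [coreABC4, Fin.forall_fin_succ, Fin.sum_univ_succ]⟩, fun s hs => ?_⟩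
  exact hC.le_of_isSumOfProducts hs

/-- The tensor `core 2 2 4` of the class `ABC5`, entry by entry. -/
def coreABC5 : Tensor 2 2 4 :=
  ![![![0, 1, 0, 0], ![0, 0, 0, 1]], ![![1, 0, 0, 0], ![0, 0, 1, 0]]]

theorem isCore_coreABC5 : IsCore coreABC5 4 := by
  have hA : ConciseA coreABC5 := by
    intro x h
    simp [coreABC5, Fin.forall_fin_succ, Fin.sum_univ_succ] at h
    ext i; fin_cases i <;> simp_all
  have hB : ConciseB coreABC5 := by
    intro x h
    simp [coreABC5, Fin.forall_fin_succ, Fin.sum_univ_succ] at h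
    ext i; fin_cases i <;> simp_all
  have hC : ConciseC coreABC5 := by
    intro x h
    simp [coreABC5, Fin.forall_fin_succ, Fin.sum_univ_succ] at h
    ext i; fin_cases i <;> simp_all
  refine ⟨hA, hB, hC, ⟨![![0, 1], ![1, 0], ![0, 1], ![1, 0]], ![![1, 0], ![1, 0], ![0, 1], ![0,
      1]], ![![1, 0, 0, 0], ![0, 1, 0, 0], ![0, 0, 1, 0], ![0, 0, 0, 1]],
    by simp [coreABC5, Fin.forall_fin_succ, Fin.sum_univ_succ]⟩, fun s hs => ?_⟩
  exact hC.le_of_isSumOfProducts hs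

/-- The tensor `core 2 3 2` of the class `ABC6`, entry by entry. -/
def coreABC6 : Tensor 2 3 2 :=
  ![![![0, 0], ![1, 0], ![0, 0]], ![![1, 0], ![0, 0], ![0, 1]]]

theorem isCore_coreABC6 : IsCore coreABC6 3 := by
  have hA : ConciseA coreABC6 := by
    intro x h
    simp [coreABC6, Fin.forall_fin_succ, Fin.sum_univ_succ] at h
    ext i; fin_cases i <;> simp_all
  have hB : ConciseB coreABC6 := by
    intro x h
    simp [coreABC6, Fin.forall_fin_succ, Fin.sum_univ_succ] at h
    ext i; fin_cases i <;> simp_all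
  have hC : ConciseC coreABC6 := by
    intro x h
    simp [coreABC6, Fin.forall_fin_succ, Fin.sum_univ_succ] at h
    ext i; fin_cases i <;> simp_all
  refine ⟨hA, hB, hC, ⟨![![0, 1], ![1, 0], ![0, 1]], ![![1, 0, 0], ![0, 1, 0], ![0, 0, 1]],
      ![![1, 0], ![1, 0], ![0, 1]],
    by simp [coreABC6, Fin.forall_fin_succ, Fin.sum_univ_succ]⟩, fun s hs => ?_⟩
  exact hB.le_of_isSumOfProducts hs

/-- The tensor `core 2 3 2` of the class `ABC7`, entry by entry. -/
def coreABC7 : Tensor 2 3 2 :=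
  ![![![0, 0], ![1, 0], ![0, 1]], ![![1, 0], ![0, 1], ![0, 0]]]

theorem isCore_coreABC7 : IsCore coreABC7 3 := by
  have hA : ConciseA coreABC7 := by
    intro x h
    simp [coreABC7, Fin.forall_fin_succ, Fin.sum_univ_succ] at h
    ext i; fin_cases i <;> simp_all
  have hB : ConciseB coreABC7 := by
    intro x h
    simp [coreABC7, Fin.forall_fin_succ, Fin.sum_univ_succ] at h
    ext i; fin_cases i <;> simp_all
  have hC : ConciseC coreABC7 := by
    intro x h
    simp [coreABC7, Fin.forall_fin_succ, Fin.sum_univ_succ] at h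
    ext i; fin_cases i <;> simp_all
  refine ⟨hA, hB, hC, ⟨![![0, 1], ![1, 0], ![1, 1]], ![![1, -1, 0], ![0, -1, 1], ![0, 1, 0]],
      ![![1, 0], ![0, 1], ![1, 1]],
    by simp [coreABC7, Fin.forall_fin_succ, Fin.sum_univ_succ]⟩, fun s hs => ?_⟩
  exact hB.le_of_isSumOfProducts hs

/-- The tensor `core 2 3 3` of the class `ABC8`, entry by entry. -/
def coreABC8 : Tensor 2 3 3 :=
  ![![![0, 0, 0], ![0, 1, 0], ![0, 0, 2]], ![![1, 0, 0], ![0, 1, 0], ![0, 0, 1]]]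

theorem isCore_coreABC8 : IsCore coreABC8 3 := by
  have hA : ConciseA coreABC8 := by
    intro x h
    simp [coreABC8, Fin.forall_fin_succ, Fin.sum_univ_succ] at h
    ext i; fin_cases i
    exacts [(by linear_combination h.2.1 - h.1 : x 0 = 0), h.1]
  have hB : ConciseB coreABC8 := by
    intro x h
    simp [coreABC8, Fin.forall_fin_succ, Fin.sum_univ_succ] at h
    ext i; fin_cases i <;> simp_all
  have hC : ConciseC coreABC8 := by
    intro x h
    simp [coreABC8, Fin.forall_fin_succ, Fin.sum_univ_succ] at h
    ext i; fin_cases i <;> simp_all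
  refine ⟨hA, hB, hC, ⟨![![0, 1], ![1, 1], ![2, 1]], ![![1, 0, 0], ![0, 1, 0], ![0, 0, 1]],
      ![![1, 0, 0], ![0, 1, 0], ![0, 0, 1]],
    by simp [coreABC8, Fin.forall_fin_succ, Fin.sum_univ_succ]⟩, fun s hs => ?_⟩
  exact hB.le_of_isSumOfProducts hs

/-- The tensor `core 2 3 3` of the class `ABC9`, entry by entry. -/
def coreABC9 : Tensor 2 3 3 :=
  ![![![0, 0, 0], ![0, 0, 0], ![0, 0, 1]], ![![1, 0, 0], ![0, 1, 0], ![0, 0, 1]]]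

theorem isCore_coreABC9 : IsCore coreABC9 3 := by
  have hA : ConciseA coreABC9 := by
    intro x h
    simp [coreABC9, Fin.forall_fin_succ, Fin.sum_univ_succ] at h
    ext i; fin_cases i
    exacts [(by linear_combination h.2 - h.1 : x 0 = 0), h.1]
  have hB : ConciseB coreABC9 := by
    intro x h
    simp [coreABC9, Fin.forall_fin_succ, Fin.sum_univ_succ] at h
    ext i; fin_cases i <;> simp_all
  have hC : ConciseC coreABC9 := by
    intro x h
    simp [coreABC9, Fin.forall_fin_succ, Fin.sum_univ_succ] at h
    ext i; fin_cases i <;> simp_all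
  refine ⟨hA, hB, hC, ⟨![![0, 1], ![0, 1], ![1, 1]], ![![1, 0, 0], ![0, 1, 0], ![0, 0, 1]],
      ![![1, 0, 0], ![0, 1, 0], ![0, 0, 1]],
    by simp [coreABC9, Fin.forall_fin_succ, Fin.sum_univ_succ]⟩, fun s hs => ?_⟩
  exact hB.le_of_isSumOfProducts hs

/-- The tensor `core 1 3 3` of the class `A_BC2`, entry by entry. -/
def coreA_BC2 : Tensor 1 3 3 :=
  ![![![1, 0, 0], ![0, 1, 0], ![0, 0, 1]]]

theorem isCore_coreA_BC2 : IsCore coreA_BC2 3 := by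
  have hA : ConciseA coreA_BC2 := by
    intro x h
    ext i
    simpa [coreA_BC2, Subsingleton.elim i 0] using h 0 0
  have hB : ConciseB coreA_BC2 := by
    intro x h
    simp [coreA_BC2, Fin.forall_fin_succ, Fin.sum_univ_succ] at h
    ext i; fin_cases i <;> simp_all
  have hC : ConciseC coreA_BC2 := by
    intro x h
    simp [coreA_BC2, Fin.forall_fin_succ, Fin.sum_univ_succ] at h
    ext i; fin_cases i <;> simp_all
  refine ⟨hA, hB, hC, ⟨![![1], ![1], ![1]], ![![1, 0, 0], ![0, 1, 0], ![0, 0, 1]], ![![1, 0, 0],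
      ![0, 1, 0], ![0, 0, 1]],
    by simp [coreA_BC2, Fin.forall_fin_succ, Fin.sum_univ_succ]⟩, fun s hs => ?_⟩
  exact hB.le_of_isSumOfProducts hs

/-- The tensor `core 2 3 3` of the class `ABC10`, entry by entry. -/
def coreABC10 : Tensor 2 3 3 :=
  ![![![0, 1, 0], ![0, 0, 0], ![0, 0, 1]], ![![1, 0, 0], ![0, 0, 1], ![0, 0, 0]]]

theorem isCore_coreABC10 : IsCore coreABC10 4 := by
  have hA : ConciseA coreABC10 := by
    intro x h
    simp [coreABC10, Fin.forall_fin_succ, Fin.sum_univ_succ] at h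
    ext i; fin_cases i <;> simp_all
  have hB : ConciseB coreABC10 := by
    intro x h
    simp [coreABC10, Fin.forall_fin_succ, Fin.sum_univ_succ] at h
    ext i; fin_cases i <;> simp_all
  have hC : ConciseC coreABC10 := by
    intro x h
    simp [coreABC10, Fin.forall_fin_succ, Fin.sum_univ_succ] at h
    ext i; fin_cases i <;> simp_all
  refine ⟨hA, hB, hC, ⟨![![0, 1], ![1, 0], ![0, 1], ![1, 0]], ![![1, 0, 0], ![1, 0, 0], ![0, 1,
      0], ![0, 0, 1]], ![![1, 0, 0], ![0, 1, 0], ![0, 0, 1], ![0, 0, 1]],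
    by simp [coreABC10, Fin.forall_fin_succ, Fin.sum_univ_succ]⟩, fun s hs => ?_⟩
  -- Some `2 × 2` minor of the combination of the slices with coefficients `z` is `± z 2 ^ 2`.
  refine hC.lt_of_isSumOfProducts 2 (fun z x y h => ?_) hs
  simpa [coreABC10, Fin.sum_univ_succ] using minor_eq_of_eq_mul h 0 1 1 2

/-- The tensor `core 2 3 3` of the class `ABC11`, entry by entry. -/
def coreABC11 : Tensor 2 3 3 :=
  ![![![0, 1, 0], ![0, 0, 0], ![0, 0, 0]], ![![1, 0, 0], ![0, 1, 0], ![0, 0, 1]]]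

theorem isCore_coreABC11 : IsCore coreABC11 4 := by
  have hA : ConciseA coreABC11 := by
    intro x h
    simp [coreABC11, Fin.forall_fin_succ, Fin.sum_univ_succ] at h
    ext i; fin_cases i <;> simp_all
  have hB : ConciseB coreABC11 := by
    intro x h
    simp [coreABC11, Fin.forall_fin_succ, Fin.sum_univ_succ] at h
    ext i; fin_cases i <;> simp_all
  have hC : ConciseC coreABC11 := by
    intro x h
    simp [coreABC11, Fin.forall_fin_succ, Fin.sum_univ_succ] at h
    ext i; fin_cases i <;> simp_all
  refine ⟨hA, hB, hC, ⟨![![0, 1], ![1, 0], ![0, 1], ![0, 1]], ![![1, 0, 0], ![1, 0, 0], ![0, 1,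
      0], ![0, 0, 1]], ![![1, 0, 0], ![0, 1, 0], ![0, 1, 0], ![0, 0, 1]],
    by simp [coreABC11, Fin.forall_fin_succ, Fin.sum_univ_succ]⟩, fun s hs => ?_⟩
  -- Some `2 × 2` minor of the combination of the slices with coefficients `z` is `± z 1 ^ 2`.
  refine hC.lt_of_isSumOfProducts 1 (fun z x y h => ?_) hs
  simpa [coreABC11, Fin.sum_univ_succ] using minor_eq_of_eq_mul h 0 1 0 1

/-- The tensor `core 2 3 3` of the class `ABC12`, entry by entry. -/
def coreABC12 : Tensor 2 3 3 :=
  ![![![0, 1, 0], ![0, 0, 0], ![0, 0, 1]], ![![1, 0, 0], ![0, 1, 0], ![0, 0, 1]]]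

theorem isCore_coreABC12 : IsCore coreABC12 4 := by
  have hA : ConciseA coreABC12 := by
    intro x h
    simp [coreABC12, Fin.forall_fin_succ, Fin.sum_univ_succ] at h
    ext i; fin_cases i <;> simp_all
  have hB : ConciseB coreABC12 := by
    intro x h
    simp [coreABC12, Fin.forall_fin_succ, Fin.sum_univ_succ] at h
    ext i; fin_cases i <;> simp_all
  have hC : ConciseC coreABC12 := by
    intro x h
    simp [coreABC12, Fin.forall_fin_succ, Fin.sum_univ_succ] at h
    ext i; fin_cases i <;> simp_all
  refine ⟨hA, hB, hC, ⟨![![0, 1], ![1, 0], ![0, 1], ![1, 1]], ![![1, 0, 0], ![1, 0, 0], ![0, 1,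
      0], ![0, 0, 1]], ![![1, 0, 0], ![0, 1, 0], ![0, 1, 0], ![0, 0, 1]],
    by simp [coreABC12, Fin.forall_fin_succ, Fin.sum_univ_succ]⟩, fun s hs => ?_⟩
  -- Some `2 × 2` minor of the combination of the slices with coefficients `z` is `± z 1 ^ 2`.
  refine hC.lt_of_isSumOfProducts 1 (fun z x y h => ?_) hs
  simpa [coreABC12, Fin.sum_univ_succ] using minor_eq_of_eq_mul h 0 1 0 1

/-- The tensor `core 2 3 3` of the class `ABC13`, entry by entry. -/
def coreABC13 : Tensor 2 3 3 :=
  ![![![0, 1, 0], ![0, 0, 1], ![0, 0, 0]], ![![1, 0, 0], ![0, 1, 0], ![0, 0, 1]]]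

theorem isCore_coreABC13 : IsCore coreABC13 4 := by
  have hA : ConciseA coreABC13 := by
    intro x h
    simp [coreABC13, Fin.forall_fin_succ, Fin.sum_univ_succ] at h
    ext i; fin_cases i <;> simp_all
  have hB : ConciseB coreABC13 := by
    intro x h
    simp [coreABC13, Fin.forall_fin_succ, Fin.sum_univ_succ] at h
    ext i; fin_cases i <;> simp_all
  have hC : ConciseC coreABC13 := by
    intro x h
    simp [coreABC13, Fin.forall_fin_succ, Fin.sum_univ_succ] at h
    ext i; fin_cases i <;> simp_all
  refine ⟨hA, hB, hC, ⟨![![0, 1], ![1, 0], ![1, 1], ![0, 1]], ![![1, 0, 0], ![0, 1, 0], ![1, 1,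
      0], ![0, 0, 1]], ![![1, -1, 0], ![0, -1, 1], ![0, 1, 0], ![0, 0, 1]],
    by simp [coreABC13, Fin.forall_fin_succ, Fin.sum_univ_succ]⟩, fun s hs => ?_⟩
  -- Some `2 × 2` minor of the combination of the slices with coefficients `z` is `± z 2 ^ 2`.
  refine hC.lt_of_isSumOfProducts 2 (fun z x y h => ?_) hs
  simpa [coreABC13, Fin.sum_univ_succ] using minor_eq_of_eq_mul h 0 1 1 2

/-- The tensor `core 2 3 4` of the class `ABC14`, entry by entry. -/
def coreABC14 : Tensor 2 3 4 :=
  ![![![0, 1, 0, 0], ![0, 0, 0, 0], ![0, 0, 0, 0]], ![![1, 0, 0, 0], ![0, 0, 1, 0], ![0, 0, 0,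
    1]]]

theorem isCore_coreABC14 : IsCore coreABC14 4 := by
  have hA : ConciseA coreABC14 := by
    intro x h
    simp [coreABC14, Fin.forall_fin_succ, Fin.sum_univ_succ] at h
    ext i; fin_cases i <;> simp_all
  have hB : ConciseB coreABC14 := by
    intro x h
    simp [coreABC14, Fin.forall_fin_succ, Fin.sum_univ_succ] at h
    ext i; fin_cases i <;> simp_all
  have hC : ConciseC coreABC14 := by
    intro x h
    simp [coreABC14, Fin.forall_fin_succ, Fin.sum_univ_succ] at h
    ext i; fin_cases i <;> simp_all
  refine ⟨hA, hB, hC, ⟨![![0, 1], ![1, 0], ![0, 1], ![0, 1]], ![![1, 0, 0], ![1, 0, 0], ![0, 1,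
      0], ![0, 0, 1]], ![![1, 0, 0, 0], ![0, 1, 0, 0], ![0, 0, 1, 0], ![0, 0, 0, 1]],
    by simp [coreABC14, Fin.forall_fin_succ, Fin.sum_univ_succ]⟩, fun s hs => ?_⟩
  exact hC.le_of_isSumOfProducts hs

/-- The tensor `core 2 3 4` of the class `ABC15`, entry by entry. -/
def coreABC15 : Tensor 2 3 4 :=
  ![![![0, 1, 0, 0], ![0, 0, 0, 0], ![0, 0, 0, 1]], ![![1, 0, 0, 0], ![0, 0, 1, 0], ![0, 0, 0,
    1]]]

theorem isCore_coreABC15 : IsCore coreABC15 4 := by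
  have hA : ConciseA coreABC15 := by
    intro x h
    simp [coreABC15, Fin.forall_fin_succ, Fin.sum_univ_succ] at h
    ext i; fin_cases i <;> simp_all
  have hB : ConciseB coreABC15 := by
    intro x h
    simp [coreABC15, Fin.forall_fin_succ, Fin.sum_univ_succ] at h
    ext i; fin_cases i <;> simp_all
  have hC : ConciseC coreABC15 := by
    intro x h
    simp [coreABC15, Fin.forall_fin_succ, Fin.sum_univ_succ] at h
    ext i; fin_cases i <;> simp_all
  refine ⟨hA, hB, hC, ⟨![![0, 1], ![1, 0], ![0, 1], ![1, 1]], ![![1, 0, 0], ![1, 0, 0], ![0, 1,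
      0], ![0, 0, 1]], ![![1, 0, 0, 0], ![0, 1, 0, 0], ![0, 0, 1, 0], ![0, 0, 0, 1]],
    by simp [coreABC15, Fin.forall_fin_succ, Fin.sum_univ_succ]⟩, fun s hs => ?_⟩
  exact hC.le_of_isSumOfProducts hs

/-- The tensor `core 2 3 4` of the class `ABC16`, entry by entry. -/
def coreABC16 : Tensor 2 3 4 :=
  ![![![0, 1, 0, 0], ![0, 0, 0, 1], ![0, 0, 0, 0]], ![![1, 0, 0, 0], ![0, 0, 1, 0], ![0, 0, 0,
    1]]]

theorem isCore_coreABC16 : IsCore coreABC16 5 := by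
  have hA : ConciseA coreABC16 := by
    intro x h
    simp [coreABC16, Fin.forall_fin_succ, Fin.sum_univ_succ] at h
    ext i; fin_cases i <;> simp_all
  have hB : ConciseB coreABC16 := by
    intro x h
    simp [coreABC16, Fin.forall_fin_succ, Fin.sum_univ_succ] at h
    ext i; fin_cases i <;> simp_all
  have hC : ConciseC coreABC16 := by
    intro x h
    simp [coreABC16, Fin.forall_fin_succ, Fin.sum_univ_succ] at h
    ext i; fin_cases i <;> simp_all
  refine ⟨hA, hB, hC, ⟨![![0, 1], ![1, 0], ![0, 1], ![1, 0], ![0, 1]], ![![1, 0, 0], ![1, 0, 0],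
      ![0, 1, 0], ![0, 1, 0], ![0, 0, 1]], ![![1, 0, 0, 0], ![0, 1, 0, 0], ![0, 0, 1, 0], ![0,
      0, 0, 1], ![0, 0, 0, 1]],
    by simp [coreABC16, Fin.forall_fin_succ, Fin.sum_univ_succ]⟩, fun s hs => ?_⟩
  -- Some `2 × 2` minor of the combination of the slices with coefficients `z` is `± z 3 ^ 2`.
  refine hC.lt_of_isSumOfProducts 3 (fun z x y h => ?_) hs
  simpa [coreABC16, Fin.sum_univ_succ] using minor_eq_of_eq_mul h 0 1 1 2

/-- The tensor `core 2 3 4` of the class `ABC17`, entry by entry. -/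
def coreABC17 : Tensor 2 3 4 :=
  ![![![0, 1, 0, 0], ![0, 0, 1, 0], ![0, 0, 0, 0]], ![![1, 0, 0, 0], ![0, 1, 0, 0], ![0, 0, 0,
    1]]]

theorem isCore_coreABC17 : IsCore coreABC17 4 := by
  have hA : ConciseA coreABC17 := by
    intro x h
    simp [coreABC17, Fin.forall_fin_succ, Fin.sum_univ_succ] at h
    ext i; fin_cases i <;> simp_all
  have hB : ConciseB coreABC17 := by
    intro x h
    simp [coreABC17, Fin.forall_fin_succ, Fin.sum_univ_succ] at h
    ext i; fin_cases i <;> simp_all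
  have hC : ConciseC coreABC17 := by
    intro x h
    simp [coreABC17, Fin.forall_fin_succ, Fin.sum_univ_succ] at h
    ext i; fin_cases i <;> simp_all
  refine ⟨hA, hB, hC, ⟨![![0, 1], ![1, 0], ![1, 1], ![0, 1]], ![![1, 0, 0], ![0, 1, 0], ![1, 1,
      0], ![0, 0, 1]], ![![1, -1, 0, 0], ![0, -1, 1, 0], ![0, 1, 0, 0], ![0, 0, 0, 1]],
    by simp [coreABC17, Fin.forall_fin_succ, Fin.sum_univ_succ]⟩, fun s hs => ?_⟩
  exact hC.le_of_isSumOfProducts hs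

/-- The tensor `core 2 3 4` of the class `ABC18`, entry by entry. -/
def coreABC18 : Tensor 2 3 4 :=
  ![![![0, 1, 0, 0], ![0, 0, 1, 0], ![0, 0, 0, 1]], ![![1, 0, 0, 0], ![0, 1, 0, 0], ![0, 0, 1,
    0]]]

theorem isCore_coreABC18 : IsCore coreABC18 4 := by
  have hA : ConciseA coreABC18 := by
    intro x h
    simp [coreABC18, Fin.forall_fin_succ, Fin.sum_univ_succ] at h
    ext i; fin_cases i <;> simp_all
  have hB : ConciseB coreABC18 := by
    intro x h
    simp [coreABC18, Fin.forall_fin_succ, Fin.sum_univ_succ] at h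
    ext i; fin_cases i <;> simp_all
  have hC : ConciseC coreABC18 := by
    intro x h
    simp [coreABC18, Fin.forall_fin_succ, Fin.sum_univ_succ] at h
    ext i; fin_cases i <;> simp_all
  refine ⟨hA, hB, hC, ⟨![![0, 1], ![1, 0], ![1, 1], ![-1, 1]], ![![1, 0, 0], ![0, 0, 1], ![1, 1,
      1], ![1, -1, 1]], ![![1, 0, -1, 0], ![0, -1, 0, 1], ![0, 1 / 2, 1 / 2, 0], ![0, -1 / 2,
      1 / 2, 0]],
    by norm_num [coreABC18, Fin.forall_fin_succ, Fin.sum_univ_succ]⟩, fun s hs => ?_⟩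
  exact hC.le_of_isSumOfProducts hs

/-- The tensor `core 2 3 5` of the class `ABC19`, entry by entry. -/
def coreABC19 : Tensor 2 3 5 :=
  ![![![0, 1, 0, 0, 0], ![0, 0, 0, 1, 0], ![0, 0, 0, 0, 0]], ![![1, 0, 0, 0, 0], ![0, 0, 1, 0,
    0], ![0, 0, 0, 0, 1]]]

theorem isCore_coreABC19 : IsCore coreABC19 5 := by
  have hA : ConciseA coreABC19 := by
    intro x h
    simp [coreABC19, Fin.forall_fin_succ, Fin.sum_univ_succ] at h
    ext i; fin_cases i <;> simp_all
  have hB : ConciseB coreABC19 := by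
    intro x h
    simp [coreABC19, Fin.forall_fin_succ, Fin.sum_univ_succ] at h
    ext i; fin_cases i <;> simp_all
  have hC : ConciseC coreABC19 := by
    intro x h
    simp [coreABC19, Fin.forall_fin_succ, Fin.sum_univ_succ] at h
    ext i; fin_cases i <;> simp_all
  refine ⟨hA, hB, hC, ⟨![![0, 1], ![1, 0], ![0, 1], ![1, 0], ![0, 1]], ![![1, 0, 0], ![1, 0, 0],
      ![0, 1, 0], ![0, 1, 0], ![0, 0, 1]], ![![1, 0, 0, 0, 0], ![0, 1, 0, 0, 0], ![0, 0, 1, 0,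
      0], ![0, 0, 0, 1, 0], ![0, 0, 0, 0, 1]],
    by simp [coreABC19, Fin.forall_fin_succ, Fin.sum_univ_succ]⟩, fun s hs => ?_⟩
  exact hC.le_of_isSumOfProducts hs

/-- The tensor `core 2 3 5` of the class `ABC20`, entry by entry. -/
def coreABC20 : Tensor 2 3 5 :=
  ![![![0, 1, 0, 0, 0], ![0, 0, 0, 1, 0], ![0, 0, 0, 0, 1]], ![![1, 0, 0, 0, 0], ![0, 0, 1, 0,
    0], ![0, 0, 0, 1, 0]]]

theorem isCore_coreABC20 : IsCore coreABC20 5 := by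
  have hA : ConciseA coreABC20 := by
    intro x h
    simp [coreABC20, Fin.forall_fin_succ, Fin.sum_univ_succ] at h
    ext i; fin_cases i <;> simp_all
  have hB : ConciseB coreABC20 := by
    intro x h
    simp [coreABC20, Fin.forall_fin_succ, Fin.sum_univ_succ] at h
    ext i; fin_cases i <;> simp_all
  have hC : ConciseC coreABC20 := by
    intro x h
    simp [coreABC20, Fin.forall_fin_succ, Fin.sum_univ_succ] at h
    ext i; fin_cases i <;> simp_all
  refine ⟨hA, hB, hC, ⟨![![0, 1], ![1, 0], ![0, 1], ![1, 0], ![1, 1]], ![![1, 0, 0], ![1, 0, 0],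
      ![0, 1, 0], ![0, 0, 1], ![0, 1, 1]], ![![1, 0, 0, 0, 0], ![0, 1, 0, 0, 0], ![0, 0, 1,
      -1, 0], ![0, 0, 0, -1, 1], ![0, 0, 0, 1, 0]],
    by simp [coreABC20, Fin.forall_fin_succ, Fin.sum_univ_succ]⟩, fun s hs => ?_⟩
  exact hC.le_of_isSumOfProducts hs

/-- The tensor `core 2 3 6` of the class `ABC21`, entry by entry. -/
def coreABC21 : Tensor 2 3 6 :=
  ![![![0, 1, 0, 0, 0, 0], ![0, 0, 0, 1, 0, 0], ![0, 0, 0, 0, 0, 1]], ![![1, 0, 0, 0, 0, 0],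
    ![0, 0, 1, 0, 0, 0], ![0, 0, 0, 0, 1, 0]]]

theorem isCore_coreABC21 : IsCore coreABC21 6 := by
  have hA : ConciseA coreABC21 := by
    intro x h
    simp [coreABC21, Fin.forall_fin_succ, Fin.sum_univ_succ] at h
    ext i; fin_cases i <;> simp_all
  have hB : ConciseB coreABC21 := by
    intro x h
    simp [coreABC21, Fin.forall_fin_succ, Fin.sum_univ_succ] at h
    ext i; fin_cases i <;> simp_all
  have hC : ConciseC coreABC21 := by
    intro x h
    simp [coreABC21, Fin.forall_fin_succ, Fin.sum_univ_succ] at h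
    ext i; fin_cases i <;> simp_all
  refine ⟨hA, hB, hC, ⟨![![0, 1], ![1, 0], ![0, 1], ![1, 0], ![0, 1], ![1, 0]], ![![1, 0, 0],
      ![1, 0, 0], ![0, 1, 0], ![0, 1, 0], ![0, 0, 1], ![0, 0, 1]], ![![1, 0, 0, 0, 0, 0], ![0,
      1, 0, 0, 0, 0], ![0, 0, 1, 0, 0, 0], ![0, 0, 0, 1, 0, 0], ![0, 0, 0, 0, 1, 0], ![0, 0,
      0, 0, 0, 1]],
    by simp [coreABC21, Fin.forall_fin_succ, Fin.sum_univ_succ]⟩, fun s hs => ?_⟩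
  exact hC.le_of_isSumOfProducts hs

theorem mutuallyRestrict_A_B_C {n : ℕ} (hn : 6 ≤ n) :
    MutuallyRestrict (ClassName.representative .A_B_C n) coreA_B_C := by
  have h : core 1 1 1 (ClassName.blocks .A_B_C) = coreA_B_C := by
    funext i j k
    fin_cases i <;> fin_cases j <;> fin_cases k <;> rfl
  refine h ▸ (mutuallyRestrict_kroneckerForm_core_two (b := 1) (c := 1) rfl rfl (
      by norm_num) (by omega)).trans (mutuallyRestrict_core_two_core_one fun j k => ?_)
  fin_cases j <;> fin_cases k <;> rfl

theorem mutuallyRestrict_AB_C {n : ℕ} (hn : 6 ≤ n) :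
    MutuallyRestrict (ClassName.representative .AB_C n) coreAB_C := by
  have h : core 2 2 1 (ClassName.blocks .AB_C) = coreAB_C := by
    funext i j k
    fin_cases i <;> fin_cases j <;> fin_cases k <;> rfl
  exact h ▸ mutuallyRestrict_kroneckerForm_core_two rfl rfl (by norm_num) (by omega)

theorem mutuallyRestrict_AC_B {n : ℕ} (hn : 6 ≤ n) :
    MutuallyRestrict (ClassName.representative .AC_B n) coreAC_B := by
  have h : core 2 1 2 (ClassName.blocks .AC_B) = coreAC_B := by
    funext i j k
    fin_cases i <;> fin_cases j <;> fin_cases k <;> rfl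
  exact h ▸ mutuallyRestrict_kroneckerForm_core_two rfl rfl (by norm_num) (by omega)

theorem mutuallyRestrict_A_BC1 {n : ℕ} (hn : 6 ≤ n) :
    MutuallyRestrict (ClassName.representative .A_BC1 n) coreA_BC1 := by
  have h : core 1 2 2 (ClassName.blocks .A_BC1) = coreA_BC1 := by
    funext i j k
    fin_cases i <;> fin_cases j <;> fin_cases k <;> rfl
  refine h ▸ (mutuallyRestrict_kroneckerForm_core_two (b := 2) (c := 2) rfl rfl (
      by norm_num) (by omega)).trans (mutuallyRestrict_core_two_core_one fun j k => ?_)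
  fin_cases j <;> fin_cases k <;> rfl

theorem mutuallyRestrict_ABC1 {n : ℕ} (hn : 6 ≤ n) :
    MutuallyRestrict (ClassName.representative .ABC1 n) coreABC1 := by
  have h : core 2 2 2 (ClassName.blocks .ABC1) = coreABC1 := by
    funext i j k
    fin_cases i <;> fin_cases j <;> fin_cases k <;> rfl
  exact h ▸ mutuallyRestrict_kroneckerForm_core_two rfl rfl (by norm_num) (by omega)

theorem mutuallyRestrict_ABC2 {n : ℕ} (hn : 6 ≤ n) :
    MutuallyRestrict (ClassName.representative .ABC2 n) coreABC2 := by
  have h : core 2 2 2 (ClassName.blocks .ABC2) = coreABC2 := by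
    funext i j k
    fin_cases i <;> fin_cases j <;> fin_cases k <;> rfl
  exact h ▸ mutuallyRestrict_kroneckerForm_core_two rfl rfl (by norm_num) (by omega)

theorem mutuallyRestrict_ABC3 {n : ℕ} (hn : 6 ≤ n) :
    MutuallyRestrict (ClassName.representative .ABC3 n) coreABC3 := by
  have h : core 2 2 3 (ClassName.blocks .ABC3) = coreABC3 := by
    funext i j k
    fin_cases i <;> fin_cases j <;> fin_cases k <;> rfl
  exact h ▸ mutuallyRestrict_kroneckerForm_core_two rfl rfl (by norm_num) (by omega)

theorem mutuallyRestrict_ABC4 {n : ℕ} (hn : 6 ≤ n) :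
    MutuallyRestrict (ClassName.representative .ABC4 n) coreABC4 := by
  have h : core 2 2 3 (ClassName.blocks .ABC4) = coreABC4 := by
    funext i j k
    fin_cases i <;> fin_cases j <;> fin_cases k <;> rfl
  exact h ▸ mutuallyRestrict_kroneckerForm_core_two rfl rfl (by norm_num) (by omega)

theorem mutuallyRestrict_ABC5 {n : ℕ} (hn : 6 ≤ n) :
    MutuallyRestrict (ClassName.representative .ABC5 n) coreABC5 := by
  have h : core 2 2 4 (ClassName.blocks .ABC5) = coreABC5 := by
    funext i j k
    fin_cases i <;> fin_cases j <;> fin_cases k <;> rfl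
  exact h ▸ mutuallyRestrict_kroneckerForm_core_two rfl rfl (by norm_num) (by omega)

theorem mutuallyRestrict_ABC6 {n : ℕ} (hn : 6 ≤ n) :
    MutuallyRestrict (ClassName.representative .ABC6 n) coreABC6 := by
  have h : core 2 3 2 (ClassName.blocks .ABC6) = coreABC6 := by
    funext i j k
    fin_cases i <;> fin_cases j <;> fin_cases k <;> rfl
  exact h ▸ mutuallyRestrict_kroneckerForm_core_two rfl rfl (by norm_num) (by omega)

theorem mutuallyRestrict_ABC7 {n : ℕ} (hn : 6 ≤ n) :
    MutuallyRestrict (ClassName.representative .ABC7 n) coreABC7 := by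
  have h : core 2 3 2 (ClassName.blocks .ABC7) = coreABC7 := by
    funext i j k
    fin_cases i <;> fin_cases j <;> fin_cases k <;> rfl
  exact h ▸ mutuallyRestrict_kroneckerForm_core_two rfl rfl (by norm_num) (by omega)

theorem mutuallyRestrict_ABC8 {n : ℕ} (hn : 6 ≤ n) :
    MutuallyRestrict (ClassName.representative .ABC8 n) coreABC8 := by
  have h : core 2 3 3 (ClassName.blocks .ABC8) = coreABC8 := by
    funext i j k
    fin_cases i <;> fin_cases j <;> fin_cases k <;> rfl
  exact h ▸ mutuallyRestrict_kroneckerForm_core_two rfl rfl (by norm_num) (by omega)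

theorem mutuallyRestrict_ABC9 {n : ℕ} (hn : 6 ≤ n) :
    MutuallyRestrict (ClassName.representative .ABC9 n) coreABC9 := by
  have h : core 2 3 3 (ClassName.blocks .ABC9) = coreABC9 := by
    funext i j k
    fin_cases i <;> fin_cases j <;> fin_cases k <;> rfl
  exact h ▸ mutuallyRestrict_kroneckerForm_core_two rfl rfl (by norm_num) (by omega)

theorem mutuallyRestrict_A_BC2 {n : ℕ} (hn : 6 ≤ n) :
    MutuallyRestrict (ClassName.representative .A_BC2 n) coreA_BC2 := by
  have h : core 1 3 3 (ClassName.blocks .A_BC2) = coreA_BC2 := by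
    funext i j k
    fin_cases i <;> fin_cases j <;> fin_cases k <;> rfl
  refine h ▸ (mutuallyRestrict_kroneckerForm_core_two (b := 3) (c := 3) rfl rfl (
      by norm_num) (by omega)).trans (mutuallyRestrict_core_two_core_one fun j k => ?_)
  fin_cases j <;> fin_cases k <;> rfl

theorem mutuallyRestrict_ABC10 {n : ℕ} (hn : 6 ≤ n) :
    MutuallyRestrict (ClassName.representative .ABC10 n) coreABC10 := by
  have h : core 2 3 3 (ClassName.blocks .ABC10) = coreABC10 := by
    funext i j k
    fin_cases i <;> fin_cases j <;> fin_cases k <;> rfl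
  exact h ▸ mutuallyRestrict_kroneckerForm_core_two rfl rfl (by norm_num) (by omega)

theorem mutuallyRestrict_ABC11 {n : ℕ} (hn : 6 ≤ n) :
    MutuallyRestrict (ClassName.representative .ABC11 n) coreABC11 := by
  have h : core 2 3 3 (ClassName.blocks .ABC11) = coreABC11 := by
    funext i j k
    fin_cases i <;> fin_cases j <;> fin_cases k <;> rfl
  exact h ▸ mutuallyRestrict_kroneckerForm_core_two rfl rfl (by norm_num) (by omega)

theorem mutuallyRestrict_ABC12 {n : ℕ} (hn : 6 ≤ n) :
    MutuallyRestrict (ClassName.representative .ABC12 n) coreABC12 := by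
  have h : core 2 3 3 (ClassName.blocks .ABC12) = coreABC12 := by
    funext i j k
    fin_cases i <;> fin_cases j <;> fin_cases k <;> rfl
  exact h ▸ mutuallyRestrict_kroneckerForm_core_two rfl rfl (by norm_num) (by omega)

theorem mutuallyRestrict_ABC13 {n : ℕ} (hn : 6 ≤ n) :
    MutuallyRestrict (ClassName.representative .ABC13 n) coreABC13 := by
  have h : core 2 3 3 (ClassName.blocks .ABC13) = coreABC13 := by
    funext i j k
    fin_cases i <;> fin_cases j <;> fin_cases k <;> rfl
  exact h ▸ mutuallyRestrict_kroneckerForm_core_two rfl rfl (by norm_num) (by omega)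

theorem mutuallyRestrict_ABC14 {n : ℕ} (hn : 6 ≤ n) :
    MutuallyRestrict (ClassName.representative .ABC14 n) coreABC14 := by
  have h : core 2 3 4 (ClassName.blocks .ABC14) = coreABC14 := by
    funext i j k
    fin_cases i <;> fin_cases j <;> fin_cases k <;> rfl
  exact h ▸ mutuallyRestrict_kroneckerForm_core_two rfl rfl (by norm_num) (by omega)

theorem mutuallyRestrict_ABC15 {n : ℕ} (hn : 6 ≤ n) :
    MutuallyRestrict (ClassName.representative .ABC15 n) coreABC15 := by
  have h : core 2 3 4 (ClassName.blocks .ABC15) = coreABC15 := by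
    funext i j k
    fin_cases i <;> fin_cases j <;> fin_cases k <;> rfl
  exact h ▸ mutuallyRestrict_kroneckerForm_core_two rfl rfl (by norm_num) (by omega)

theorem mutuallyRestrict_ABC16 {n : ℕ} (hn : 6 ≤ n) :
    MutuallyRestrict (ClassName.representative .ABC16 n) coreABC16 := by
  have h : core 2 3 4 (ClassName.blocks .ABC16) = coreABC16 := by
    funext i j k
    fin_cases i <;> fin_cases j <;> fin_cases k <;> rfl
  exact h ▸ mutuallyRestrict_kroneckerForm_core_two rfl rfl (by norm_num) (by omega)

theorem mutuallyRestrict_ABC17 {n : ℕ} (hn : 6 ≤ n) :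
    MutuallyRestrict (ClassName.representative .ABC17 n) coreABC17 := by
  have h : core 2 3 4 (ClassName.blocks .ABC17) = coreABC17 := by
    funext i j k
    fin_cases i <;> fin_cases j <;> fin_cases k <;> rfl
  exact h ▸ mutuallyRestrict_kroneckerForm_core_two rfl rfl (by norm_num) (by omega)

theorem mutuallyRestrict_ABC18 {n : ℕ} (hn : 6 ≤ n) :
    MutuallyRestrict (ClassName.representative .ABC18 n) coreABC18 := by
  have h : core 2 3 4 (ClassName.blocks .ABC18) = coreABC18 := by
    funext i j k
    fin_cases i <;> fin_cases j <;> fin_cases k <;> rfl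
  exact h ▸ mutuallyRestrict_kroneckerForm_core_two rfl rfl (by norm_num) (by omega)

theorem mutuallyRestrict_ABC19 {n : ℕ} (hn : 6 ≤ n) :
    MutuallyRestrict (ClassName.representative .ABC19 n) coreABC19 := by
  have h : core 2 3 5 (ClassName.blocks .ABC19) = coreABC19 := by
    funext i j k
    fin_cases i <;> fin_cases j <;> fin_cases k <;> rfl
  exact h ▸ mutuallyRestrict_kroneckerForm_core_two rfl rfl (by norm_num) (by omega)

theorem mutuallyRestrict_ABC20 {n : ℕ} (hn : 6 ≤ n) :
    MutuallyRestrict (ClassName.representative .ABC20 n) coreABC20 := by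
  have h : core 2 3 5 (ClassName.blocks .ABC20) = coreABC20 := by
    funext i j k
    fin_cases i <;> fin_cases j <;> fin_cases k <;> rfl
  exact h ▸ mutuallyRestrict_kroneckerForm_core_two rfl rfl (by norm_num) (by omega)

theorem mutuallyRestrict_ABC21 {n : ℕ} (hn : 6 ≤ n) :
    MutuallyRestrict (ClassName.representative .ABC21 n) coreABC21 := by
  have h : core 2 3 6 (ClassName.blocks .ABC21) = coreABC21 := by
    funext i j k
    fin_cases i <;> fin_cases j <;> fin_cases k <;> rfl
  exact h ▸ mutuallyRestrict_kroneckerForm_core_two rfl rfl (by norm_num) (by omega)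

/-! ### Product vectors orthogonal to the slices of Charlie -/

/-- The product vector `α ⊗ y` is orthogonal, for the bilinear form, to all slices `ψ · · k`.
For a pencil this means that `y` is in the left kernel of the matrix `α 0 R + α 1 S`. -/
def Annihilates {a b c : ℕ} (α : Fin a → ℂ) (y : Fin b → ℂ) (ψ : Tensor a b c) : Prop :=
  ∀ k, ∑ i, ∑ j, α i * y j * ψ i j k = 0

theorem annihilates_iff {a b c : ℕ} {α : Fin a → ℂ} {y : Fin b → ℂ} {ψ : Tensor a b c} :
    Annihilates α y ψ ↔
      localOp (Matrix.of fun _ : Fin 1 => α) (Matrix.of fun _ : Fin 1 => y)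
        (1 : Matrix (Fin c) (Fin c) ℂ) ψ = 0 := by
  simp [funext_iff, localOp, Annihilates, Matrix.one_apply]

theorem conciseA_iff {a b c : ℕ} {ψ : Tensor a b c} : ConciseA ψ ↔
    ∀ x : Fin a → ℂ, localOp (Matrix.of fun _ : Fin 1 => x) (1 : Matrix (Fin b) (Fin b) ℂ)
      (1 : Matrix (Fin c) (Fin c) ℂ) ψ = 0 → x = 0 := by
  simp [ConciseA, funext_iff, localOp, Matrix.one_apply]

theorem conciseB_iff {a b c : ℕ} {ψ : Tensor a b c} : ConciseB ψ ↔
    ∀ y : Fin b → ℂ, localOp (1 : Matrix (Fin a) (Fin a) ℂ) (Matrix.of fun _ : Fin 1 => y)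
      (1 : Matrix (Fin c) (Fin c) ℂ) ψ = 0 → y = 0 := by
  simp [ConciseB, funext_iff, localOp, Matrix.one_apply]

theorem of_row_mul {a b : ℕ} (x : Fin a → ℂ) (A : Matrix (Fin a) (Fin b) ℂ) :
    (Matrix.of fun _ : Fin 1 => x) * A = Matrix.of fun _ : Fin 1 => x ᵥ* A := by
  ext i j
  simp [Matrix.mul_apply, Matrix.vecMul, dotProduct]

/-- Local operators between tensors of the same format are invertible for Alice and Bob if the
result has reduced density operators of full rank; then they act on annihilating product
vectors. -/
theorem Restricts.exists_annihilates_equiv {a b c : ℕ} {ψ φ : Tensor a b c} (h : Restricts ψ φ)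
    (hA : ConciseA φ) (hB : ConciseB φ) :
    ∃ (e₁ : (Fin a → ℂ) ≃ₗ[ℂ] (Fin a → ℂ)) (e₂ : (Fin b → ℂ) ≃ₗ[ℂ] (Fin b → ℂ)),
      ∀ α y, Annihilates α y ψ → Annihilates (e₁ α) (e₂ y) φ := by
  obtain ⟨A, B, C, rfl⟩ := h
  have hA' : Function.Injective A.vecMulLinear := by
    rw [injective_iff_map_eq_zero]
    refine fun x hx => conciseA_iff.1 hA x ?_
    rw [localOp_localOp, of_row_mul]
    have hx' : x ᵥ* A = 0 := hx
    funext i j k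
    simp [hx', localOp]
  have hB' : Function.Injective B.vecMulLinear := by
    rw [injective_iff_map_eq_zero]
    refine fun x hx => conciseB_iff.1 hB x ?_
    rw [localOp_localOp, of_row_mul]
    have hx' : x ᵥ* B = 0 := hx
    funext i j k
    simp [hx', localOp]
  let e₁ := LinearEquiv.ofInjectiveEndo _ hA'
  let e₂ := LinearEquiv.ofInjectiveEndo _ hB'
  refine ⟨e₁.symm, e₂.symm, fun α y hα => ?_⟩
  have h₁ : e₁.symm α ᵥ* A = α := e₁.apply_symm_apply α
  have h₂ : e₂.symm y ᵥ* B = y := e₂.apply_symm_apply y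
  rw [annihilates_iff] at hα ⊢
  have key := localOp_localOp (1 : Matrix (Fin 1) (Fin 1) ℂ) (1 : Matrix (Fin 1) (Fin 1) ℂ) C
    (Matrix.of fun _ : Fin 1 => α) (Matrix.of fun _ : Fin 1 => y)
    1 ψ
  rw [hα, localOp_zero] at key
  rw [localOp_localOp, of_row_mul, of_row_mul, h₁, h₂, key, Matrix.one_mul, Matrix.one_mul,
    Matrix.one_mul, Matrix.mul_one]

/-- Some product vector annihilates `ψ`. -/
def HasAnnihilator {a b c : ℕ} (ψ : Tensor a b c) : Prop :=
  ∃ α y, α ≠ 0 ∧ y ≠ 0 ∧ Annihilates α y ψ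

/-- Two independent product vectors with the same first factor annihilate `ψ`. -/
def HasDoubleAnnihilator {a b c : ℕ} (ψ : Tensor a b c) : Prop :=
  ∃ α y y', α ≠ 0 ∧ LinearIndependent ℂ ![y, y'] ∧ Annihilates α y ψ ∧ Annihilates α y' ψ

/-- Two product vectors with independent first factors annihilate `ψ`. -/
def HasTwoAnnihilators {a b c : ℕ} (ψ : Tensor a b c) : Prop :=
  ∃ α α' y y', LinearIndependent ℂ ![α, α'] ∧ y ≠ 0 ∧ y' ≠ 0 ∧
    Annihilates α y ψ ∧ Annihilates α' y' ψ

/-- Every vector is the first factor of a product vector that annihilates `ψ`. -/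
def HasAllAnnihilators {a b c : ℕ} (ψ : Tensor a b c) : Prop :=
  ∀ α, ∃ y, y ≠ 0 ∧ Annihilates α y ψ

theorem linearIndependent_pair_map {m : ℕ} {x y : Fin m → ℂ} (h : LinearIndependent ℂ ![x, y])
    (e : (Fin m → ℂ) ≃ₗ[ℂ] (Fin m → ℂ)) : LinearIndependent ℂ ![e x, e y] := by
  have := h.map' e.toLinearMap e.ker
  rwa [show (e.toLinearMap : (Fin m → ℂ) → (Fin m → ℂ)) ∘ ![x, y] = ![e x, e y] by
    funext i; fin_cases i <;> rfl] at this

theorem Restricts.hasAnnihilator {a b c : ℕ} {ψ φ : Tensor a b c} (h : Restricts ψ φ)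
    (hA : ConciseA φ) (hB : ConciseB φ) (hψ : HasAnnihilator ψ) : HasAnnihilator φ := by
  obtain ⟨e₁, e₂, he⟩ := h.exists_annihilates_equiv hA hB
  obtain ⟨α, y, hα, hy, h⟩ := hψ
  exact ⟨_, _, e₁.map_ne_zero_iff.2 hα, e₂.map_ne_zero_iff.2 hy, he _ _ h⟩

theorem Restricts.hasDoubleAnnihilator {a b c : ℕ} {ψ φ : Tensor a b c} (h : Restricts ψ φ)
    (hA : ConciseA φ) (hB : ConciseB φ) (hψ : HasDoubleAnnihilator ψ) : HasDoubleAnnihilator φ := by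
  obtain ⟨e₁, e₂, he⟩ := h.exists_annihilates_equiv hA hB
  obtain ⟨α, y, y', hα, hy, h, h'⟩ := hψ
  exact ⟨_, _, _, e₁.map_ne_zero_iff.2 hα, linearIndependent_pair_map hy e₂, he _ _ h, he _ _ h'⟩

theorem Restricts.hasTwoAnnihilators {a b c : ℕ} {ψ φ : Tensor a b c} (h : Restricts ψ φ)
    (hA : ConciseA φ) (hB : ConciseB φ) (hψ : HasTwoAnnihilators ψ) : HasTwoAnnihilators φ := by
  obtain ⟨e₁, e₂, he⟩ := h.exists_annihilates_equiv hA hB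
  obtain ⟨α, α', y, y', hα, hy, hy', h, h'⟩ := hψ
  exact ⟨_, _, _, _, linearIndependent_pair_map hα e₁, e₂.map_ne_zero_iff.2 hy,
    e₂.map_ne_zero_iff.2 hy', he _ _ h, he _ _ h'⟩

theorem Restricts.hasAllAnnihilators {a b c : ℕ} {ψ φ : Tensor a b c} (h : Restricts ψ φ)
    (hA : ConciseA φ) (hB : ConciseB φ) (hψ : HasAllAnnihilators ψ) : HasAllAnnihilators φ := by
  obtain ⟨e₁, e₂, he⟩ := h.exists_annihilates_equiv hA hB
  intro α
  obtain ⟨y, hy, h⟩ := hψ (e₁.symm α)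
  exact ⟨_, e₂.map_ne_zero_iff.2 hy, by simpa using he _ _ h⟩

theorem exists_minor_ne_of_linearIndependent {m : ℕ} {x y : Fin m → ℂ}
    (h : LinearIndependent ℂ ![x, y]) : ∃ i j, x i * y j ≠ x j * y i := by
  by_contra! hm
  rw [LinearIndependent.pair_iff] at h
  have hy (j) : y j = 0 := (h (y j) (-x j) (by
    funext i
    simp only [Pi.add_apply, Pi.smul_apply, smul_eq_mul, Pi.zero_apply]
    linear_combination hm i j)).1
  have := h 0 1 (by funext i; simp [hy])
  simp at this

theorem linearIndependent_pair_of_minor_ne {m : ℕ} {x y : Fin m → ℂ} (i j : Fin m)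
    (h : x i * y j ≠ x j * y i) : LinearIndependent ℂ ![x, y] := by
  rw [LinearIndependent.pair_iff]
  intro s t hst
  have hi := congrFun hst i
  have hj := congrFun hst j
  simp only [Pi.add_apply, Pi.smul_apply, smul_eq_mul, Pi.zero_apply] at hi hj
  have h' : x i * y j - x j * y i ≠ 0 := sub_ne_zero.2 h
  constructor
  · exact (mul_eq_zero.1 (show s * (x i * y j - x j * y i) = 0 by
      linear_combination y j * hi - y i * hj)).resolve_right h'
  · exact (mul_eq_zero.1 (show t * (x i * y j - x j * y i) = 0 by
      linear_combination x i * hj - x j * hi)).resolve_right h'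

theorem ne_zero_fin_two {y : Fin 2 → ℂ} (hy : y ≠ 0) : y 0 ≠ 0 ∨ y 1 ≠ 0 := by
  by_contra! h
  exact hy (funext fun i => by fin_cases i <;> simp [h])

theorem ne_zero_fin_three {y : Fin 3 → ℂ} (hy : y ≠ 0) : y 0 ≠ 0 ∨ y 1 ≠ 0 ∨ y 2 ≠ 0 := by
  by_contra! h
  exact hy (funext fun i => by fin_cases i <;> simp [h])

theorem hasAnnihilator_coreABC3 : HasAnnihilator coreABC3 :=
  ⟨![1, 0], ![0, 1], by simp, by simp,
    by simp [coreABC3, Annihilates, Fin.forall_fin_succ, Fin.sum_univ_succ]⟩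

theorem hasDoubleAnnihilator_coreABC6 : HasDoubleAnnihilator coreABC6 :=
  ⟨![1, 0], ![1, 0, 0], ![0, 0, 1], by simp, linearIndependent_pair_of_minor_ne 0 2 (by simp),
    by simp [coreABC6, Annihilates, Fin.forall_fin_succ, Fin.sum_univ_succ],
    by simp [coreABC6, Annihilates, Fin.forall_fin_succ, Fin.sum_univ_succ]⟩

theorem hasDoubleAnnihilator_coreABC9 : HasDoubleAnnihilator coreABC9 :=
  ⟨![1, 0], ![1, 0, 0], ![0, 1, 0], by simp, linearIndependent_pair_of_minor_ne 0 1 (by simp),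
    by simp [coreABC9, Annihilates, Fin.forall_fin_succ, Fin.sum_univ_succ],
    by simp [coreABC9, Annihilates, Fin.forall_fin_succ, Fin.sum_univ_succ]⟩

theorem hasDoubleAnnihilator_coreABC11 : HasDoubleAnnihilator coreABC11 :=
  ⟨![1, 0], ![0, 1, 0], ![0, 0, 1], by simp, linearIndependent_pair_of_minor_ne 1 2 (by simp),
    by simp [coreABC11, Annihilates, Fin.forall_fin_succ, Fin.sum_univ_succ],
    by simp [coreABC11, Annihilates, Fin.forall_fin_succ, Fin.sum_univ_succ]⟩

theorem hasTwoAnnihilators_coreABC12 : HasTwoAnnihilators coreABC12 :=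
  ⟨![1, 0], ![1, -1], ![0, 1, 0], ![0, 0, 1], linearIndependent_pair_of_minor_ne 0 1 (by simp),
    by simp, by simp, by simp [coreABC12, Annihilates, Fin.forall_fin_succ, Fin.sum_univ_succ],
    by simp [coreABC12, Annihilates, Fin.sum_univ_succ]⟩

theorem hasDoubleAnnihilator_coreABC14 : HasDoubleAnnihilator coreABC14 :=
  ⟨![1, 0], ![0, 1, 0], ![0, 0, 1], by simp, linearIndependent_pair_of_minor_ne 1 2 (by simp),
    by simp [coreABC14, Annihilates, Fin.forall_fin_succ, Fin.sum_univ_succ],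
    by simp [coreABC14, Annihilates, Fin.forall_fin_succ, Fin.sum_univ_succ]⟩

theorem hasTwoAnnihilators_coreABC15 : HasTwoAnnihilators coreABC15 :=
  ⟨![1, 0], ![1, -1], ![0, 1, 0], ![0, 0, 1], linearIndependent_pair_of_minor_ne 0 1 (by simp),
    by simp, by simp, by simp [coreABC15, Annihilates, Fin.forall_fin_succ, Fin.sum_univ_succ],
    by simp [coreABC15, Annihilates, Fin.sum_univ_succ]⟩

theorem hasAnnihilator_coreABC14 : HasAnnihilator coreABC14 :=
  ⟨![1, 0], ![0, 1, 0], by simp, by simp,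
    by simp [coreABC14, Annihilates, Fin.forall_fin_succ, Fin.sum_univ_succ]⟩

theorem hasAnnihilator_coreABC15 : HasAnnihilator coreABC15 :=
  ⟨![1, 0], ![0, 1, 0], by simp, by simp,
    by simp [coreABC15, Annihilates, Fin.forall_fin_succ, Fin.sum_univ_succ]⟩

theorem hasAnnihilator_coreABC17 : HasAnnihilator coreABC17 :=
  ⟨![1, 0], ![0, 0, 1], by simp, by simp,
    by simp [coreABC17, Annihilates, Fin.forall_fin_succ, Fin.sum_univ_succ]⟩

theorem hasAnnihilator_coreABC19 : HasAnnihilator coreABC19 :=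
  ⟨![1, 0], ![0, 0, 1], by simp, by simp,
    by simp [coreABC19, Annihilates, Fin.forall_fin_succ, Fin.sum_univ_succ]⟩

theorem hasAllAnnihilators_coreABC10 : HasAllAnnihilators coreABC10 := by
  intro α
  by_cases hα : α = 0
  · exact ⟨![0, 1, 0], by simp,
      by simp [hα, coreABC10, Annihilates]⟩
  · refine ⟨![0, α 0, -α 1], fun h => hα ?_, ?_⟩
    · ext i
      fin_cases i
      · simpa using congrFun h 1
      · simpa using congrFun h 2
    · simp [coreABC10, Annihilates, Fin.forall_fin_succ, Fin.sum_univ_succ]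
      ring

theorem not_hasAnnihilator_coreABC4 : ¬HasAnnihilator coreABC4 := by
  rintro ⟨α, y, hα, hy, h⟩
  have hα' : α 0 ≠ 0 ∨ α 1 ≠ 0 := ne_zero_fin_two hα
  simp [coreABC4, Annihilates, Fin.forall_fin_succ, Fin.sum_univ_succ] at h
  have hy' := ne_zero_fin_two hy
  grind

theorem not_hasAnnihilator_coreABC18 : ¬HasAnnihilator coreABC18 := by
  rintro ⟨α, y, hα, hy, h⟩
  have hα' : α 0 ≠ 0 ∨ α 1 ≠ 0 := ne_zero_fin_two hα
  simp [coreABC18, Annihilates, Fin.forall_fin_succ, Fin.sum_univ_succ] at h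
  have hy' := ne_zero_fin_three hy
  grind

theorem not_hasAnnihilator_coreABC20 : ¬HasAnnihilator coreABC20 := by
  rintro ⟨α, y, hα, hy, h⟩
  have hα' : α 0 ≠ 0 ∨ α 1 ≠ 0 := ne_zero_fin_two hα
  simp [coreABC20, Annihilates, Fin.forall_fin_succ, Fin.sum_univ_succ] at h
  have hy' := ne_zero_fin_three hy
  grind

theorem not_hasDoubleAnnihilator_coreABC7 : ¬HasDoubleAnnihilator coreABC7 := by
  rintro ⟨α, y, y', hα, hy, h, h'⟩
  have hα' : α 0 ≠ 0 ∨ α 1 ≠ 0 := ne_zero_fin_two hα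
  obtain ⟨i, j, hij⟩ := exists_minor_ne_of_linearIndependent hy
  simp [coreABC7, Annihilates, Fin.forall_fin_succ, Fin.sum_univ_succ] at h h'
  fin_cases i <;> fin_cases j <;> grind

theorem not_hasDoubleAnnihilator_coreABC8 : ¬HasDoubleAnnihilator coreABC8 := by
  rintro ⟨α, y, y', hα, hy, h, h'⟩
  have hα' : α 0 ≠ 0 ∨ α 1 ≠ 0 := ne_zero_fin_two hα
  obtain ⟨i, j, hij⟩ := exists_minor_ne_of_linearIndependent hy
  simp [coreABC8, Annihilates, Fin.forall_fin_succ, Fin.sum_univ_succ] at h h'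
  fin_cases i <;> fin_cases j <;> grind

theorem not_hasDoubleAnnihilator_coreABC12 : ¬HasDoubleAnnihilator coreABC12 := by
  rintro ⟨α, y, y', hα, hy, h, h'⟩
  have hα' : α 0 ≠ 0 ∨ α 1 ≠ 0 := ne_zero_fin_two hα
  obtain ⟨i, j, hij⟩ := exists_minor_ne_of_linearIndependent hy
  simp [coreABC12, Annihilates, Fin.forall_fin_succ, Fin.sum_univ_succ] at h h'
  fin_cases i <;> fin_cases j <;> grind

theorem not_hasDoubleAnnihilator_coreABC13 : ¬HasDoubleAnnihilator coreABC13 := by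
  rintro ⟨α, y, y', hα, hy, h, h'⟩
  have hα' : α 0 ≠ 0 ∨ α 1 ≠ 0 := ne_zero_fin_two hα
  obtain ⟨i, j, hij⟩ := exists_minor_ne_of_linearIndependent hy
  simp [coreABC13, Annihilates, Fin.forall_fin_succ, Fin.sum_univ_succ] at h h'
  fin_cases i <;> fin_cases j <;> grind

theorem not_hasDoubleAnnihilator_coreABC15 : ¬HasDoubleAnnihilator coreABC15 := by
  rintro ⟨α, y, y', hα, hy, h, h'⟩
  have hα' : α 0 ≠ 0 ∨ α 1 ≠ 0 := ne_zero_fin_two hα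
  obtain ⟨i, j, hij⟩ := exists_minor_ne_of_linearIndependent hy
  simp [coreABC15, Annihilates, Fin.forall_fin_succ, Fin.sum_univ_succ] at h h'
  fin_cases i <;> fin_cases j <;> grind

theorem not_hasDoubleAnnihilator_coreABC17 : ¬HasDoubleAnnihilator coreABC17 := by
  rintro ⟨α, y, y', hα, hy, h, h'⟩
  have hα' : α 0 ≠ 0 ∨ α 1 ≠ 0 := ne_zero_fin_two hα
  obtain ⟨i, j, hij⟩ := exists_minor_ne_of_linearIndependent hy
  simp [coreABC17, Annihilates, Fin.forall_fin_succ, Fin.sum_univ_succ] at h h'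
  fin_cases i <;> fin_cases j <;> grind

theorem not_hasTwoAnnihilators_coreABC13 : ¬HasTwoAnnihilators coreABC13 := by
  rintro ⟨α, α', y, y', hα, hy, hy', h, h'⟩
  obtain ⟨i, j, hij⟩ := exists_minor_ne_of_linearIndependent hα
  have hy₀ := ne_zero_fin_three hy
  have hy₀' := ne_zero_fin_three hy'
  simp [coreABC13, Annihilates, Fin.forall_fin_succ, Fin.sum_univ_succ] at h h'
  fin_cases i <;> fin_cases j <;> grind

theorem not_hasTwoAnnihilators_coreABC17 : ¬HasTwoAnnihilators coreABC17 := by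
  rintro ⟨α, α', y, y', hα, hy, hy', h, h'⟩
  obtain ⟨i, j, hij⟩ := exists_minor_ne_of_linearIndependent hα
  have hy₀ := ne_zero_fin_three hy
  have hy₀' := ne_zero_fin_three hy'
  simp [coreABC17, Annihilates, Fin.forall_fin_succ, Fin.sum_univ_succ] at h h'
  fin_cases i <;> fin_cases j <;> grind

theorem not_hasAllAnnihilators_coreABC11 : ¬HasAllAnnihilators coreABC11 := by
  intro h
  obtain ⟨y, hy, h⟩ := h ![0, 1]
  simp [coreABC11, Annihilates, Fin.forall_fin_succ, Fin.sum_univ_succ] at h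
  refine hy (funext fun i => ?_)
  fin_cases i <;> simp_all

theorem not_hasAllAnnihilators_coreABC12 : ¬HasAllAnnihilators coreABC12 := by
  intro h
  obtain ⟨y, hy, h⟩ := h ![0, 1]
  simp [coreABC12, Annihilates, Fin.forall_fin_succ, Fin.sum_univ_succ] at h
  refine hy (funext fun i => ?_)
  fin_cases i <;> simp_all

theorem not_hasAllAnnihilators_coreABC13 : ¬HasAllAnnihilators coreABC13 := by
  intro h
  obtain ⟨y, hy, h⟩ := h ![0, 1]
  simp [coreABC13, Annihilates, Fin.forall_fin_succ, Fin.sum_univ_succ] at h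
  refine hy (funext fun i => ?_)
  fin_cases i <;> simp_all

/-! ### Orbits of the local general linear groups -/

/-- `ψ` and `φ` are in the same orbit of `GL_a × GL_b × GL_c`. -/
def SameOrbit {a b c : ℕ} (ψ φ : Tensor a b c) : Prop :=
  ∃ A B C, A.det ≠ 0 ∧ B.det ≠ 0 ∧ C.det ≠ 0 ∧ φ = localOp A B C ψ

theorem conciseC_iff {a b c : ℕ} {ψ : Tensor a b c} : ConciseC ψ ↔
    ∀ z : Fin c → ℂ, localOp (1 : Matrix (Fin a) (Fin a) ℂ) (1 : Matrix (Fin b) (Fin b) ℂ)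
      (Matrix.of fun _ : Fin 1 => z) ψ = 0 → z = 0 := by
  simp [ConciseC, funext_iff, localOp, Matrix.one_apply]

namespace SameOrbit

variable {a b c : ℕ} {ψ φ χ : Tensor a b c}

theorem refl (ψ : Tensor a b c) : SameOrbit ψ ψ :=
  ⟨1, 1, 1, by simp, by simp, by simp, (localOp_one ψ).symm⟩

theorem trans (h : SameOrbit ψ φ) (h' : SameOrbit φ χ) : SameOrbit ψ χ := by
  obtain ⟨A, B, C, hA, hB, hC, rfl⟩ := h
  obtain ⟨A', B', C', hA', hB', hC', rfl⟩ := h'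
  refine ⟨A' * A, B' * B, C' * C, ?_, ?_, ?_, localOp_localOp ..⟩ <;> simp [*]

theorem symm (h : SameOrbit ψ φ) : SameOrbit φ ψ := by
  obtain ⟨A, B, C, hA, hB, hC, rfl⟩ := h
  refine ⟨A⁻¹, B⁻¹, C⁻¹, ?_, ?_, ?_, ?_⟩
  · simpa [Matrix.det_nonsing_inv, Ring.inverse_eq_inv'] using hA
  · simpa [Matrix.det_nonsing_inv, Ring.inverse_eq_inv'] using hB
  · simpa [Matrix.det_nonsing_inv, Ring.inverse_eq_inv'] using hC
  · rw [localOp_localOp, Matrix.nonsing_inv_mul _ (isUnit_iff_ne_zero.2 hA),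
      Matrix.nonsing_inv_mul _ (isUnit_iff_ne_zero.2 hB),
      Matrix.nonsing_inv_mul _ (isUnit_iff_ne_zero.2 hC), localOp_one]

theorem restricts (h : SameOrbit ψ φ) : Restricts ψ φ := by
  obtain ⟨A, B, C, -, -, -, h⟩ := h
  exact ⟨A, B, C, h⟩

theorem mutuallyRestrict (h : SameOrbit ψ φ) : MutuallyRestrict ψ φ :=
  ⟨h.restricts, h.symm.restricts⟩

theorem of_alice {A : Matrix (Fin a) (Fin a) ℂ} (hA : A.det ≠ 0)
    (h : ∀ i j k, φ i j k = ∑ x, A i x * ψ x j k) : SameOrbit ψ φ := by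
  refine ⟨A, 1, 1, hA, by simp, by simp, ?_⟩
  funext i j k
  simp [h, localOp, Matrix.one_apply]

theorem of_bob {B : Matrix (Fin b) (Fin b) ℂ} (hB : B.det ≠ 0)
    (h : ∀ i j k, φ i j k = ∑ y, B j y * ψ i y k) : SameOrbit ψ φ := by
  refine ⟨1, B, 1, by simp, hB, by simp, ?_⟩
  funext i j k
  simp [h, localOp, Matrix.one_apply]

theorem of_charlie {C : Matrix (Fin c) (Fin c) ℂ} (hC : C.det ≠ 0)
    (h : ∀ i j k, φ i j k = ∑ z, C k z * ψ i j z) : SameOrbit ψ φ := by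
  refine ⟨1, 1, C, by simp, by simp, hC, ?_⟩
  funext i j k
  simp [h, localOp, Matrix.one_apply]

theorem conciseC (h : SameOrbit ψ φ) (hψ : ConciseC ψ) : ConciseC φ := by
  obtain ⟨A, B, C, hA, hB, hC, h⟩ := h.symm
  have hC' : IsUnit C.det := isUnit_iff_ne_zero.2 hC
  rw [conciseC_iff] at hψ ⊢
  intro z hz
  have key : z ᵥ* C⁻¹ = 0 := hψ _ (by
    have e := localOp_localOp A B (1 : Matrix (Fin 1) (Fin 1) ℂ) (1 : Matrix (Fin a) (Fin a) ℂ)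
      (1 : Matrix (Fin b) (Fin b) ℂ) (Matrix.of fun _ : Fin 1 => z) φ
    rw [hz, localOp_zero] at e
    rw [h, localOp_localOp, of_row_mul, Matrix.vecMul_vecMul, Matrix.nonsing_inv_mul _ hC',
      Matrix.vecMul_one, e]
    simp)
  rw [← Matrix.vecMul_one z, ← Matrix.nonsing_inv_mul _ hC', ← Matrix.vecMul_vecMul, key,
    Matrix.zero_vecMul]

end SameOrbit

/-! ### Vectors in the plane and in space -/

/-- The determinant of a pair of vectors in the plane. -/
def det₂ (x y : Fin 2 → ℂ) : ℂ := x 0 * y 1 - x 1 * y 0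

theorem exists_eq_smul_add_smul {x y : Fin 2 → ℂ} (h : det₂ x y ≠ 0) (p : Fin 2 → ℂ) :
    ∃ s t : ℂ, p = s • x + t • y := by
  refine ⟨det₂ p y / det₂ x y, det₂ x p / det₂ x y, ?_⟩
  have h' := h
  unfold det₂ at h'
  funext i
  simp only [Pi.add_apply, Pi.smul_apply, smul_eq_mul]
  field_simp
  fin_cases i <;> simp [det₂] <;> ring

theorem exists_eq_smul_of_det₂_eq_zero {x y : Fin 2 → ℂ} (hx : x ≠ 0) (h : det₂ x y = 0) :
    ∃ s : ℂ, y = s • x := by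
  unfold det₂ at h
  rcases ne_zero_fin_two hx with h0 | h0
  · refine ⟨y 0 / x 0, funext fun i => ?_⟩
    fin_cases i <;> simp <;> field_simp
    linear_combination h
  · refine ⟨y 1 / x 1, funext fun i => ?_⟩
    fin_cases i <;> simp <;> field_simp
    linear_combination -h

theorem exists_det₂_ne_zero {x : Fin 2 → ℂ} (hx : x ≠ 0) : ∃ y, det₂ x y ≠ 0 := by
  rcases ne_zero_fin_two hx with h0 | h0
  · exact ⟨![0, 1], by simpa [det₂] using h0⟩
  · exact ⟨![1, 0], by simpa [det₂] using h0⟩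

/-- `GL_2` acts transitively on bases of the plane. -/
theorem exists_mulVec_eq_of_det₂ {x y x' y' : Fin 2 → ℂ} (h : det₂ x y ≠ 0) (h' : det₂ x' y' ≠ 0) :
    ∃ A : Matrix (Fin 2) (Fin 2) ℂ, A.det ≠ 0 ∧ A *ᵥ x = x' ∧ A *ᵥ y = y' := by
  let d := det₂ x y
  let A : Matrix (Fin 2) (Fin 2) ℂ :=
    !![(x' 0 * y 1 - y' 0 * x 1) / d, (y' 0 * x 0 - x' 0 * y 0) / d;
      (x' 1 * y 1 - y' 1 * x 1) / d, (y' 1 * x 0 - x' 1 * y 0) / d]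
  have hd : d ≠ 0 := h
  have hdd : d = x 0 * y 1 - x 1 * y 0 := rfl
  refine ⟨A, ?_, ?_, ?_⟩
  · have : A.det = det₂ x' y' / d := by
      simp only [A, Matrix.det_fin_two_of, det₂]
      field_simp
      rw [hdd]
      ring
    rw [this]
    exact div_ne_zero h' hd
  · funext i
    fin_cases i <;> simp [A, Matrix.mulVec, dotProduct] <;> field_simp <;> rw [hdd] <;> ring
  · funext i
    fin_cases i <;> simp [A, Matrix.mulVec, dotProduct] <;> field_simp <;> rw [hdd] <;> ring

theorem exists_matrix_row_zero_eq_two {w : Fin 2 → ℂ} (hw : w ≠ 0) :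
    ∃ C : Matrix (Fin 2) (Fin 2) ℂ, C.det ≠ 0 ∧ C 0 = w := by
  rcases ne_zero_fin_two hw with h | h
  · exact ⟨Matrix.of ![w, ![0, 1]], by simpa [Matrix.det_fin_two] using h, rfl⟩
  · exact ⟨Matrix.of ![w, ![1, 0]], by simpa [Matrix.det_fin_two] using h, rfl⟩

theorem exists_matrix_row_zero_eq_three {w : Fin 3 → ℂ} (hw : w ≠ 0) :
    ∃ C : Matrix (Fin 3) (Fin 3) ℂ, C.det ≠ 0 ∧ C 0 = w := by
  rcases ne_zero_fin_three hw with h | h | h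
  · exact ⟨Matrix.of ![w, ![0, 1, 0], ![0, 0, 1]], by simpa [Matrix.det_fin_three] using h, rfl⟩
  · exact ⟨Matrix.of ![w, ![1, 0, 0], ![0, 0, 1]], by simpa [Matrix.det_fin_three] using h, rfl⟩
  · exact ⟨Matrix.of ![w, ![1, 0, 0], ![0, 1, 0]], by simpa [Matrix.det_fin_three] using h, rfl⟩

/-- The inverse of an invertible matrix with first column `w` maps `w` to the first basis
vector. -/
theorem exists_mulVec_eq_single {m : ℕ} [NeZero m] {w : Fin m → ℂ}
    (h : ∃ C : Matrix (Fin m) (Fin m) ℂ, C.det ≠ 0 ∧ C 0 = w) :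
    ∃ B : Matrix (Fin m) (Fin m) ℂ, B.det ≠ 0 ∧ B *ᵥ w = Pi.single 0 1 := by
  obtain ⟨C, hC, rfl⟩ := h
  have hC' : IsUnit Cᵀ.det := by simpa using hC
  refine ⟨Cᵀ⁻¹, ?_, ?_⟩
  · simpa [Matrix.det_nonsing_inv, Ring.inverse_eq_inv'] using hC
  · rw [show C 0 = Cᵀ *ᵥ Pi.single 0 1 by funext i; simp, Matrix.mulVec_mulVec,
      Matrix.nonsing_inv_mul _ hC', Matrix.one_mulVec]

theorem exists_mulVec_eq_smul_single_two (w : Fin 2 → ℂ) :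
    ∃ B : Matrix (Fin 2) (Fin 2) ℂ, B.det ≠ 0 ∧ ∃ t : ℂ, B *ᵥ w = t • Pi.single 0 1 := by
  by_cases hw : w = 0
  · exact ⟨1, by simp, 0, by simp [hw]⟩
  · obtain ⟨B, hB, h⟩ := exists_mulVec_eq_single (exists_matrix_row_zero_eq_two hw)
    exact ⟨B, hB, 1, by simp [h]⟩

theorem exists_mulVec_eq_smul_single_three (w : Fin 3 → ℂ) :
    ∃ B : Matrix (Fin 3) (Fin 3) ℂ, B.det ≠ 0 ∧ ∃ t : ℂ, B *ᵥ w = t • Pi.single 0 1 := by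
  by_cases hw : w = 0
  · exact ⟨1, by simp, 0, by simp [hw]⟩
  · obtain ⟨B, hB, h⟩ := exists_mulVec_eq_single (exists_matrix_row_zero_eq_three hw)
    exact ⟨B, hB, 1, by simp [h]⟩

theorem exists_matrix_of_linearIndependent {u v : Fin 3 → ℂ} (h : LinearIndependent ℂ ![u, v]) :
    ∃ M : Matrix (Fin 3) (Fin 3) ℂ, M.det ≠ 0 ∧ (∀ j, M j 0 = u j) ∧ ∀ j, M j 1 = v j := by
  obtain ⟨i, j, hij⟩ := exists_minor_ne_of_linearIndependent h
  have : u 0 * v 1 - u 1 * v 0 ≠ 0 ∨ u 0 * v 2 - u 2 * v 0 ≠ 0 ∨ u 1 * v 2 - u 2 * v 1 ≠ 0 := by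
    fin_cases i <;> fin_cases j <;> grind
  rcases this with h | h | h
  · refine ⟨!![u 0, v 0, 0; u 1, v 1, 0; u 2, v 2, 1], ?_, ?_, ?_⟩
    · simp only [Matrix.det_fin_three]
      simp
      contrapose! h
      linear_combination h
    all_goals intro j; fin_cases j <;> rfl
  · refine ⟨!![u 0, v 0, 0; u 1, v 1, 1; u 2, v 2, 0], ?_, ?_, ?_⟩
    · simp only [Matrix.det_fin_three]
      simp
      contrapose! h
      linear_combination -h
    all_goals intro j; fin_cases j <;> rfl
  · refine ⟨!![u 0, v 0, 1; u 1, v 1, 0; u 2, v 2, 0], ?_, ?_, ?_⟩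
    · simp only [Matrix.det_fin_three]
      simp
      contrapose! h
      linear_combination h
    all_goals intro j; fin_cases j <;> rfl

/-- `GL_3` acts transitively on independent pairs of vectors in space. -/
theorem exists_mulVec_eq_of_linearIndependent {u v u' v' : Fin 3 → ℂ}
    (h : LinearIndependent ℂ ![u, v]) (h' : LinearIndependent ℂ ![u', v']) :
    ∃ B : Matrix (Fin 3) (Fin 3) ℂ, B.det ≠ 0 ∧ B *ᵥ u = u' ∧ B *ᵥ v = v' := by
  obtain ⟨M, hM, hu, hv⟩ := exists_matrix_of_linearIndependent h
  obtain ⟨M', hM', hu', hv'⟩ := exists_matrix_of_linearIndependent h'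
  have e₁ : u = M *ᵥ Pi.single 0 1 := by funext i; simp [hu]
  have e₂ : v = M *ᵥ Pi.single 1 1 := by funext i; simp [hv]
  have e₁' : u' = M' *ᵥ Pi.single 0 1 := by funext i; simp [hu']
  have e₂' : v' = M' *ᵥ Pi.single 1 1 := by funext i; simp [hv']
  have hMu : IsUnit M.det := isUnit_iff_ne_zero.2 hM
  refine ⟨M' * M⁻¹, ?_, ?_, ?_⟩
  · simp [Matrix.det_nonsing_inv, Ring.inverse_eq_inv', hM, hM']
  · rw [e₁, e₁', Matrix.mulVec_mulVec, Matrix.mul_assoc, Matrix.nonsing_inv_mul _ hMu,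
      Matrix.mul_one]
  · rw [e₂, e₂', Matrix.mulVec_mulVec, Matrix.mul_assoc, Matrix.nonsing_inv_mul _ hMu,
      Matrix.mul_one]

/-- Two dependent vectors are the two coefficients of a product vector. -/
theorem exists_eq_smul_of_dependent {m : ℕ} {α : Fin 2 → ℂ} (hα : α ≠ 0) {u v : Fin m → ℂ}
    (h : α 0 • u + α 1 • v = 0) : ∃ (x : Fin 2 → ℂ) (e : Fin m → ℂ), u = x 0 • e ∧ v = x 1 • e := by
  rcases ne_zero_fin_two hα with h0 | h0
  · refine ⟨![-(α 1 / α 0), 1], v, ?_, by simp⟩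
    funext j
    have := congrFun h j
    simp at this ⊢
    field_simp
    linear_combination this
  · refine ⟨![1, -(α 0 / α 1)], u, by simp, ?_⟩
    funext j
    have := congrFun h j
    simp at this ⊢
    field_simp
    linear_combination this

/-- Every square pencil has a singular point. -/
theorem exists_pencil_mulVec_eq_zero {m : ℕ} [NeZero m] (R S : Matrix (Fin m) (Fin m) ℂ) :
    ∃ α : Fin 2 → ℂ, α ≠ 0 ∧ ∃ w : Fin m → ℂ, w ≠ 0 ∧ (α 0 • R + α 1 • S) *ᵥ w = 0 := by
  by_cases hS : S.det = 0
  · obtain ⟨w, hw, h⟩ := Matrix.exists_mulVec_eq_zero_iff.2 hS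
    exact ⟨![0, 1], by simp, w, hw, by simpa using h⟩
  · obtain ⟨x, hx⟩ := Module.End.exists_eigenvalue (Matrix.toLin' (S⁻¹ * R))
    obtain ⟨w, hw⟩ := hx.exists_hasEigenvector
    refine ⟨![1, -x], by simp, w, hw.2, ?_⟩
    have e := hw.apply_eq_smul
    rw [Matrix.toLin'_apply] at e
    have e' : R *ᵥ w = x • S *ᵥ w := by
      rw [← Matrix.mulVec_smul, ← e, Matrix.mulVec_mulVec, ← Matrix.mul_assoc,
        Matrix.mul_nonsing_inv _ (isUnit_iff_ne_zero.2 hS), Matrix.one_mul]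
    simp [Matrix.add_mulVec, Matrix.smul_mulVec, Matrix.neg_mulVec, e']

/-! ### Triangular pencils -/

theorem localOp_one_apply {b c e f : ℕ} {a : ℕ} (B : Matrix (Fin e) (Fin b) ℂ)
    (C : Matrix (Fin f) (Fin c) ℂ) (ψ : Tensor a b c) (i : Fin a) (j : Fin e) (k : Fin f) :
    localOp 1 B C ψ i j k = ∑ y, B j y * ∑ z, C k z * ψ i y z := by
  simp only [localOp, Matrix.one_apply, ite_mul, one_mul, zero_mul, Finset.mul_sum]
  rw [Finset.sum_eq_single i (fun x _ hx => by simp [hx.symm]) (by simp)]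
  simp [mul_assoc]

/-- A singular point of a pencil gives a product vector in the span of its columns, which can be
moved to the first column. -/
theorem exists_sameOrbit_first_column {c : ℕ} (ψ : Tensor 2 3 (c + 1)) {α : Fin 2 → ℂ}
    (hα : α ≠ 0) {C : Matrix (Fin (c + 1)) (Fin (c + 1)) ℂ} (hC : C.det ≠ 0)
    (h : ∀ j, α 0 * ∑ k, C 0 k * ψ 0 j k + α 1 * ∑ k, C 0 k * ψ 1 j k = 0) :
    ∃ φ, SameOrbit ψ φ ∧ ∀ i, φ i 1 0 = 0 ∧ φ i 2 0 = 0 := by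
  obtain ⟨x, e, h₀, h₁⟩ := exists_eq_smul_of_dependent hα
    (u := fun j => ∑ k, C 0 k * ψ 0 j k) (v := fun j => ∑ k, C 0 k * ψ 1 j k)
    (funext fun j => h j)
  have hx (i) : (fun j => ∑ k, C 0 k * ψ i j k) = x i • e := by
    fin_cases i
    exacts [h₀, h₁]
  obtain ⟨B, hB, t, ht⟩ := exists_mulVec_eq_smul_single_three e
  have key (i j) : localOp 1 B C ψ i j 0 = x i * t * (Pi.single 0 1 : Fin 3 → ℂ) j := by
    rw [localOp_one_apply]
    have : B *ᵥ (fun j => ∑ k, C 0 k * ψ i j k) = (x i * t) • Pi.single 0 1 := by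
      rw [hx, Matrix.mulVec_smul, ht, smul_smul]
    exact congrFun this j
  exact ⟨_, ⟨1, B, C, by simp, hB, hC, rfl⟩, fun i => by simp [key]⟩

/-- The upper triangular `3 × 3` pencil with the given linear forms as entries; a linear form is
given by its coefficients of `μ` and `λ`. -/
def tri (l p q l' r l'' : Fin 2 → ℂ) : Tensor 2 3 3 :=
  fun i => ![![l i, p i, q i], ![0, l' i, r i], ![0, 0, l'' i]]

/-- Every `3 × 3` pencil can be made triangular: a product vector is moved to the first column,
and then the same is done for the lower right `2 × 2` pencil. -/
theorem exists_sameOrbit_tri (ψ : Tensor 2 3 3) :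
    ∃ l p q l' r l'', SameOrbit ψ (tri l p q l' r l'') := by
  obtain ⟨α, hα, w, hw, h⟩ := exists_pencil_mulVec_eq_zero (Matrix.of (ψ 0)) (Matrix.of (ψ 1))
  obtain ⟨C, hC, rfl⟩ := exists_matrix_row_zero_eq_three hw
  obtain ⟨φ, hφ, hφ0⟩ := exists_sameOrbit_first_column ψ hα hC fun j => by
    rw [Matrix.add_mulVec, Matrix.smul_mulVec, Matrix.smul_mulVec] at h
    have := congrFun h j
    simp only [Pi.add_apply, Pi.smul_apply, smul_eq_mul,
      Matrix.mulVec, dotProduct, Matrix.of_apply, Pi.zero_apply] at this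
    simpa only [mul_comm (C 0 _)] using this
  -- The same argument is applied to the remaining `2 × 2` pencil.
  obtain ⟨β, hβ, z, hz, h'⟩ := exists_pencil_mulVec_eq_zero
    !![φ 0 1 1, φ 0 1 2; φ 0 2 1, φ 0 2 2] !![φ 1 1 1, φ 1 1 2; φ 1 2 1, φ 1 2 2]
  obtain ⟨D, hD, rfl⟩ := exists_matrix_row_zero_eq_two hz
  obtain ⟨x, e, h₀, h₁⟩ := exists_eq_smul_of_dependent hβ
    (u := !![φ 0 1 1, φ 0 1 2; φ 0 2 1, φ 0 2 2] *ᵥ D 0)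
    (v := !![φ 1 1 1, φ 1 1 2; φ 1 2 1, φ 1 2 2] *ᵥ D 0)
    (by rw [← h', Matrix.add_mulVec, Matrix.smul_mulVec, Matrix.smul_mulVec])
  obtain ⟨B, hB, t, ht⟩ := exists_mulVec_eq_smul_single_two e
  let B' : Matrix (Fin 3) (Fin 3) ℂ := !![1, 0, 0; 0, B 0 0, B 0 1; 0, B 1 0, B 1 1]
  let D' : Matrix (Fin 3) (Fin 3) ℂ := !![1, 0, 0; 0, D 0 0, D 0 1; 0, D 1 0, D 1 1]
  have hB' : B'.det ≠ 0 := by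
    simpa [B', Matrix.det_fin_three, Matrix.det_fin_two] using hB
  have hD' : D'.det ≠ 0 := by
    simpa [D', Matrix.det_fin_three, Matrix.det_fin_two] using hD
  obtain ⟨χ, hχ⟩ : ∃ χ : Tensor 2 3 3, χ = localOp 1 B' D' φ := ⟨_, rfl⟩
  have hs : SameOrbit φ χ := ⟨1, B', D', by simp, hB', hD', hχ⟩
  have ht1 : B 1 0 * e 0 + B 1 1 * e 1 = 0 := by
    simpa [Matrix.mulVec, dotProduct] using congrFun ht 1
  have h21 (i) : χ i 2 1 = 0 := by
    have a0 : ∀ i, φ i 1 1 * D 0 0 + φ i 1 2 * D 0 1 = x i * e 0 ∧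
        φ i 2 1 * D 0 0 + φ i 2 2 * D 0 1 = x i * e 1 := by
      intro i
      fin_cases i
      · exact ⟨by simpa [Matrix.mulVec, dotProduct] using congrFun h₀ 0,
          by simpa [Matrix.mulVec, dotProduct] using congrFun h₀ 1⟩
      · exact ⟨by simpa [Matrix.mulVec, dotProduct] using congrFun h₁ 0,
          by simpa [Matrix.mulVec, dotProduct] using congrFun h₁ 1⟩
    obtain ⟨a1, a2⟩ := a0 i
    simp only [hχ, localOp_one_apply, Fin.sum_univ_three]
    simp [B', D']
    linear_combination B 1 0 * a1 + B 1 1 * a2 + x i * ht1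
  refine ⟨fun i => χ i 0 0, fun i => χ i 0 1,
    fun i => χ i 0 2, fun i => χ i 1 1,
    fun i => χ i 1 2, fun i => χ i 2 2, hφ.trans ?_⟩
  convert hs using 1
  funext i j k
  fin_cases j <;> fin_cases k <;> simp [tri, h21] <;>
    simp [hχ, localOp_one_apply, Fin.sum_univ_three, B', D', hφ0]

namespace SameOrbit

variable (l p q l' r l'' : Fin 2 → ℂ)

theorem tri_mulVec {A : Matrix (Fin 2) (Fin 2) ℂ} (hA : A.det ≠ 0) :
    SameOrbit (tri l p q l' r l'')
      (tri (A *ᵥ l) (A *ᵥ p) (A *ᵥ q) (A *ᵥ l') (A *ᵥ r) (A *ᵥ l'')) := by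
  refine of_alice hA fun i j k => ?_
  fin_cases j <;> fin_cases k <;> simp [tri, Matrix.mulVec, dotProduct]

theorem tri_smul {x y z x' y' z' : ℂ} (hx : x ≠ 0) (hy : y ≠ 0) (hz : z ≠ 0) (hx' : x' ≠ 0)
    (hy' : y' ≠ 0) (hz' : z' ≠ 0) :
    SameOrbit (tri l p q l' r l'') (tri ((x * x') • l) ((x * y') • p) ((x * z') • q)
      ((y * y') • l') ((y * z') • r) ((z * z') • l'')) := by
  refine ⟨1, Matrix.diagonal ![x, y, z], Matrix.diagonal ![x', y', z'], by simp,
    by simp [Fin.prod_univ_three, *], by simp [Fin.prod_univ_three, *], ?_⟩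
  funext i j k
  rw [localOp_one_apply]
  fin_cases j <;> fin_cases k <;> simp [tri, Fin.sum_univ_three, mul_assoc]

theorem tri_add_col_zero_one (c : ℂ) : SameOrbit (tri l p q l' r l'')
    (tri l (p + c • l) q l' r l'') := by
  refine of_charlie (C := !![1, 0, 0; c, 1, 0; 0, 0, 1]) (by simp [Matrix.det_fin_three])
    fun i j k => ?_
  fin_cases j <;> fin_cases k <;> simp [tri, Fin.sum_univ_three, add_comm]

theorem tri_add_col_zero_two (c : ℂ) : SameOrbit (tri l p q l' r l'')
    (tri l p (q + c • l) l' r l'') := by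
  refine of_charlie (C := !![1, 0, 0; 0, 1, 0; c, 0, 1]) (by simp [Matrix.det_fin_three])
    fun i j k => ?_
  fin_cases j <;> fin_cases k <;> simp [tri, Fin.sum_univ_three, add_comm]

theorem tri_add_col_one_two (c : ℂ) : SameOrbit (tri l p q l' r l'')
    (tri l p (q + c • p) l' (r + c • l') l'') := by
  refine of_charlie (C := !![1, 0, 0; 0, 1, 0; 0, c, 1]) (by simp [Matrix.det_fin_three])
    fun i j k => ?_
  fin_cases j <;> fin_cases k <;> simp [tri, Fin.sum_univ_three, add_comm]

theorem tri_add_row_one_zero (c : ℂ) : SameOrbit (tri l p q l' r l'')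
    (tri l (p + c • l') (q + c • r) l' r l'') := by
  refine of_bob (B := !![1, c, 0; 0, 1, 0; 0, 0, 1]) (by simp [Matrix.det_fin_three])
    fun i j k => ?_
  fin_cases j <;> fin_cases k <;> simp [tri, Fin.sum_univ_three]

theorem tri_add_row_two_zero (c : ℂ) : SameOrbit (tri l p q l' r l'')
    (tri l p (q + c • l'') l' r l'') := by
  refine of_bob (B := !![1, 0, c; 0, 1, 0; 0, 0, 1]) (by simp [Matrix.det_fin_three])
    fun i j k => ?_
  fin_cases j <;> fin_cases k <;> simp [tri, Fin.sum_univ_three]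

theorem tri_add_row_two_one (c : ℂ) : SameOrbit (tri l p q l' r l'')
    (tri l p q l' (r + c • l'') l'') := by
  refine of_bob (B := !![1, 0, 0; 0, 1, c; 0, 0, 1]) (by simp [Matrix.det_fin_three])
    fun i j k => ?_
  fin_cases j <;> fin_cases k <;> simp [tri, Fin.sum_univ_three]

/-- Simultaneous exchange of the last two rows and columns. -/
theorem tri_swap_one_two : SameOrbit (tri l p q l' 0 l'') (tri l q p l'' 0 l') := by
  refine ⟨1, !![1, 0, 0; 0, 0, 1; 0, 1, 0], !![1, 0, 0; 0, 0, 1; 0, 1, 0], by simp,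
    by simp [Matrix.det_fin_three], by simp [Matrix.det_fin_three], ?_⟩
  funext i j k
  rw [localOp_one_apply]
  fin_cases j <;> fin_cases k <;> simp [tri, Fin.sum_univ_three]

/-- Simultaneous cyclic permutation of the rows and columns. -/
theorem tri_rotate : SameOrbit (tri l 0 0 l' r l'') (tri l' r 0 l'' 0 l) := by
  refine ⟨1, !![0, 1, 0; 0, 0, 1; 1, 0, 0], !![0, 1, 0; 0, 0, 1; 1, 0, 0], by simp,
    by simp [Matrix.det_fin_three], by simp [Matrix.det_fin_three], ?_⟩
  funext i j k
  rw [localOp_one_apply]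
  fin_cases j <;> fin_cases k <;> simp [tri, Fin.sum_univ_three]

variable {l p q l' r l''}

theorem tri_eliminate_zero_one (h : det₂ l l' ≠ 0) (p q r l'' : Fin 2 → ℂ) :
    ∃ q', SameOrbit (tri l p q l' r l'') (tri l 0 q' l' r l'') := by
  obtain ⟨s, t, rfl⟩ := exists_eq_smul_add_smul h p
  have h := tri_add_row_one_zero l (s • l + t • l' + -s • l) q l' r l'' (-t)
  rw [show s • l + t • l' + -s • l + -t • l' = 0 by module] at h
  exact ⟨_, (tri_add_col_zero_one _ _ _ _ _ _ (-s)).trans h⟩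

theorem tri_eliminate_one_two (h : det₂ l' l'' ≠ 0) (l p q r : Fin 2 → ℂ) :
    ∃ q', SameOrbit (tri l p q l' r l'') (tri l p q' l' 0 l'') := by
  obtain ⟨s, t, rfl⟩ := exists_eq_smul_add_smul h r
  have h := tri_add_row_two_one l p (q + -s • p) l' (s • l' + t • l'' + -s • l') l'' (-t)
  rw [show s • l' + t • l'' + -s • l' + -t • l'' = 0 by module] at h
  exact ⟨_, (tri_add_col_one_two _ _ _ _ _ _ (-s)).trans h⟩

theorem tri_eliminate_zero_two (h : det₂ l l'' ≠ 0) (p q l' r : Fin 2 → ℂ) :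
    SameOrbit (tri l p q l' r l'') (tri l p 0 l' r l'') := by
  obtain ⟨s, t, rfl⟩ := exists_eq_smul_add_smul h q
  have h := tri_add_row_two_zero l p (s • l + t • l'' + -s • l) l' r l'' (-t)
  rw [show s • l + t • l'' + -s • l + -t • l'' = 0 by module] at h
  exact (tri_add_col_zero_two _ _ _ _ _ _ (-s)).trans h

end SameOrbit

/-- `ψ` is equivalent, up to superfluous dimensions, to one of the representatives. -/
def InSomeClass {a b c : ℕ} (ψ : Tensor a b c) : Prop :=
  ∃ t : ClassName, ∀ n, 6 ≤ n → MutuallyRestrict ψ (t.representative n)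

theorem MutuallyRestrict.inSomeClass {a b c d e f : ℕ} {ψ : Tensor a b c} {φ : Tensor d e f}
    (h : MutuallyRestrict ψ φ) (hφ : InSomeClass φ) : InSomeClass ψ := by
  obtain ⟨t, ht⟩ := hφ
  exact ⟨t, fun n hn => h.trans (ht n hn)⟩

theorem SameOrbit.inSomeClass {a b c : ℕ} {ψ φ : Tensor a b c} (h : SameOrbit ψ φ)
    (hφ : InSomeClass φ) : InSomeClass ψ := h.mutuallyRestrict.inSomeClass hφ

/-! ### Classification of the `3 × 3` pencils with independent columns -/

/-- The linear form `μ`. -/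
def formMu : Fin 2 → ℂ := ![1, 0]

/-- The linear form `λ`. -/
def formLambda : Fin 2 → ℂ := ![0, 1]

theorem det₂_formLambda_formMu : det₂ formLambda formMu ≠ 0 := by simp [det₂, formMu, formLambda]

theorem SameOrbit.tri_transform {l p q l' r l'' L P Q L' R L'' : Fin 2 → ℂ}
    {A : Matrix (Fin 2) (Fin 2) ℂ} (hA : A.det ≠ 0) {x y z x' y' z' : ℂ} (hx : x ≠ 0)
    (hy : y ≠ 0) (hz : z ≠ 0) (hx' : x' ≠ 0) (hy' : y' ≠ 0) (hz' : z' ≠ 0)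
    (h₁ : (x * x') • A *ᵥ l = L) (h₂ : (x * y') • A *ᵥ p = P) (h₃ : (x * z') • A *ᵥ q = Q)
    (h₄ : (y * y') • A *ᵥ l' = L') (h₅ : (y * z') • A *ᵥ r = R)
    (h₆ : (z * z') • A *ᵥ l'' = L'') :
    SameOrbit (tri l p q l' r l'') (tri L P Q L' R L'') := by
  have h := (tri_mulVec l p q l' r l'' hA).trans
    (tri_smul _ _ _ _ _ _ hx hy hz hx' hy' hz')
  rwa [h₁, h₂, h₃, h₄, h₅, h₆] at h

/-- The three points given by the diagonal are different; `GL_2` is transitive on such triples. -/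
theorem inSomeClass_tri_diagonal {l l' l'' : Fin 2 → ℂ} (h : det₂ l l' ≠ 0)
    (h' : det₂ l' l'' ≠ 0) (h'' : det₂ l l'' ≠ 0) : InSomeClass (tri l 0 0 l' 0 l'') := by
  obtain ⟨s, t, rfl⟩ := exists_eq_smul_add_smul h l''
  have hs : s ≠ 0 := by
    rintro rfl
    refine h' ?_
    simp only [det₂, Pi.add_apply, Pi.smul_apply, smul_eq_mul]
    ring
  have ht : t ≠ 0 := by
    rintro rfl
    refine h'' ?_
    simp only [det₂, Pi.add_apply, Pi.smul_apply, smul_eq_mul]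
    ring
  -- The three points are moved to `λ`, `μ + λ` and `2 μ + λ = 2 (μ + λ) - λ`.
  obtain ⟨A, hA, hl, hl'⟩ := exists_mulVec_eq_of_det₂ h
    (x' := -s⁻¹ • formLambda) (y' := (2 / t) • (formMu + formLambda))
    (by simp [det₂, formMu, formLambda, hs, ht])
  have key : SameOrbit (tri l 0 0 l' 0 (s • l + t • l')) (tri formLambda 0 0
      (formMu + formLambda) 0 ((2 : ℂ) • formMu + formLambda)) := by
    refine SameOrbit.tri_transform hA (x := -s) (y := t / 2) (z := 1) (x' := 1) (y' := 1)
      (z' := 1) (by simpa) (by simpa) one_ne_zero one_ne_zero one_ne_zero one_ne_zero ?_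
      (by simp) (by simp) ?_ (by simp) ?_
    · rw [hl, smul_smul]
      simp [hs]
    · rw [hl', smul_smul]
      field_simp
      simp
    · rw [Matrix.mulVec_add, Matrix.mulVec_smul, Matrix.mulVec_smul, hl, hl', smul_smul, smul_smul]
      field_simp
      module
  refine key.inSomeClass ⟨.ABC8, fun n hn => ?_⟩
  convert (mutuallyRestrict_ABC8 hn).symm using 1
  funext i j k
  fin_cases i <;> fin_cases j <;> fin_cases k <;> simp [tri, coreABC8, formMu, formLambda]

/-- Two of the three points given by the diagonal coincide; the entry `p` decides whether the double
point has a Jordan block. -/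
theorem inSomeClass_tri_of_parallel {l l'' : Fin 2 → ℂ} {s : ℂ} (hs : s ≠ 0)
    (h : det₂ l l'' ≠ 0) (p : Fin 2 → ℂ) : InSomeClass (tri l p 0 (s • l) 0 l'') := by
  obtain ⟨c, d, rfl⟩ := exists_eq_smul_add_smul h p
  obtain ⟨A, hA, hl, hl''⟩ := exists_mulVec_eq_of_det₂ h
    (x' := formLambda) (y' := formMu + formLambda) (by simp [det₂, formMu, formLambda])
  have key := SameOrbit.tri_add_col_zero_one l (c • l + d • l'') 0 (s • l) 0 l'' (-c - d)
  by_cases hd : d = 0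
  · have key' : SameOrbit (tri l (c • l + d • l'') 0 (s • l) 0 l'')
        (tri formLambda 0 0 formLambda 0 (formMu + formLambda)) := by
      refine key.trans (SameOrbit.tri_transform hA (x := 1) (y := s⁻¹) (z := 1) (x' := 1)
        (y' := 1) (z' := 1) one_ne_zero (by simpa) one_ne_zero one_ne_zero one_ne_zero
        one_ne_zero (by simp [hl]) ?_ (by simp) ?_ (by simp) (by simp [hl'']))
      · rw [show c • l + d • l'' + (-c - d) • l = 0 by rw [hd]; module]
        simp
      · simp [Matrix.mulVec_smul, hl, smul_smul, hs]
    refine key'.inSomeClass ⟨.ABC9, fun n hn => ?_⟩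
    convert (mutuallyRestrict_ABC9 hn).symm using 1
    funext i j k
    fin_cases i <;> fin_cases j <;> fin_cases k <;> simp [tri, coreABC9, formMu, formLambda]
  · have key' : SameOrbit (tri l (c • l + d • l'') 0 (s • l) 0 l'')
        (tri formLambda formMu 0 formLambda 0 (formMu + formLambda)) := by
      refine key.trans (SameOrbit.tri_transform hA (x := 1) (y := d / s) (z := 1) (x' := 1)
        (y' := d⁻¹) (z' := 1) one_ne_zero (by simp [hs, hd]) one_ne_zero one_ne_zero (by simpa)
        one_ne_zero (by simp [hl]) ?_ (by simp) ?_ (by simp) (by simp [hl'']))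
      · rw [show c • l + d • l'' + (-c - d) • l = d • (l'' - l) by module]
        simp [Matrix.mulVec_smul, Matrix.mulVec_sub, hl, hl'', smul_smul, hd]
      · simp only [Matrix.mulVec_smul, hl, smul_smul]
        field_simp
        simp
    refine key'.inSomeClass ⟨.ABC12, fun n hn => ?_⟩
    convert (mutuallyRestrict_ABC12 hn).symm using 1
    funext i j k
    fin_cases i <;> fin_cases j <;> fin_cases k <;> simp [tri, coreABC12, formMu, formLambda]

theorem inSomeClass_tri_ABC11 {a : ℂ} (ha : a ≠ 0) :
    InSomeClass (tri formLambda (a • formMu) 0 formLambda 0 formLambda) := by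
  have key : SameOrbit (tri formLambda (a • formMu) 0 formLambda 0 formLambda)
      (tri formLambda formMu 0 formLambda 0 formLambda) := by
    refine SameOrbit.tri_transform (A := 1) (by simp) (x := 1) (y := a) (z := 1) (x' := 1)
      (y' := a⁻¹) (z' := 1) one_ne_zero ha one_ne_zero one_ne_zero (by simpa) one_ne_zero
      ?_ ?_ ?_ ?_ ?_ ?_ <;> simp [smul_smul, ha]
  refine key.inSomeClass ⟨.ABC11, fun n hn => ?_⟩
  convert (mutuallyRestrict_ABC11 hn).symm using 1
  funext i j k
  fin_cases i <;> fin_cases j <;> fin_cases k <;> simp [tri, coreABC11, formMu, formLambda]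

/-- The pencils `λ I + μ N` with `N` strictly upper triangular are classified by the rank
of `N`. -/
theorem inSomeClass_tri_unipotent (a b c : ℂ) : InSomeClass
    (tri formLambda (a • formMu) (c • formMu) formLambda (b • formMu) formLambda) := by
  by_cases ha : a = 0 <;> by_cases hb : b = 0
  · subst ha hb
    by_cases hc : c = 0
    · subst hc
      refine ⟨.A_BC2, fun n hn => ?_⟩
      refine MutuallyRestrict.trans ?_ (mutuallyRestrict_A_BC2 hn).symm
      refine mutuallyRestrict_of_padding (σ := fun _ => 1) (τ := id) (ρ := id)
        (fun _ _ _ => Subsingleton.elim _ _) Function.injective_id Function.injective_id ?_ ?_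
      · intro i j k
        rw [Subsingleton.elim i 0]
        fin_cases j <;> fin_cases k <;> simp [tri, coreA_BC2, formMu, formLambda]
      · intro x y z hx
        refine ⟨⟨0, ?_⟩, ⟨y, rfl⟩, ⟨z, rfl⟩⟩
        by_contra h1
        obtain rfl : x = 0 := by omega
        refine hx ?_
        fin_cases y <;> fin_cases z <;> simp [tri, formMu, formLambda]
    · rw [zero_smul]
      exact (SameOrbit.tri_swap_one_two ..).inSomeClass (inSomeClass_tri_ABC11 hc)
  · subst ha
    -- The entry `c μ` is cleared with the second row, and then `- (c / b) λ` with the first column.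
    have h₁ := SameOrbit.tri_add_row_one_zero formLambda ((0 : ℂ) • formMu) (c • formMu) formLambda
      (b • formMu) formLambda (-(c / b))
    have h₂ := SameOrbit.tri_add_col_zero_one formLambda
      ((0 : ℂ) • formMu + -(c / b) • formLambda) (c • formMu + -(c / b) • b • formMu) formLambda
      (b • formMu) formLambda (c / b)
    have h₃ := h₁.trans h₂
    rw [show (0 : ℂ) • formMu + -(c / b) • formLambda + (c / b) • formLambda = 0 by module,
      show c • formMu + -(c / b) • b • formMu = 0 by
        rw [smul_smul, neg_mul, div_mul_cancel₀ c hb]; module] at h₃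
    exact (h₃.trans (SameOrbit.tri_rotate ..)).inSomeClass (inSomeClass_tri_ABC11 hb)
  · subst hb
    have h₁ := SameOrbit.tri_add_col_one_two formLambda (a • formMu) (c • formMu) formLambda
      ((0 : ℂ) • formMu) formLambda (-(c / a))
    have h₂ := SameOrbit.tri_add_row_two_one formLambda (a • formMu)
      (c • formMu + -(c / a) • a • formMu) formLambda
      ((0 : ℂ) • formMu + -(c / a) • formLambda) formLambda (c / a)
    have h₃ := h₁.trans h₂
    rw [show (0 : ℂ) • formMu + -(c / a) • formLambda + (c / a) • formLambda = 0 by module,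
      show c • formMu + -(c / a) • a • formMu = 0 by
        rw [smul_smul, neg_mul, div_mul_cancel₀ c ha]; module] at h₃
    exact h₃.inSomeClass (inSomeClass_tri_ABC11 ha)
  · have h₁ := SameOrbit.tri_add_row_one_zero formLambda (a • formMu) (c • formMu) formLambda
      (b • formMu) formLambda (-(c / b))
    have h₂ := SameOrbit.tri_add_col_zero_one formLambda
      (a • formMu + -(c / b) • formLambda) (c • formMu + -(c / b) • b • formMu) formLambda
      (b • formMu) formLambda (c / b)
    have h₃ := h₁.trans h₂
    rw [show a • formMu + -(c / b) • formLambda + (c / b) • formLambda = a • formMu by module,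
      show c • formMu + -(c / b) • b • formMu = 0 by
        rw [smul_smul, neg_mul, div_mul_cancel₀ c hb]; module] at h₃
    have key : SameOrbit (tri formLambda (a • formMu) 0 formLambda (b • formMu) formLambda)
        (tri formLambda formMu 0 formLambda formMu formLambda) := by
      refine SameOrbit.tri_transform (A := 1) (by simp) (x := 1) (y := a) (z := a * b) (x' := 1)
        (y' := a⁻¹) (z' := (a * b)⁻¹) one_ne_zero ha (by simp [ha, hb]) one_ne_zero (by simpa)
        (by simp [ha, hb]) ?_ ?_ ?_ ?_ ?_ ?_ <;> simp [smul_smul, ha]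
      all_goals field_simp; simp
    refine (h₃.trans key).inSomeClass ⟨.ABC13, fun n hn => ?_⟩
    convert (mutuallyRestrict_ABC13 hn).symm using 1
    funext i j k
    fin_cases i <;> fin_cases j <;> fin_cases k <;> simp [tri, coreABC13, formMu, formLambda]

/-- The three points given by the diagonal coincide. -/
theorem inSomeClass_tri_of_all_parallel {l : Fin 2 → ℂ} (hl : l ≠ 0) {s t : ℂ} (hs : s ≠ 0)
    (ht : t ≠ 0) (p q r : Fin 2 → ℂ) : InSomeClass (tri l p q (s • l) r (t • l)) := by
  obtain ⟨m, hm⟩ := exists_det₂_ne_zero hl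
  obtain ⟨A, hA, hl', hm'⟩ := exists_mulVec_eq_of_det₂ hm det₂_formLambda_formMu
  obtain ⟨p₁, p₂, hp⟩ := exists_eq_smul_add_smul det₂_formLambda_formMu (A *ᵥ p)
  obtain ⟨q₁, q₂, hq⟩ := exists_eq_smul_add_smul det₂_formLambda_formMu (A *ᵥ q)
  obtain ⟨r₁, r₂, hr⟩ := exists_eq_smul_add_smul det₂_formLambda_formMu (s⁻¹ • A *ᵥ r)
  have h₁ : SameOrbit (tri l p q (s • l) r (t • l)) (tri formLambda (p₁ • formLambda + p₂ • formMu)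
      (q₁ • formLambda + q₂ • formMu) formLambda (r₁ • formLambda + r₂ • formMu) formLambda) := by
    refine SameOrbit.tri_transform hA (x := 1) (y := s⁻¹) (z := t⁻¹) (x' := 1) (y' := 1)
      (z' := 1) one_ne_zero (by simpa) (by simpa) one_ne_zero one_ne_zero one_ne_zero
      ?_ ?_ ?_ ?_ ?_ ?_ <;> simp [Matrix.mulVec_smul, hl', smul_smul, hp, hq, hs, ht]
    simpa using hr
  -- The multiples of `λ` above the diagonal are cleared with column operations.
  have h₂ := SameOrbit.tri_add_col_zero_one formLambda (p₁ • formLambda + p₂ • formMu)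
      (q₁ • formLambda + q₂ • formMu) formLambda (r₁ • formLambda + r₂ • formMu) formLambda (-p₁)
  rw [show p₁ • formLambda + p₂ • formMu + -p₁ • formLambda = p₂ • formMu by module] at h₂
  have h₃ := SameOrbit.tri_add_col_one_two formLambda (p₂ • formMu)
      (q₁ • formLambda + q₂ • formMu) formLambda (r₁ • formLambda + r₂ • formMu) formLambda (-r₁)
  rw [show r₁ • formLambda + r₂ • formMu + -r₁ • formLambda = r₂ • formMu by module] at h₃
  have h₄ := SameOrbit.tri_add_col_zero_two formLambda (p₂ • formMu)
      (q₁ • formLambda + q₂ • formMu + -r₁ • p₂ • formMu) formLambda (r₂ • formMu) formLambda (-q₁)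
  rw [show q₁ • formLambda + q₂ • formMu + -r₁ • p₂ • formMu + -q₁ • formLambda =
    (q₂ - r₁ * p₂) • formMu by module] at h₄
  exact (h₁.trans (h₂.trans (h₃.trans h₄))).inSomeClass (inSomeClass_tri_unipotent _ _ _)

theorem SameOrbit.tri_mix_columns_one_two {x y x' y' : ℂ} (h : x * y' - y * x' ≠ 0)
    (l p q l' r : Fin 2 → ℂ) : SameOrbit (tri l p q l' r 0)
      (tri l (x • p + y • q) (x' • p + y' • q) (x • l' + y • r) (x' • l' + y' • r) 0) := by
  refine of_charlie (C := !![1, 0, 0; 0, x, y; 0, x', y'])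
    (by simpa [Matrix.det_fin_three] using h) fun i j k => ?_
  fin_cases j <;> fin_cases k <;> simp [tri, Fin.sum_univ_three]

theorem SameOrbit.tri_mix_columns_zero_one {x y x' y' : ℂ} (h : x * y' - y * x' ≠ 0)
    (l p q r l'' : Fin 2 → ℂ) : SameOrbit (tri l p q 0 r l'')
      (tri (x • l + y • p) (x' • l + y' • p) q 0 r l'') := by
  refine of_charlie (C := !![x, y, 0; x', y', 0; 0, 0, 1])
    (by simpa [Matrix.det_fin_three] using h) fun i j k => ?_
  fin_cases j <;> fin_cases k <;> simp [tri, Fin.sum_univ_three]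

theorem SameOrbit.tri_mix_rows_one_two {x y x' y' : ℂ} (h : x * y' - y * x' ≠ 0)
    (l p q r l'' : Fin 2 → ℂ) : SameOrbit (tri l p q 0 r l'')
      (tri l p q 0 (x • r + y • l'') (x' • r + y' • l'')) := by
  refine of_bob (B := !![1, 0, 0; 0, x, y; 0, x', y'])
    (by simpa [Matrix.det_fin_three] using h) fun i j k => ?_
  fin_cases j <;> fin_cases k <;> simp [tri, Fin.sum_univ_three]

/-- Two bases of the plane are related by an invertible matrix. In contrast to
`exists_mulVec_eq_of_det₂` the matrix acts on the index of the pair, that is, by row or column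
operations on two linear forms, and not on the coefficients of the forms. -/
theorem exists_mix_of_det₂ {x y x' y' : Fin 2 → ℂ} (h : det₂ x y ≠ 0) (h' : det₂ x' y' ≠ 0) :
    ∃ a b c d : ℂ, a * d - b * c ≠ 0 ∧ x' = a • x + b • y ∧ y' = c • x + d • y := by
  obtain ⟨a, b, rfl⟩ := exists_eq_smul_add_smul h x'
  obtain ⟨c, d, rfl⟩ := exists_eq_smul_add_smul h y'
  refine ⟨a, b, c, d, fun h0 => h' ?_, rfl, rfl⟩
  simp only [det₂, Pi.add_apply, Pi.smul_apply, smul_eq_mul]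
  linear_combination (x 0 * y 1 - x 1 * y 0) * h0

/-- The last row vanishes, and the second one is a block `L 1`: the pencil is `L 2`, or `L 1` with
a block of size one. -/
theorem inSomeClass_tri_last_zero {l l' r : Fin 2 → ℂ} (hl : l ≠ 0) (h : det₂ l' r ≠ 0)
    (p q : Fin 2 → ℂ) : InSomeClass (tri l p q l' r 0) := by
  -- Mixing the last two columns makes the second row `(0, l, m)`; then `l` and `m` are moved to
  -- `λ` and `μ`.
  obtain ⟨m, hm⟩ := exists_det₂_ne_zero hl
  obtain ⟨a, b, c, d, hd, e₁, e₂⟩ := exists_mix_of_det₂ h hm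
  have h₁ := SameOrbit.tri_mix_columns_one_two hd l p q l' r
  rw [← e₁, ← e₂] at h₁
  obtain ⟨A, hA, hl', hm'⟩ := exists_mulVec_eq_of_det₂ hm det₂_formLambda_formMu
  have h₂ := SameOrbit.tri_mulVec l (a • p + b • q) (c • p + d • q) l m 0 hA
  rw [hl', hm', Matrix.mulVec_zero] at h₂
  obtain ⟨p₁, p₂, hp⟩ := exists_eq_smul_add_smul det₂_formLambda_formMu (A *ᵥ (a • p + b • q))
  obtain ⟨q₁, q₂, hq⟩ := exists_eq_smul_add_smul det₂_formLambda_formMu (A *ᵥ (c • p + d • q))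
  rw [hp, hq] at h₂
  -- The first row is reduced to `(λ, p₂ μ, 0)` with the second row and the first column.
  have h₃ := SameOrbit.tri_add_row_one_zero formLambda (p₁ • formLambda + p₂ • formMu)
    (q₁ • formLambda + q₂ • formMu) formLambda formMu 0 (-q₂)
  have h₄ := SameOrbit.tri_add_col_zero_two formLambda
    (p₁ • formLambda + p₂ • formMu + -q₂ • formLambda)
    (q₁ • formLambda + q₂ • formMu + -q₂ • formMu) formLambda formMu 0 (-q₁)
  rw [show q₁ • formLambda + q₂ • formMu + -q₂ • formMu + -q₁ • formLambda = 0 by module] at h₄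
  have h₅ := SameOrbit.tri_add_col_zero_one formLambda
    (p₁ • formLambda + p₂ • formMu + -q₂ • formLambda) 0 formLambda formMu 0 (q₂ - p₁)
  rw [show p₁ • formLambda + p₂ • formMu + -q₂ • formLambda + (q₂ - p₁) • formLambda =
    p₂ • formMu by module] at h₅
  have h₆ := h₁.trans (h₂.trans (h₃.trans (h₄.trans h₅)))
  refine h₆.inSomeClass ?_
  by_cases hp₂ : p₂ = 0
  · subst hp₂
    refine ⟨.ABC3, fun n hn => ?_⟩
    refine MutuallyRestrict.trans ?_ (mutuallyRestrict_ABC3 hn).symm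
    refine mutuallyRestrict_of_padding (σ := id) (τ := ![1, 0]) (ρ := ![1, 2, 0])
      Function.injective_id (by decide) (by decide) ?_ fun x y z hx => ⟨⟨x, rfl⟩, ?_, ?_⟩
    · intro i j k
      fin_cases i <;> fin_cases j <;> fin_cases k <;> simp [tri, coreABC3, formMu, formLambda]
    · fin_cases y
      exacts [⟨1, rfl⟩, ⟨0, rfl⟩, absurd (by fin_cases z <;> rfl) hx]
    · fin_cases z
      exacts [⟨2, rfl⟩, ⟨0, rfl⟩, ⟨1, rfl⟩]
  · have h₇ : SameOrbit (tri formLambda (p₂ • formMu) 0 formLambda formMu 0)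
        (tri formLambda formMu 0 formLambda formMu 0) := by
      refine SameOrbit.tri_transform (A := 1) (by simp) (x := 1) (y := p₂) (z := 1) (x' := 1)
        (y' := p₂⁻¹) (z' := p₂⁻¹) one_ne_zero hp₂ one_ne_zero one_ne_zero (by simpa) (by simpa)
        ?_ ?_ ?_ ?_ ?_ ?_ <;> simp [smul_smul, hp₂]
    refine h₇.inSomeClass ⟨.ABC4, fun n hn => ?_⟩
    refine MutuallyRestrict.trans ?_ (mutuallyRestrict_ABC4 hn).symm
    refine mutuallyRestrict_of_padding (σ := id) (τ := ![0, 1]) (ρ := id)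
      Function.injective_id (by decide) Function.injective_id ?_
      fun x y z hx => ⟨⟨x, rfl⟩, ?_, ⟨z, rfl⟩⟩
    · intro i j k
      fin_cases i <;> fin_cases j <;> fin_cases k <;> simp [tri, coreABC4, formMu, formLambda]
    · fin_cases y
      exacts [⟨0, rfl⟩, ⟨1, rfl⟩, absurd (by fin_cases z <;> rfl) hx]

/-- The pencils whose first row starts with a block `L 1`. -/
theorem inSomeClass_tri_middle_zero {l p : Fin 2 → ℂ} (h : det₂ l p ≠ 0) {r l'' : Fin 2 → ℂ}
    (hr : r ≠ 0 ∨ l'' ≠ 0) (q : Fin 2 → ℂ) : InSomeClass (tri l p q 0 r l'') := by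
  obtain ⟨s, t, rfl⟩ := exists_eq_smul_add_smul h q
  have h₁ := SameOrbit.tri_add_col_zero_two l p (s • l + t • p) 0 r l'' (-s)
  have h₂ := SameOrbit.tri_add_col_one_two l p (s • l + t • p + -s • l) 0 r l'' (-t)
  rw [show s • l + t • p + -s • l + -t • p = 0 by module, smul_zero, add_zero] at h₂
  refine (h₁.trans h₂).inSomeClass ?_
  by_cases hd : det₂ r l'' = 0
  · -- The last two rows are proportional, and one of them is cleared.
    obtain ⟨r', hr', h₃⟩ : ∃ r' : Fin 2 → ℂ, r' ≠ 0 ∧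
        SameOrbit (tri l p 0 0 r l'') (tri l p 0 0 r' 0) := by
      by_cases hr0 : r = 0
      · refine ⟨l'', hr.resolve_left (not_not.2 hr0), ?_⟩
        have := SameOrbit.tri_mix_rows_one_two (x := 0) (y := 1) (x' := 1) (y' := 0) (by simp)
          l p 0 r l''
        simpa [hr0] using this
      · obtain ⟨c, rfl⟩ := exists_eq_smul_of_det₂_eq_zero hr0 hd
        refine ⟨r, hr0, ?_⟩
        have := SameOrbit.tri_mix_rows_one_two (x := 1) (y := 0) (x' := -c) (y' := 1) (by simp)
          l p 0 r (c • r)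
        simpa using this
    obtain ⟨m, hm⟩ := exists_det₂_ne_zero hr'
    obtain ⟨a, b, c, d, habcd, e₁, e₂⟩ := exists_mix_of_det₂ h hm
    have h₄ := SameOrbit.tri_mix_columns_zero_one habcd l p 0 r' 0
    rw [← e₁, ← e₂] at h₄
    obtain ⟨A, hA, hl', hm'⟩ := exists_mulVec_eq_of_det₂ hm det₂_formLambda_formMu
    have h₅ := SameOrbit.tri_mulVec r' m 0 0 r' 0 hA
    rw [hl', hm', Matrix.mulVec_zero] at h₅
    refine (h₃.trans (h₄.trans h₅)).inSomeClass ⟨.ABC3, fun n hn => ?_⟩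
    refine MutuallyRestrict.trans ?_ (mutuallyRestrict_ABC3 hn).symm
    refine mutuallyRestrict_of_padding (σ := id) (τ := ![0, 1]) (ρ := id)
      Function.injective_id (by decide) Function.injective_id ?_
      fun x y z hx => ⟨⟨x, rfl⟩, ?_, ⟨z, rfl⟩⟩
    · intro i j k
      fin_cases i <;> fin_cases j <;> fin_cases k <;> simp [tri, coreABC3, formMu, formLambda]
    · fin_cases y
      exacts [⟨0, rfl⟩, ⟨1, rfl⟩, absurd (by fin_cases z <;> rfl) hx]
  · obtain ⟨a, b, c, d, habcd, e₁, e₂⟩ := exists_mix_of_det₂ hd h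
    have h₃ := SameOrbit.tri_mix_rows_one_two habcd l p 0 r l''
    rw [← e₁, ← e₂] at h₃
    obtain ⟨A, hA, hl', hm'⟩ := exists_mulVec_eq_of_det₂ h det₂_formLambda_formMu
    have h₄ := SameOrbit.tri_mulVec l p 0 0 l p hA
    rw [hl', hm', Matrix.mulVec_zero] at h₄
    refine (h₃.trans h₄).inSomeClass ⟨.ABC10, fun n hn => ?_⟩
    convert (mutuallyRestrict_ABC10 hn).symm using 1
    funext i j k
    fin_cases i <;> fin_cases j <;> fin_cases k <;> simp [tri, coreABC10, formMu, formLambda]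

/-- When the middle entry of the diagonal vanishes, independence of the first two columns makes `l`
and `p` independent. -/
theorem inSomeClass_tri_of_conciseC_middle_zero {l p q r l'' : Fin 2 → ℂ}
    (h : ConciseC (tri l p q 0 r l'')) : InSomeClass (tri l p q 0 r l'') := by
  have hlp : det₂ l p ≠ 0 := by
    intro h0
    have e := h ![p 0, -l 0, 0] (by
      unfold det₂ at h0
      simp [tri, Fin.forall_fin_succ, Fin.sum_univ_three]
      exact ⟨by ring, by linear_combination -h0⟩)
    have e' := h ![p 1, -l 1, 0] (by
      unfold det₂ at h0
      simp [tri, Fin.forall_fin_succ, Fin.sum_univ_three]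
      exact ⟨by linear_combination h0, by ring⟩)
    have e₁ : l 0 = 0 := by simpa using congrFun e 1
    have e₂ : l 1 = 0 := by simpa using congrFun e' 1
    have e₃ := h ![1, 0, 0] (by simp [tri, Fin.forall_fin_succ, Fin.sum_univ_three, e₁, e₂])
    simpa using congrFun e₃ 0
  refine inSomeClass_tri_middle_zero hlp ?_ q
  by_contra! h0
  obtain ⟨rfl, rfl⟩ := h0
  obtain ⟨s, t, rfl⟩ := exists_eq_smul_add_smul hlp q
  have e := h ![s, t, -1] (by simp [tri, Fin.forall_fin_succ, Fin.sum_univ_three])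
  simpa using congrFun e 2

theorem det₂_smul_left (s : ℂ) (x y : Fin 2 → ℂ) : det₂ (s • x) y = s * det₂ x y := by
  simp only [det₂, Pi.smul_apply, smul_eq_mul]
  ring

theorem det₂_smul_right (s : ℂ) (x y : Fin 2 → ℂ) : det₂ x (s • y) = s * det₂ x y := by
  simp only [det₂, Pi.smul_apply, smul_eq_mul]
  ring

theorem det₂_swap (x y : Fin 2 → ℂ) : det₂ y x = -det₂ x y := by
  simp only [det₂]
  ring

/-- Triangular pencils without zeros on the diagonal are regular; they are classified by the
position of the three points of the projective line given by the diagonal. -/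
theorem inSomeClass_tri_regular {l l' l'' : Fin 2 → ℂ} (hl : l ≠ 0) (hl' : l' ≠ 0) (hl'' : l'' ≠ 0)
    (p q r : Fin 2 → ℂ) : InSomeClass (tri l p q l' r l'') := by
  by_cases h : det₂ l l' = 0
  · obtain ⟨s, rfl⟩ := exists_eq_smul_of_det₂_eq_zero hl h
    have hs : s ≠ 0 := fun h0 => hl' (by rw [h0, zero_smul])
    by_cases h' : det₂ l l'' = 0
    · obtain ⟨t, rfl⟩ := exists_eq_smul_of_det₂_eq_zero hl h'
      have ht : t ≠ 0 := fun h0 => hl'' (by rw [h0, zero_smul])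
      exact inSomeClass_tri_of_all_parallel hl hs ht p q r
    · have h'' : det₂ (s • l) l'' ≠ 0 := by
        rw [det₂_smul_left]
        exact mul_ne_zero hs h'
      obtain ⟨q', h₁⟩ := SameOrbit.tri_eliminate_one_two h'' l p q r
      exact (h₁.trans (SameOrbit.tri_eliminate_zero_two h' ..)).inSomeClass
        (inSomeClass_tri_of_parallel hs h' p)
  · obtain ⟨q', h₁⟩ := SameOrbit.tri_eliminate_zero_one h p q r l''
    by_cases h' : det₂ l l'' = 0
    · obtain ⟨t, rfl⟩ := exists_eq_smul_of_det₂_eq_zero hl h'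
      have ht : t ≠ 0 := fun h0 => hl'' (by rw [h0, zero_smul])
      have h'' : det₂ l' (t • l) ≠ 0 := by
        rw [det₂_smul_right, det₂_swap]
        exact mul_ne_zero ht (neg_ne_zero.2 h)
      obtain ⟨q'', h₂⟩ := SameOrbit.tri_eliminate_one_two h'' l 0 q' r
      exact (h₁.trans (h₂.trans (SameOrbit.tri_swap_one_two ..))).inSomeClass
        (inSomeClass_tri_of_parallel ht h q'')
    · by_cases h'' : det₂ l' l'' = 0
      · obtain ⟨t, rfl⟩ := exists_eq_smul_of_det₂_eq_zero hl' h''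
        have ht : t ≠ 0 := fun h0 => hl'' (by rw [h0, zero_smul])
        have h₂ := SameOrbit.tri_eliminate_zero_two h' 0 q' l' r
        refine (h₁.trans (h₂.trans (SameOrbit.tri_rotate ..))).inSomeClass
          (inSomeClass_tri_of_parallel ht ?_ r)
        rw [det₂_swap]
        exact neg_ne_zero.2 h
      · obtain ⟨q'', h₂⟩ := SameOrbit.tri_eliminate_one_two h'' l 0 q' r
        exact (h₁.trans (h₂.trans (SameOrbit.tri_eliminate_zero_two h' ..))).inSomeClass
          (inSomeClass_tri_diagonal h h'' h')

/-- The pencil is regular if the diagonal of its triangular form has no zero; otherwise it contains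
a block `L 1` or `L 2`. -/
theorem inSomeClass_of_conciseC_three (ψ : Tensor 2 3 3) (hψ : ConciseC ψ) : InSomeClass ψ := by
  obtain ⟨l, p, q, l', r, l'', h⟩ := exists_sameOrbit_tri ψ
  have hc := h.conciseC hψ
  refine h.inSomeClass ?_
  have hl : l ≠ 0 := by
    rintro rfl
    have e := hc ![1, 0, 0] (by simp [tri, Fin.forall_fin_succ, Fin.sum_univ_three])
    simpa using congrFun e 0
  by_cases hl' : l' = 0
  · subst hl'
    exact inSomeClass_tri_of_conciseC_middle_zero hc
  · by_cases hl'' : l'' = 0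
    · subst hl''
      by_cases hr : det₂ l' r = 0
      · obtain ⟨s, rfl⟩ := exists_eq_smul_of_det₂_eq_zero hl' hr
        have h₁ := SameOrbit.tri_add_col_one_two l p q l' (s • l') 0 (-s)
        rw [show s • l' + -s • l' = 0 by module] at h₁
        have h₂ := h₁.trans (SameOrbit.tri_swap_one_two ..)
        exact h₂.inSomeClass (inSomeClass_tri_of_conciseC_middle_zero (h₂.conciseC hc))
      · exact inSomeClass_tri_last_zero hl hr p q
    · exact inSomeClass_tri_regular hl hl' hl'' p q r

/-! ### Duality of spaces of slices -/

/-- The space spanned by the slices `ψ · · k` is the orthogonal complement of the one spanned by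
the slices of `χ`, for the bilinear form `∑ i, ∑ j, X i j * Y i j`. -/
structure IsDual {a b c m : ℕ} (ψ : Tensor a b c) (χ : Tensor a b m) : Prop where
  orthogonal : ∀ k l, ∑ i, ∑ j, ψ i j k * χ i j l = 0
  exists_coeff : ∀ X : Fin a → Fin b → ℂ, (∀ l, ∑ i, ∑ j, X i j * χ i j l = 0) →
    ∃ z : Fin c → ℂ, ∀ i j, X i j = ∑ k, z k * ψ i j k

theorem sum_comm_four {a b c d : ℕ} (F : Fin a → Fin b → Fin c → Fin d → ℂ) :
    ∑ i, ∑ j, ∑ x, ∑ y, F i j x y = ∑ x, ∑ y, ∑ i, ∑ j, F i j x y := by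
  have h := Finset.sum_comm (s := Finset.univ) (t := Finset.univ)
    (f := fun (p : Fin a × Fin b) (q : Fin c × Fin d) => F p.1 p.2 q.1 q.2)
  simpa only [Fintype.sum_prod_type] using h

/-- The adjoint of `A ⊗ B` maps the orthogonal complement of the slices of `Q` into that of the
slices of `χ`. -/
theorem IsDual.restricts_of_sameOrbit {a b c d m : ℕ} {ψ : Tensor a b c} {D : Tensor a b d}
    {χ Q : Tensor a b m} (hψ : IsDual ψ χ) (hD : IsDual D Q) (h : SameOrbit χ Q) :
    Restricts ψ D := by
  obtain ⟨A, B, C, hA, hB, hC, rfl⟩ := h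
  have hAu : IsUnit Aᵀ.det := by simpa using hA
  have hBu : IsUnit Bᵀ.det := by simpa using hB
  have key (k : Fin d) (z : Fin m) :
      ∑ x, ∑ y, (∑ i, ∑ j, A i x * B j y * D i j k) * χ x y z = 0 := by
    have h₁ : ∀ l, ∑ z, C l z *
        (∑ x, ∑ y, (∑ i, ∑ j, A i x * B j y * D i j k) * χ x y z) = 0 := by
      intro l
      rw [← hD.orthogonal k l]
      simp only [localOp, Finset.mul_sum, Finset.sum_mul]
      conv_rhs => rw [sum_comm_four]
      refine Finset.sum_comm.trans (Finset.sum_congr rfl fun x _ => ?_)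
      refine Finset.sum_comm.trans (Finset.sum_congr rfl fun y _ => ?_)
      refine Finset.sum_comm.trans (Finset.sum_congr rfl fun i _ => ?_)
      refine Finset.sum_comm.trans (Finset.sum_congr rfl fun j _ =>
        Finset.sum_congr rfl fun z _ => ?_)
      ring
    have h₂ : C *ᵥ (fun z => ∑ x, ∑ y, (∑ i, ∑ j, A i x * B j y * D i j k) * χ x y z) = 0 :=
      funext h₁
    exact congrFun (Matrix.eq_zero_of_mulVec_eq_zero hC h₂) z
  choose z hz using fun k => hψ.exists_coeff _ (key k)
  have e : localOp Aᵀ Bᵀ (1 : Matrix (Fin d) (Fin d) ℂ) D =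
      localOp 1 1 (Matrix.of z) ψ := by
    funext x y k
    rw [localOp_one_apply]
    simpa [Matrix.one_apply, localOp] using hz k x y
  refine ⟨Aᵀ⁻¹, Bᵀ⁻¹, Matrix.of z, ?_⟩
  have e' := congrArg (fun t => localOp Aᵀ⁻¹ Bᵀ⁻¹ (1 : Matrix (Fin d) (Fin d) ℂ) t) e
  rw [localOp_localOp, localOp_localOp, Matrix.nonsing_inv_mul _ hAu,
    Matrix.nonsing_inv_mul _ hBu, Matrix.one_mul, localOp_one, Matrix.mul_one, Matrix.mul_one,
    Matrix.one_mul] at e'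
  exact e'

theorem IsDual.mutuallyRestrict {a b c d m : ℕ} {ψ : Tensor a b c} {D : Tensor a b d}
    {χ Q : Tensor a b m} (hψ : IsDual ψ χ) (hD : IsDual D Q) (h : SameOrbit χ Q) :
    MutuallyRestrict ψ D :=
  ⟨hψ.restricts_of_sameOrbit hD h, hD.restricts_of_sameOrbit hψ h.symm⟩

theorem linearIndependent_of_conciseC {a b c : ℕ} {ψ : Tensor a b c} (hψ : ConciseC ψ) :
    LinearIndependent ℂ fun k i j => ψ i j k := by
  rw [Fintype.linearIndependent_iff]
  intro z hz k
  refine congrFun (hψ z fun i j => ?_) k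
  simpa using congrFun (congrFun hz i) j

/-- A tensor with independent slices has a dual tensor with independent slices; the two numbers of
slices are complementary. -/
theorem exists_isDual {a b c m : ℕ} {ψ : Tensor a b c} (hψ : ConciseC ψ) (h : c + m = a * b) :
    ∃ χ : Tensor a b m, ConciseC χ ∧ IsDual ψ χ := by
  let V : Submodule ℂ (Fin a → Fin b → ℂ) := Submodule.span ℂ (Set.range fun k i j => ψ i j k)
  have hV : Module.finrank ℂ V = c := by
    simpa using finrank_span_eq_card (linearIndependent_of_conciseC hψ)
  have hm : Module.finrank ℂ V.dualAnnihilator = m := by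
    have e := Subspace.finrank_add_finrank_dualAnnihilator_eq V
    rw [hV, Module.finrank_pi_fintype] at e
    simp at e
    omega
  -- The slices of `χ` are a basis of the annihilator of `V`, in coordinates.
  let f := Module.finBasisOfFinrankEq ℂ _ hm
  let g (l : Fin m) : Module.Dual ℂ (Fin a → Fin b → ℂ) := f l
  have hf (l) (X : Fin a → Fin b → ℂ) :
      ∑ i, ∑ j, X i j * g l (Pi.single i (Pi.single j 1)) = g l X := by
    conv_rhs => rw [show X = ∑ i, ∑ j, X i j • Pi.single i (Pi.single j (1 : ℂ)) by
      funext i j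
      simp [Finset.sum_apply, Pi.single_apply, apply_ite, ite_apply]]
    simp [map_sum]
  refine ⟨fun i j l => g l (Pi.single i (Pi.single j 1)), ?_, ?_, ?_⟩
  · intro z hz
    have : ∑ l, z l • f l = 0 := by
      refine Subtype.ext (LinearMap.ext fun X => ?_)
      simp only [Submodule.coe_sum, Submodule.coe_smul, LinearMap.sum_apply,
        LinearMap.smul_apply, Submodule.coe_zero, LinearMap.zero_apply, smul_eq_mul]
      change ∑ l, z l * g l X = 0
      have e (l) : z l * g l X =
          ∑ i, ∑ j, z l * (X i j * g l (Pi.single i (Pi.single j 1))) := by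
        simp only [← Finset.mul_sum, hf]
      simp only [e]
      rw [Finset.sum_comm]
      refine Finset.sum_eq_zero fun i _ => ?_
      rw [Finset.sum_comm]
      refine Finset.sum_eq_zero fun j _ => ?_
      have e : ∑ l, z l * g l (Pi.single i (Pi.single j 1)) = 0 := hz i j
      simp only [mul_left_comm (z _), ← Finset.mul_sum, e, mul_zero]
    funext l
    exact Fintype.linearIndependent_iff.1 f.linearIndependent z this l
  · intro k l
    rw [hf l fun i j => ψ i j k]
    exact (Submodule.mem_dualAnnihilator _).1 (f l).2 _ (Submodule.subset_span ⟨k, rfl⟩)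
  · intro X hX
    have hX' : X ∈ V.dualAnnihilator.dualCoannihilator := by
      rw [Submodule.mem_dualCoannihilator]
      intro y hy
      have := f.sum_repr ⟨y, hy⟩
      have e := congrArg (fun t : V.dualAnnihilator => (t : Module.Dual ℂ _) X) this
      simp only [Submodule.coe_sum, Submodule.coe_smul, LinearMap.sum_apply,
        LinearMap.smul_apply] at e
      rw [← e]
      refine Finset.sum_eq_zero fun l _ => ?_
      change _ • g l X = 0
      rw [← hf, hX, smul_zero]
    rw [Subspace.dualAnnihilator_dualCoannihilator_eq] at hX'
    obtain ⟨z, hz⟩ := (Submodule.mem_span_range_iff_exists_fun ℂ).1 hX'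
    exact ⟨z, fun i j => by simpa using (congrFun (congrFun hz i) j).symm⟩

/-- Every tensor can be compressed, on the last party, to one with independent slices. -/
theorem exists_conciseC {a b n : ℕ} (ψ : Tensor a b n) :
    ∃ (d : ℕ) (φ : Tensor a b d), d ≤ a * b ∧ ConciseC φ ∧ MutuallyRestrict ψ φ := by
  let V : Submodule ℂ (Fin a → Fin b → ℂ) := Submodule.span ℂ (Set.range fun k i j => ψ i j k)
  let f := Module.finBasis ℂ V
  have hle : Module.finrank ℂ V ≤ a * b := by
    refine V.finrank_le.trans ?_
    rw [Module.finrank_pi_fintype]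
    simp
  choose z hz using fun k => (Submodule.mem_span_range_iff_exists_fun ℂ).1 (f k).2
  refine ⟨_, fun i j k => (f k : Fin a → Fin b → ℂ) i j, hle, ?_,
    ⟨1, 1, Matrix.of z, ?_⟩, ⟨1, 1, Matrix.of fun k l => f.repr ⟨_, Submodule.subset_span
      ⟨k, rfl⟩⟩ l, ?_⟩⟩
  · intro y hy
    funext l
    refine Fintype.linearIndependent_iff.1 f.linearIndependent y ?_ l
    ext i j
    simpa using hy i j
  · funext i j k
    rw [localOp_one_apply, ← hz]
    simp [Matrix.one_apply]
  · funext i j k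
    have := f.sum_repr (⟨fun i j => ψ i j k, Submodule.subset_span ⟨k, rfl⟩⟩ : V)
    have e := congrFun (congrFun (congrArg Subtype.val this) i) j
    simp only [Submodule.coe_sum, Submodule.coe_smul, Finset.sum_apply, Pi.smul_apply,
      smul_eq_mul] at e
    rw [localOp_one_apply]
    refine e.symm.trans ?_
    simp [Matrix.one_apply]

/-! ### Pencils with one or two columns, and their duals -/

/-- Up to the action of the local groups, `χ` is equivalent to a representative, and so is some
tensor dual to it. -/
def ClassifiedWithDual {m : ℕ} (χ : Tensor 2 3 m) : Prop :=
  ∃ (Q : Tensor 2 3 m) (d : ℕ) (D : Tensor 2 3 d),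
    SameOrbit χ Q ∧ InSomeClass Q ∧ IsDual D Q ∧ InSomeClass D

theorem ClassifiedWithDual.inSomeClass {m : ℕ} {χ : Tensor 2 3 m} (h : ClassifiedWithDual χ) :
    InSomeClass χ := by
  obtain ⟨Q, d, D, hQ, hQ', -⟩ := h
  exact hQ.inSomeClass hQ'

theorem ClassifiedWithDual.inSomeClass_of_isDual {m c : ℕ} {χ : Tensor 2 3 m}
    (h : ClassifiedWithDual χ) {ψ : Tensor 2 3 c} (hψ : IsDual ψ χ) : InSomeClass ψ := by
  obtain ⟨Q, d, D, hQ, -, hDQ, hD⟩ := h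
  exact (hψ.mutuallyRestrict hDQ hQ).inSomeClass hD

theorem SameOrbit.classifiedWithDual {m : ℕ} {χ φ : Tensor 2 3 m} (h : SameOrbit χ φ)
    (hφ : ClassifiedWithDual φ) : ClassifiedWithDual χ := by
  obtain ⟨Q, d, D, hQ, h'⟩ := hφ
  exact ⟨Q, d, D, h.trans hQ, h'⟩

/-- The `3 × 2` pencil with the columns `(l, 0, 0)` and `(p, q, r)`. -/
def twoCol (l p q r : Fin 2 → ℂ) : Tensor 2 3 2 :=
  fun i => ![![l i, p i], ![0, q i], ![0, r i]]

/-- The `3 × 2` pencil with the columns `(μ, -λ, 0)` and `(p, q, r)`. -/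
def chainCol (p q r : Fin 2 → ℂ) : Tensor 2 3 2 :=
  fun i => ![![formMu i, p i], ![-formLambda i, q i], ![0, r i]]

/-- The `3 × 1` pencil with the column `(0, q, r)`. -/
def oneCol (q r : Fin 2 → ℂ) : Tensor 2 3 1 :=
  fun i => ![![0], ![q i], ![r i]]

/-- A tensor of the class `AC_B`; its duals are of the class `ABC5`. -/
theorem classifiedWithDual_twoCol_AC_B : ClassifiedWithDual (twoCol formLambda formMu 0 0) := by
  refine ⟨_, 4, ![![![0, 0, 0, 0], ![0, 1, 0, 0], ![0, 0, 0, 1]],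
      ![![0, 0, 0, 0], ![1, 0, 0, 0], ![0, 0, 1, 0]]], SameOrbit.refl _, ?_, ⟨?_, ?_⟩,
    ⟨.ABC5, fun n hn => MutuallyRestrict.trans ?_ (mutuallyRestrict_ABC5 hn).symm⟩⟩
  · refine ⟨.AC_B, fun n hn => MutuallyRestrict.trans ?_ (mutuallyRestrict_AC_B hn).symm⟩
    refine mutuallyRestrict_of_padding (σ := id) (τ := ![0]) (ρ := id)
      Function.injective_id (fun _ _ _ => Subsingleton.elim _ _) Function.injective_id ?_ ?_
    · intro i j k
      fin_cases i <;> fin_cases j <;> fin_cases k <;> simp [twoCol, coreAC_B, formMu, formLambda]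
    · intro x y z
      fin_cases x <;> fin_cases y <;> fin_cases z <;>
        simp [twoCol, formMu, formLambda]
  · intro k l
    fin_cases k <;> fin_cases l <;> simp [twoCol, formMu, formLambda, Fin.sum_univ_succ]
  · intro X h
    have h0 := h 0
    have h1 := h 1
    simp [twoCol, formMu, formLambda, Fin.sum_univ_succ] at h0 h1
    refine ⟨![X 1 1, X 0 1, X 1 2, X 0 2], fun i j => ?_⟩
    fin_cases i <;> fin_cases j <;> simp [Fin.sum_univ_succ] <;> grind
  · refine mutuallyRestrict_of_padding (σ := id) (τ := ![1, 2]) (ρ := id)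
      Function.injective_id (by decide) Function.injective_id ?_ ?_
    · intro i j k
      fin_cases i <;> fin_cases j <;> fin_cases k <;> simp [coreABC5]
    · intro x y z
      fin_cases x <;> fin_cases y <;> fin_cases z <;> simp [Fin.exists_fin_two]

/-- A tensor of the class `A_BC1`; its duals are of the class `ABC14`. -/
theorem classifiedWithDual_twoCol_A_BC1 : ClassifiedWithDual (twoCol formMu 0 formMu 0) := by
  refine ⟨_, 4, ![![![0, 0, 0, 0], ![0, 0, 0, 0], ![0, 1, 0, 0]],
      ![![0, 0, 1, 0], ![0, 0, 0, 1], ![1, 0, 0, 0]]], SameOrbit.refl _, ?_, ⟨?_, ?_⟩,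
    ⟨.ABC14, fun n hn => MutuallyRestrict.trans ?_ (mutuallyRestrict_ABC14 hn).symm⟩⟩
  · refine ⟨.A_BC1, fun n hn => MutuallyRestrict.trans ?_ (mutuallyRestrict_A_BC1 hn).symm⟩
    refine mutuallyRestrict_of_padding (σ := ![0]) (τ := ![0, 1]) (ρ := id)
      (fun _ _ _ => Subsingleton.elim _ _) (by decide) Function.injective_id ?_ ?_
    · intro i j k
      fin_cases i <;> fin_cases j <;> fin_cases k <;> simp [twoCol, coreA_BC1, formMu]
    · intro x y z
      fin_cases x <;> fin_cases y <;> fin_cases z <;>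
        simp [twoCol, formMu, Fin.exists_fin_succ]
  · intro k l
    fin_cases k <;> fin_cases l <;> simp [twoCol, formMu, Fin.sum_univ_succ]
  · intro X h
    have h0 := h 0
    have h1 := h 1
    simp [twoCol, formMu, Fin.sum_univ_succ] at h0 h1
    refine ⟨![X 1 2, X 0 2, X 1 0, X 1 1], fun i j => ?_⟩
    fin_cases i <;> fin_cases j <;> simp [Fin.sum_univ_succ] <;> grind
  · refine mutuallyRestrict_of_padding (σ := id) (τ := ![2, 0, 1]) (ρ := id)
      Function.injective_id (by decide) Function.injective_id ?_ ?_
    · intro i j k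
      fin_cases i <;> fin_cases j <;> fin_cases k <;> simp [coreABC14]
    · intro x y z
      fin_cases x <;> fin_cases y <;> fin_cases z <;> simp [Fin.exists_fin_succ]

/-- A tensor of the class `ABC1`; its duals are of the class `ABC15`. -/
theorem classifiedWithDual_twoCol_ABC1 :
    ClassifiedWithDual (twoCol formMu 0 (formMu - formLambda) 0) := by
  refine ⟨_, 4, ![![![0, 0, 0, 0], ![0, 0, 0, 1], ![0, 1, 0, 0]],
      ![![0, 0, 1, 0], ![0, 0, 0, 1], ![1, 0, 0, 0]]], SameOrbit.refl _, ?_, ⟨?_, ?_⟩,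
    ⟨.ABC15, fun n hn => MutuallyRestrict.trans ?_ (mutuallyRestrict_ABC15 hn).symm⟩⟩
  · -- After this change of basis for Alice only basis vectors have to be permuted.
    have h : SameOrbit (twoCol formMu 0 (formMu - formLambda) 0)
        (twoCol formLambda 0 (formMu + formLambda) 0) :=
      SameOrbit.of_alice (A := !![0, -1; 1, 0]) (by simp) fun i j k => by
        fin_cases i <;> fin_cases j <;> fin_cases k <;>
          simp [twoCol, formMu, formLambda]
    refine h.inSomeClass ⟨.ABC1, fun n hn =>
      MutuallyRestrict.trans ?_ (mutuallyRestrict_ABC1 hn).symm⟩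
    refine mutuallyRestrict_of_padding (σ := id) (τ := ![0, 1]) (ρ := id)
      Function.injective_id (by decide) Function.injective_id ?_ ?_
    · intro i j k
      fin_cases i <;> fin_cases j <;> fin_cases k <;> simp [twoCol, coreABC1, formMu, formLambda]
    · intro x y z
      fin_cases x <;> fin_cases y <;> fin_cases z <;>
        simp [twoCol, formMu, formLambda, Fin.exists_fin_succ]
  · intro k l
    fin_cases k <;> fin_cases l <;> simp [twoCol, formMu, formLambda, Fin.sum_univ_succ]
  · intro X h
    have h0 := h 0
    have h1 := h 1
    simp [twoCol, formMu, formLambda, Fin.sum_univ_succ] at h0 h1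
    refine ⟨![X 1 2, X 0 2, X 1 0, X 1 1], fun i j => ?_⟩
    fin_cases i <;> fin_cases j <;> simp [Fin.sum_univ_succ] <;> grind
  · refine mutuallyRestrict_of_padding (σ := id) (τ := ![2, 0, 1]) (ρ := id)
      Function.injective_id (by decide) Function.injective_id ?_ ?_
    · intro i j k
      fin_cases i <;> fin_cases j <;> fin_cases k <;> simp [coreABC15]
    · intro x y z
      fin_cases x <;> fin_cases y <;> fin_cases z <;> simp [Fin.exists_fin_succ]

/-- A tensor of the class `ABC2`; its duals are of the class `ABC16`. -/
theorem classifiedWithDual_twoCol_ABC2 :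
    ClassifiedWithDual (twoCol formMu (-formLambda) formMu 0) := by
  refine ⟨_, 4, ![![![0, 0, 0, 0], ![0, 0, 0, 1], ![0, 1, 0, 0]],
      ![![0, 0, 0, 1], ![0, 0, 1, 0], ![1, 0, 0, 0]]], SameOrbit.refl _, ?_, ⟨?_, ?_⟩,
    ⟨.ABC16, fun n hn => MutuallyRestrict.trans ?_ (mutuallyRestrict_ABC16 hn).symm⟩⟩
  · -- After this change of basis for Alice only basis vectors have to be permuted.
    have h : SameOrbit (twoCol formMu (-formLambda) formMu 0)
        (twoCol formLambda formMu formLambda 0) :=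
      SameOrbit.of_alice (A := !![0, -1; 1, 0]) (by simp) fun i j k => by
        fin_cases i <;> fin_cases j <;> fin_cases k <;>
          simp [twoCol, formMu, formLambda]
    refine h.inSomeClass ⟨.ABC2, fun n hn =>
      MutuallyRestrict.trans ?_ (mutuallyRestrict_ABC2 hn).symm⟩
    refine mutuallyRestrict_of_padding (σ := id) (τ := ![0, 1]) (ρ := id)
      Function.injective_id (by decide) Function.injective_id ?_ ?_
    · intro i j k
      fin_cases i <;> fin_cases j <;> fin_cases k <;> simp [twoCol, coreABC2, formMu, formLambda]
    · intro x y z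
      fin_cases x <;> fin_cases y <;> fin_cases z <;>
        simp [twoCol, formMu, formLambda, Fin.exists_fin_succ]
  · intro k l
    fin_cases k <;> fin_cases l <;> simp [twoCol, formMu, formLambda, Fin.sum_univ_succ]
  · intro X h
    have h0 := h 0
    have h1 := h 1
    simp [twoCol, formMu, formLambda, Fin.sum_univ_succ] at h0 h1
    refine ⟨![X 1 2, X 0 2, X 1 1, X 0 1], fun i j => ?_⟩
    fin_cases i <;> fin_cases j <;> simp [Fin.sum_univ_succ] <;> grind
  · refine mutuallyRestrict_of_padding (σ := id) (τ := ![2, 1, 0]) (ρ := id)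
      Function.injective_id (by decide) Function.injective_id ?_ ?_
    · intro i j k
      fin_cases i <;> fin_cases j <;> fin_cases k <;> simp [coreABC16]
    · intro x y z
      fin_cases x <;> fin_cases y <;> fin_cases z <;> simp [Fin.exists_fin_succ]

/-- A tensor of the class `ABC6`; its duals are of the class `ABC17`. -/
theorem classifiedWithDual_twoCol_ABC6 :
    ClassifiedWithDual (twoCol formMu 0 formMu (-formLambda)) := by
  refine ⟨_, 4, ![![![0, 0, 0, 0], ![0, 1, 0, 0], ![0, 0, 1, 0]],
      ![![0, 0, 0, 1], ![1, 0, 0, 0], ![0, 1, 0, 0]]], SameOrbit.refl _, ?_, ⟨?_, ?_⟩,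
    ⟨.ABC17, fun n hn => MutuallyRestrict.trans ?_ (mutuallyRestrict_ABC17 hn).symm⟩⟩
  · -- After this change of basis for Alice only basis vectors have to be permuted.
    have h : SameOrbit (twoCol formMu 0 formMu (-formLambda)) (twoCol formMu 0 formMu formLambda) :=
      SameOrbit.of_alice (A := !![1, 0; 0, -1]) (by simp) fun i j k => by
        fin_cases i <;> fin_cases j <;> fin_cases k <;>
          simp [twoCol, formMu, formLambda]
    refine h.inSomeClass ⟨.ABC6, fun n hn =>
      MutuallyRestrict.trans ?_ (mutuallyRestrict_ABC6 hn).symm⟩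
    refine mutuallyRestrict_of_padding (σ := ![1, 0]) (τ := ![1, 2, 0]) (ρ := ![1, 0])
      (by decide) (by decide) (by decide) ?_ ?_
    · intro i j k
      fin_cases i <;> fin_cases j <;> fin_cases k <;> simp [twoCol, coreABC6, formMu, formLambda]
    · intro x y z
      fin_cases x <;> fin_cases y <;> fin_cases z <;>
        simp [twoCol, formMu, formLambda, Fin.exists_fin_succ]
  · intro k l
    fin_cases k <;> fin_cases l <;> simp [twoCol, formMu, formLambda, Fin.sum_univ_succ]
  · intro X h
    have h0 := h 0
    have h1 := h 1
    simp [twoCol, formMu, formLambda, Fin.sum_univ_succ] at h0 h1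
    refine ⟨![X 1 1, X 0 1, X 0 2, X 1 0], fun i j => ?_⟩
    fin_cases i <;> fin_cases j <;> simp [Fin.sum_univ_succ] <;> grind
  · refine mutuallyRestrict_of_padding (σ := id) (τ := ![1, 2, 0]) (ρ := id)
      Function.injective_id (by decide) Function.injective_id ?_ ?_
    · intro i j k
      fin_cases i <;> fin_cases j <;> fin_cases k <;> simp [coreABC17]
    · intro x y z
      fin_cases x <;> fin_cases y <;> fin_cases z <;> simp [Fin.exists_fin_succ]

/-- A tensor of the class `ABC7`; its duals are of the class `ABC18`. -/
theorem classifiedWithDual_chainCol : ClassifiedWithDual (chainCol 0 formMu (-formLambda)) := by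
  refine ⟨_, 4, coreABC18, SameOrbit.refl _, ?_, ⟨?_, ?_⟩,
    ⟨.ABC18, fun n hn => (mutuallyRestrict_ABC18 hn).symm⟩⟩
  · -- After this change of basis for Alice only basis vectors have to be permuted.
    have h : SameOrbit (chainCol 0 formMu (-formLambda))
        (fun i => ![![formMu i, 0], ![formLambda i, formMu i], ![0, formLambda i]]) :=
      SameOrbit.of_alice (A := !![1, 0; 0, -1]) (by simp) fun i j k => by
        fin_cases i <;> fin_cases j <;> fin_cases k <;>
          simp [chainCol, formMu, formLambda]
    refine h.inSomeClass ⟨.ABC7, fun n hn =>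
      MutuallyRestrict.trans ?_ (mutuallyRestrict_ABC7 hn).symm⟩
    refine mutuallyRestrict_of_padding (σ := id) (τ := ![2, 1, 0]) (ρ := ![1, 0])
      Function.injective_id (by decide) (by decide) ?_ ?_
    · intro i j k
      fin_cases i <;> fin_cases j <;> fin_cases k <;> simp [coreABC7, formMu, formLambda]
    · intro x y z
      fin_cases x <;> fin_cases y <;> fin_cases z <;>
        simp [formMu, formLambda, Fin.exists_fin_succ]
  · intro k l
    fin_cases k <;> fin_cases l <;>
      simp [coreABC18, chainCol, formMu, formLambda, Fin.sum_univ_succ]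
  · intro X h
    have h0 := h 0
    have h1 := h 1
    simp [chainCol, formMu, formLambda, Fin.sum_univ_succ] at h0 h1
    refine ⟨![X 1 0, X 0 0, X 0 1, X 0 2], fun i j => ?_⟩
    fin_cases i <;> fin_cases j <;> simp [coreABC18, Fin.sum_univ_succ] <;> grind

/-- A tensor of the class `A_B_C`; its duals are of the class `ABC19`. -/
theorem classifiedWithDual_oneCol_A_B_C : ClassifiedWithDual (oneCol 0 formMu) := by
  refine ⟨_, 5, coreABC19, SameOrbit.refl _, ?_, ⟨?_, ?_⟩,
    ⟨.ABC19, fun n hn => (mutuallyRestrict_ABC19 hn).symm⟩⟩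
  · refine ⟨.A_B_C, fun n hn => MutuallyRestrict.trans ?_ (mutuallyRestrict_A_B_C hn).symm⟩
    refine mutuallyRestrict_of_padding (σ := ![0]) (τ := ![2]) (ρ := id)
      (fun _ _ _ => Subsingleton.elim _ _) (fun _ _ _ => Subsingleton.elim _ _)
      Function.injective_id ?_ ?_
    · intro i j k
      fin_cases i <;> fin_cases j <;> fin_cases k <;> simp [oneCol, coreA_B_C, formMu]
    · intro x y z
      fin_cases x <;> fin_cases y <;> fin_cases z <;>
        simp [oneCol, formMu]
  · intro k l
    fin_cases k <;> fin_cases l <;> simp [coreABC19, oneCol, formMu, Fin.sum_univ_succ]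
  · intro X h
    have h0 := h 0
    simp [oneCol, formMu, Fin.sum_univ_succ] at h0
    refine ⟨![X 1 0, X 0 0, X 1 1, X 0 1, X 1 2], fun i j => ?_⟩
    fin_cases i <;> fin_cases j <;> simp [coreABC19, Fin.sum_univ_succ] <;> grind

/-- A tensor of the class `AB_C`; its duals are of the class `ABC20`. -/
theorem classifiedWithDual_oneCol_AB_C : ClassifiedWithDual (oneCol formMu (-formLambda)) := by
  refine ⟨_, 5, coreABC20, SameOrbit.refl _, ?_, ⟨?_, ?_⟩,
    ⟨.ABC20, fun n hn => (mutuallyRestrict_ABC20 hn).symm⟩⟩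
  · -- After this change of basis for Alice only basis vectors have to be permuted.
    have h : SameOrbit (oneCol formMu (-formLambda)) (oneCol formMu formLambda) :=
      SameOrbit.of_alice (A := !![1, 0; 0, -1]) (by simp) fun i j k => by
        fin_cases i <;> fin_cases j <;> fin_cases k <;>
          simp [oneCol, formMu, formLambda]
    refine h.inSomeClass ⟨.AB_C, fun n hn =>
      MutuallyRestrict.trans ?_ (mutuallyRestrict_AB_C hn).symm⟩
    refine mutuallyRestrict_of_padding (σ := id) (τ := ![2, 1]) (ρ := id)
      Function.injective_id (by decide) Function.injective_id ?_ ?_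
    · intro i j k
      fin_cases i <;> fin_cases j <;> fin_cases k <;> simp [oneCol, coreAB_C, formMu, formLambda]
    · intro x y z
      fin_cases x <;> fin_cases y <;> fin_cases z <;>
        simp [oneCol, formMu, formLambda, Fin.exists_fin_succ]
  · intro k l
    fin_cases k <;> fin_cases l <;> simp [coreABC20, oneCol, formMu, formLambda, Fin.sum_univ_succ]
  · intro X h
    have h0 := h 0
    simp [oneCol, formMu, formLambda, Fin.sum_univ_succ] at h0
    refine ⟨![X 1 0, X 0 0, X 1 1, X 0 1, X 0 2], fun i j => ?_⟩
    fin_cases i <;> fin_cases j <;> simp [coreABC20, Fin.sum_univ_succ] <;> grind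

/-- A single slice is a product vector if the coefficients of `μ` and `λ` in it are dependent, and
otherwise is equivalent to `μ e₁ - λ e₂`. -/
theorem classifiedWithDual_of_conciseC_one (ψ : Tensor 2 3 1) (hψ : ConciseC ψ) :
    ClassifiedWithDual ψ := by
  obtain ⟨u, hu⟩ : ∃ u : Fin 3 → ℂ, u = fun j => ψ 0 j 0 := ⟨_, rfl⟩
  obtain ⟨v, hv⟩ : ∃ v : Fin 3 → ℂ, v = fun j => ψ 1 j 0 := ⟨_, rfl⟩
  by_cases h : LinearIndependent ℂ ![u, v]
  · obtain ⟨B, hB, hBu, hBv⟩ := exists_mulVec_eq_of_linearIndependent h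
      (u' := ![0, 1, 0]) (v' := ![0, 0, -1])
      (linearIndependent_pair_of_minor_ne 1 2 (by simp))
    refine SameOrbit.classifiedWithDual (SameOrbit.of_bob hB fun i j k => ?_)
      classifiedWithDual_oneCol_AB_C
    rw [Subsingleton.elim k 0]
    subst hu hv
    have e0 := congrFun hBu j
    have e1 := congrFun hBv j
    simp only [Matrix.mulVec, dotProduct] at e0 e1
    fin_cases i
    · refine Eq.trans ?_ e0.symm
      fin_cases j <;> simp [oneCol, formMu, formLambda]
    · refine Eq.trans ?_ e1.symm
      fin_cases j <;> simp [oneCol, formMu, formLambda]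
  · rw [LinearIndependent.pair_iff] at h
    push Not at h
    obtain ⟨s, t, hst, h0⟩ := h
    have hα : (![s, t] : Fin 2 → ℂ) ≠ 0 := fun hz =>
      h0 (congrFun hz 0) (congrFun hz 1)
    obtain ⟨x, e, hx0, hx1⟩ := exists_eq_smul_of_dependent hα (by simpa using hst)
    subst hu hv
    have hψe (i j k) : ψ i j k = x i * e j := by
      rw [Subsingleton.elim k 0]
      fin_cases i
      exacts [congrFun hx0 j, congrFun hx1 j]
    have hne : ψ ≠ 0 := by
      rintro rfl
      exact one_ne_zero (congrFun (hψ (fun _ => 1) (by simp)) 0)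
    have hx : x ≠ 0 := by
      rintro rfl
      exact hne (funext fun i => funext fun j => funext fun k => by simp [hψe])
    have he : e ≠ 0 := by
      rintro rfl
      exact hne (funext fun i => funext fun j => funext fun k => by simp [hψe])
    obtain ⟨B, hB, hBe⟩ := exists_mulVec_eq_single (exists_matrix_row_zero_eq_three he)
    obtain ⟨A, hA, hAx⟩ := exists_mulVec_eq_single (exists_matrix_row_zero_eq_two hx)
    refine SameOrbit.classifiedWithDual (φ := oneCol 0 formMu)
      ⟨A, !![0, 1, 0; 0, 0, 1; 1, 0, 0] * B, 1, hA, ?_, by simp, ?_⟩ classifiedWithDual_oneCol_A_B_C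
    · rw [Matrix.det_mul]
      exact mul_ne_zero (by simp [Matrix.det_fin_three]) hB
    · funext i j k
      have hAi := congrFun hAx i
      have hBj := congrFun (congrArg (fun w => !![(0:ℂ), 1, 0; 0, 0, 1; 1, 0, 0] *ᵥ w) hBe) j
      simp only [Matrix.mulVec_mulVec] at hBj
      have e1 : localOp A (!![0, 1, 0; 0, 0, 1; 1, 0, 0] * B) 1 ψ i j k =
          (A *ᵥ x) i * ((!![0, 1, 0; 0, 0, 1; 1, 0, 0] * B) *ᵥ e) j := by
        simp only [localOp, hψe, Matrix.mulVec, dotProduct, Finset.sum_mul, Finset.mul_sum]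
        rw [Finset.sum_comm]
        refine Finset.sum_congr rfl fun y _ => Finset.sum_congr rfl fun z _ => ?_
        rw [Subsingleton.elim k 0]
        simp
        ring
      rw [e1, hAi, hBj]
      fin_cases i <;> fin_cases j <;> simp [oneCol, formMu, Matrix.mulVec, dotProduct,
        Fin.sum_univ_three]

/-! ### Two columns, one of which is a product vector -/

namespace SameOrbit

variable (l p q r : Fin 2 → ℂ)

theorem twoCol_mulVec {A : Matrix (Fin 2) (Fin 2) ℂ} (hA : A.det ≠ 0) :
    SameOrbit (twoCol l p q r) (twoCol (A *ᵥ l) (A *ᵥ p) (A *ᵥ q) (A *ᵥ r)) := by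
  refine of_alice hA fun i j k => ?_
  fin_cases j <;> fin_cases k <;> simp [twoCol, Matrix.mulVec, dotProduct]

theorem twoCol_mix_rows {x y x' y' : ℂ} (h : x * y' - y * x' ≠ 0) :
    SameOrbit (twoCol l p q r) (twoCol l p (x • q + y • r) (x' • q + y' • r)) := by
  refine of_bob (B := !![1, 0, 0; 0, x, y; 0, x', y'])
    (by simpa [Matrix.det_fin_three] using h) fun i j k => ?_
  fin_cases j <;> fin_cases k <;> simp [twoCol, Fin.sum_univ_three]

theorem twoCol_add_row_zero (x y : ℂ) :
    SameOrbit (twoCol l p q r) (twoCol l (p + x • q + y • r) q r) := by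
  refine of_bob (B := !![1, x, y; 0, 1, 0; 0, 0, 1])
    (by simp [Matrix.det_fin_three]) fun i j k => ?_
  fin_cases j <;> fin_cases k <;> simp [twoCol, Fin.sum_univ_three]

theorem twoCol_add_col_one (x : ℂ) :
    SameOrbit (twoCol l p q r) (twoCol l (p + x • l) q r) := by
  refine of_charlie (C := !![1, 0; x, 1]) (by simp) fun i j k => ?_
  fin_cases j <;> fin_cases k <;> simp [twoCol, add_comm]

theorem twoCol_smul_row_one {x : ℂ} (hx : x ≠ 0) :
    SameOrbit (twoCol l p q r) (twoCol l p (x • q) r) := by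
  refine of_bob (B := !![1, 0, 0; 0, x, 0; 0, 0, 1])
    (by simpa [Matrix.det_fin_three]) fun i j k => ?_
  fin_cases j <;> fin_cases k <;> simp [twoCol, Fin.sum_univ_three]

end SameOrbit

theorem det₂_formMu_formLambda_ne_zero : det₂ formMu (-formLambda) ≠ 0 := by
  simp [det₂, formMu, formLambda]

/-- The pencil has two rows; it is classified by `q` and its position with respect to `l`. -/
theorem classifiedWithDual_twoCol_of_last_zero {l p q : Fin 2 → ℂ} (hl : l ≠ 0)
    (hψ : ConciseC (twoCol l p q 0)) : ClassifiedWithDual (twoCol l p q 0) := by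
  by_cases hq : q = 0
  · subst hq
    have hd : det₂ l p ≠ 0 := by
      intro hd
      obtain ⟨s, rfl⟩ := exists_eq_smul_of_det₂_eq_zero hl hd
      have := congrFun (hψ ![-s, 1] fun i j => by
        fin_cases j <;> simp [twoCol]) 1
      simp at this
    obtain ⟨A, hA, e₁, e₂⟩ := exists_mulVec_eq_of_det₂ hd det₂_formLambda_formMu
    have h := SameOrbit.twoCol_mulVec l p 0 0 hA
    rw [e₁, e₂, Matrix.mulVec_zero] at h
    exact h.classifiedWithDual classifiedWithDual_twoCol_AC_B
  by_cases hd : det₂ l q = 0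
  · obtain ⟨s, rfl⟩ := exists_eq_smul_of_det₂_eq_zero hl hd
    have hs : s ≠ 0 := by
      rintro rfl
      simp at hq
    obtain ⟨m, hm⟩ := exists_det₂_ne_zero hl
    obtain ⟨A, hA, e₁, e₂⟩ := exists_mulVec_eq_of_det₂ hm det₂_formMu_formLambda_ne_zero
    obtain ⟨x, y, rfl⟩ := exists_eq_smul_add_smul hm p
    have h₁ := SameOrbit.twoCol_add_col_one l (x • l + y • m) (s • l) 0 (-x)
    rw [show x • l + y • m + -x • l = y • m by module] at h₁
    have h₂ := SameOrbit.twoCol_mulVec l (y • m) (s • l) 0 hA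
    rw [Matrix.mulVec_smul, Matrix.mulVec_smul, e₁, e₂, Matrix.mulVec_zero] at h₂
    have h₃ := h₁.trans h₂
    by_cases hy : y = 0
    · subst hy
      have h₄ := SameOrbit.twoCol_smul_row_one formMu ((0 : ℂ) • -formLambda) (s • formMu) 0
        (inv_ne_zero hs)
      rw [smul_smul, inv_mul_cancel₀ hs, one_smul] at h₄
      have h₅ := h₃.trans h₄
      rw [show (0 : ℂ) • -formLambda = 0 by module] at h₅
      exact h₅.classifiedWithDual classifiedWithDual_twoCol_A_BC1
    · have h₄ : SameOrbit (twoCol formMu (y • -formLambda) (s • formMu) 0)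
          (twoCol formMu (-formLambda) formMu 0) := by
        refine ⟨1, !![1, 0, 0; 0, y / s, 0; 0, 0, 1], !![1, 0; 0, y⁻¹], by simp,
          by simp [Matrix.det_fin_three, hy, hs], by simp [hy], ?_⟩
        funext i j k
        rw [localOp_one_apply]
        fin_cases j <;> fin_cases k <;> simp [twoCol, Fin.sum_univ_three, hy]
        field_simp
      exact (h₃.trans h₄).classifiedWithDual classifiedWithDual_twoCol_ABC2
  · obtain ⟨x, y, rfl⟩ := exists_eq_smul_add_smul hd p
    have h₁ := SameOrbit.twoCol_add_col_one l (x • l + y • q) q 0 (-x)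
    rw [show x • l + y • q + -x • l = y • q by module] at h₁
    have h₂ := SameOrbit.twoCol_add_row_zero l (y • q) q 0 (-y) 0
    rw [show y • q + -y • q + (0 : ℂ) • (0 : Fin 2 → ℂ) = 0 by module] at h₂
    obtain ⟨A, hA, e₁, e₂⟩ := exists_mulVec_eq_of_det₂ hd
      (x' := formMu) (y' := formMu - formLambda) (by simp [det₂, formMu, formLambda])
    have h₃ := SameOrbit.twoCol_mulVec l 0 q 0 hA
    rw [e₁, e₂, Matrix.mulVec_zero] at h₃
    exact (h₁.trans (h₂.trans h₃)).classifiedWithDual classifiedWithDual_twoCol_ABC1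

theorem classifiedWithDual_twoCol {l p q r : Fin 2 → ℂ} (hψ : ConciseC (twoCol l p q r)) :
    ClassifiedWithDual (twoCol l p q r) := by
  have hl : l ≠ 0 := by
    rintro rfl
    have := congrFun (hψ ![1, 0] fun i j => by fin_cases j <;> simp [twoCol]) 0
    simp at this
  by_cases hd : det₂ q r = 0
  · -- The entries below the product column are dependent, and one row can be cleared.
    by_cases hq : q = 0
    · subst hq
      have h := SameOrbit.twoCol_mix_rows l p 0 r (x := 0) (y := 1) (x' := 1) (y' := 0) (by simp)
      rw [show (0 : ℂ) • (0 : Fin 2 → ℂ) + (1 : ℂ) • r = r by module,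
        show (1 : ℂ) • (0 : Fin 2 → ℂ) + (0 : ℂ) • r = 0 by module] at h
      exact h.classifiedWithDual (classifiedWithDual_twoCol_of_last_zero hl (h.conciseC hψ))
    · obtain ⟨s, rfl⟩ := exists_eq_smul_of_det₂_eq_zero hq hd
      have h := SameOrbit.twoCol_mix_rows l p q (s • q) (x := 1) (y := 0) (x' := -s) (y' := 1)
        (by simp)
      rw [show (1 : ℂ) • q + (0 : ℂ) • s • q = q by module,
        show -s • q + (1 : ℂ) • s • q = 0 by module] at h
      exact h.classifiedWithDual (classifiedWithDual_twoCol_of_last_zero hl (h.conciseC hψ))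
  · obtain ⟨s, t, rfl⟩ := exists_eq_smul_add_smul hd p
    have h₁ := SameOrbit.twoCol_add_row_zero l (s • q + t • r) q r (-s) (-t)
    rw [show s • q + t • r + -s • q + -t • r = 0 by module] at h₁
    obtain ⟨m, hm⟩ := exists_det₂_ne_zero hl
    obtain ⟨A, hA, e₁, e₂⟩ := exists_mulVec_eq_of_det₂ hm det₂_formMu_formLambda_ne_zero
    obtain ⟨a, b, c, d, hne, f₁, f₂⟩ := exists_mix_of_det₂ hd hm
    have h₂ := SameOrbit.twoCol_mix_rows l 0 q r hne
    rw [← f₁, ← f₂] at h₂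
    have h₃ := SameOrbit.twoCol_mulVec l 0 l m hA
    rw [e₁, e₂, Matrix.mulVec_zero] at h₃
    exact (h₁.trans (h₂.trans h₃)).classifiedWithDual classifiedWithDual_twoCol_ABC6

/-- A pencil with two columns is classified if it has a product vector in the span of its
columns. -/
theorem classifiedWithDual_of_first_column {ψ : Tensor 2 3 2} (hψ : ConciseC ψ) {α : Fin 2 → ℂ}
    (hα : α ≠ 0) {w : Fin 2 → ℂ} (hw : w ≠ 0)
    (h : ∀ j, α 0 * ∑ k, w k * ψ 0 j k + α 1 * ∑ k, w k * ψ 1 j k = 0) :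
    ClassifiedWithDual ψ := by
  obtain ⟨C, hC, rfl⟩ := exists_matrix_row_zero_eq_two hw
  obtain ⟨φ, hφ, hφ0⟩ := exists_sameOrbit_first_column ψ hα hC h
  have e : φ = twoCol (fun i => φ i 0 0) (fun i => φ i 0 1) (fun i => φ i 1 1)
      (fun i => φ i 2 1) := by
    funext i j k
    fin_cases j <;> fin_cases k <;> simp [twoCol, hφ0]
  refine hφ.classifiedWithDual ?_
  have hc := hφ.conciseC hψ
  rw [e] at hc ⊢
  exact classifiedWithDual_twoCol hc

/-! ### Two columns that span no product vector -/

/-- A pencil with columns `(μ, -λ, 0)` and `(p, q, -λ)` is equivalent to `L_2^T`, or has a product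
vector in the span of its columns. -/
theorem classifiedWithDual_chainCol_of_last {p q : Fin 2 → ℂ}
    (hψ : ConciseC (chainCol p q (-formLambda))) :
    ClassifiedWithDual (chainCol p q (-formLambda)) := by
  obtain ⟨b, a, rfl⟩ := exists_eq_smul_add_smul det₂_formLambda_formMu p
  obtain ⟨d, c, rfl⟩ := exists_eq_smul_add_smul det₂_formLambda_formMu q
  -- Row and column operations leave the multiple `c μ` of `μ` in the middle of the second column.
  have h : SameOrbit (chainCol (b • formLambda + a • formMu) (d • formLambda + c • formMu)
      (-formLambda)) (chainCol 0 (c • formMu) (-formLambda)) := by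
    refine ⟨1, !![1, 0, b; 0, 1, d + a; 0, 0, 1], !![1, 0; -a, 1], by simp,
      by simp [Matrix.det_fin_three], by simp, ?_⟩
    funext i j k
    rw [localOp_one_apply]
    fin_cases i <;> fin_cases j <;> fin_cases k <;>
      simp [chainCol, formMu, formLambda, Fin.sum_univ_three] <;> ring
  refine h.classifiedWithDual ?_
  by_cases hc : c = 0
  · subst hc
    refine classifiedWithDual_of_first_column (h.conciseC hψ) (α := ![1, 0]) (w := ![0, 1])
      (by simp) (by simp) fun j => ?_
    fin_cases j <;> simp [chainCol, formLambda]
  · refine SameOrbit.classifiedWithDual (φ := chainCol 0 formMu (-formLambda))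
      ⟨1, !![1, 0, 0; 0, 1, 0; 0, 0, c], !![1, 0; 0, c⁻¹], by simp,
        by simpa [Matrix.det_fin_three], by simpa, ?_⟩ classifiedWithDual_chainCol
    funext i j k
    rw [localOp_one_apply]
    fin_cases j <;> fin_cases k <;> simp [chainCol, Fin.sum_univ_three, hc]

/-- If the first column is not a product vector, it can be moved to `(μ, -λ, 0)`. -/
theorem classifiedWithDual_of_conciseC_two (ψ : Tensor 2 3 2) (hψ : ConciseC ψ) :
    ClassifiedWithDual ψ := by
  by_cases h : LinearIndependent ℂ ![fun j => ψ 0 j 0, fun j => ψ 1 j 0]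
  · obtain ⟨B, hB, hBu, hBv⟩ := exists_mulVec_eq_of_linearIndependent h
      (u' := ![1, 0, 0]) (v' := ![0, -1, 0])
      (linearIndependent_pair_of_minor_ne 0 1 (by simp))
    obtain ⟨φ, hφ⟩ : ∃ φ : Tensor 2 3 2, φ = localOp 1 B 1 ψ := ⟨_, rfl⟩
    have h₁ : SameOrbit ψ φ := ⟨1, B, 1, by simp, hB, by simp, hφ⟩
    have e : φ = chainCol (fun i => φ i 0 1) (fun i => φ i 1 1) (fun i => φ i 2 1) := by
      funext i j k
      have e0 := congrFun hBu j
      have e1 := congrFun hBv j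
      simp only [Matrix.mulVec, dotProduct] at e0 e1
      have e2 (i) : φ i j 0 = ∑ y, B j y * ψ i y 0 := by
        rw [hφ, localOp_one_apply]
        simp [Matrix.one_apply]
      fin_cases k
      · have e3 := e2 i
        fin_cases i
        · refine (e3.trans e0).trans ?_
          fin_cases j <;> simp [chainCol, formMu, formLambda]
        · refine (e3.trans e1).trans ?_
          fin_cases j <;> simp [chainCol, formMu, formLambda]
      · fin_cases j <;> simp [chainCol]
    refine h₁.classifiedWithDual ?_
    have hc := h₁.conciseC hψ
    rw [e] at hc ⊢
    generalize (fun i => φ i 0 1) = p at hc ⊢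
    generalize (fun i => φ i 1 1) = q at hc ⊢
    generalize (fun i => φ i 2 1) = r at hc ⊢
    by_cases hr : r = 0
    · -- What is left is a square pencil, which has a singular point.
      subst hr
      obtain ⟨α, hα, w, hw, hs⟩ := exists_pencil_mulVec_eq_zero !![1, p 0; 0, q 0]
        !![0, p 1; -1, q 1]
      have hs0 := congrFun hs 0
      have hs1 := congrFun hs 1
      simp [Matrix.mulVec, dotProduct] at hs0 hs1
      refine classifiedWithDual_of_first_column hc hα hw fun j => ?_
      fin_cases j <;> simp [chainCol, formMu, formLambda]
      · linear_combination hs0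
      · linear_combination hs1
    · -- The last entry is moved to `-λ`, and the first column is then restored by mixing rows.
      obtain ⟨m, hm⟩ := exists_det₂_ne_zero hr
      obtain ⟨A, hA, e₁, -⟩ := exists_mulVec_eq_of_det₂ hm (x' := -formLambda) (y' := formMu)
        (by simp [det₂, formMu, formLambda])
      have hdet : det₂ (A *ᵥ formMu) (A *ᵥ -formLambda) ≠ 0 := by
        rw [Matrix.det_fin_two] at hA
        simp [det₂, formMu, formLambda, Matrix.mulVec, dotProduct]
        contrapose! hA
        linear_combination -hA
      obtain ⟨a, b, c, d, hne, f₁, f₂⟩ := exists_mix_of_det₂ hdet det₂_formMu_formLambda_ne_zero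
      have h₂ : SameOrbit (chainCol p q r) (chainCol (a • A *ᵥ p + b • A *ᵥ q)
          (c • A *ᵥ p + d • A *ᵥ q) (-formLambda)) := by
        refine (SameOrbit.of_alice hA fun i j k => rfl).trans (SameOrbit.of_bob
          (B := !![a, b, 0; c, d, 0; 0, 0, 1])
          (by simpa [Matrix.det_fin_three] using hne) fun i j k => ?_)
        have g₁ := congrFun f₁ i
        have g₂ := congrFun f₂ i
        have g₃ := congrFun e₁ i
        fin_cases i <;> simp [Matrix.mulVec, dotProduct] at g₁ g₂ g₃ <;>
          fin_cases j <;> fin_cases k <;>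
          simp [chainCol, Fin.sum_univ_three] <;> grind
      exact h₂.classifiedWithDual (classifiedWithDual_chainCol_of_last (h₂.conciseC hc))
  · rw [LinearIndependent.pair_iff] at h
    push Not at h
    obtain ⟨s, t, hst, h0⟩ := h
    refine classifiedWithDual_of_first_column hψ (α := ![s, t]) (w := ![1, 0])
      (fun hz => h0 (congrFun hz 0) (congrFun hz 1)) (by simp) fun j => ?_
    simpa using congrFun hst j

/-! ### Classification of all tensors -/

theorem isDual_coreABC21 : IsDual coreABC21 (0 : Tensor 2 3 0) := by
  refine ⟨fun k l => l.elim0, fun X _ => ⟨![X 1 0, X 0 0, X 1 1, X 0 1, X 1 2, X 0 2],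
    fun i j => ?_⟩⟩
  fin_cases i <;> fin_cases j <;> simp [coreABC21, Fin.sum_univ_succ]

/-- The space of slices, of dimension `d`, is classified directly for `d ≤ 3` and through its
orthogonal complement for `d ≥ 4`. -/
theorem inSomeClass_of_ne_zero {n : ℕ} (ψ : Tensor 2 3 n) (hψ : ψ ≠ 0) : InSomeClass ψ := by
  obtain ⟨d, φ, hd, hφ, h⟩ := exists_conciseC ψ
  refine h.inSomeClass ?_
  interval_cases d
  · exact absurd (Subsingleton.elim φ 0) (h.2.ne_zero hψ)
  · exact (classifiedWithDual_of_conciseC_one φ hφ).inSomeClass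
  · exact (classifiedWithDual_of_conciseC_two φ hφ).inSomeClass
  · exact inSomeClass_of_conciseC_three φ hφ
  · obtain ⟨χ, hχ, hd⟩ := exists_isDual (m := 2) hφ rfl
    exact (classifiedWithDual_of_conciseC_two χ hχ).inSomeClass_of_isDual hd
  · obtain ⟨χ, hχ, hd⟩ := exists_isDual (m := 1) hφ rfl
    exact (classifiedWithDual_of_conciseC_one χ hχ).inSomeClass_of_isDual hd
  · obtain ⟨χ, -, hd⟩ := exists_isDual (m := 0) hφ rfl
    rw [Subsingleton.elim χ 0] at hd
    exact (hd.mutuallyRestrict isDual_coreABC21 (.refl _)).inSomeClass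
      ⟨.ABC21, fun n hn => (mutuallyRestrict_ABC21 hn).symm⟩

/-! ### Separation of the classes -/

/-- Nonvanishing, local ranks and tensor rank are inherited from the core. -/
theorem properties_of_isCore {a b c n r : ℕ} {ψ : Tensor 2 3 n} {φ : Tensor (a + 1) b c}
    (h : MutuallyRestrict ψ φ) (hφ : IsCore φ r) :
    ψ ≠ 0 ∧ localRanks ψ = (a + 1, b, c) ∧ HasTensorRank ψ r :=
  ⟨h.1.ne_zero hφ.ne_zero,
    h.localRanks_eq.trans (localRanks_eq_of_concise hφ.conciseA hφ.conciseB hφ.conciseC),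
    h.hasTensorRank hφ.ne_zero hφ.hasTensorRank⟩

theorem representative_properties {n : ℕ} (hn : 6 ≤ n) (t : ClassName) :
    t.representative n ≠ 0 ∧ localRanks (t.representative n) = t.ranks ∧
      HasTensorRank (t.representative n) t.tensorRank := by
  cases t
  · exact properties_of_isCore (mutuallyRestrict_A_B_C hn) isCore_coreA_B_C
  · exact properties_of_isCore (mutuallyRestrict_AB_C hn) isCore_coreAB_C
  · exact properties_of_isCore (mutuallyRestrict_AC_B hn) isCore_coreAC_B
  · exact properties_of_isCore (mutuallyRestrict_A_BC1 hn) isCore_coreA_BC1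
  · exact properties_of_isCore (mutuallyRestrict_ABC1 hn) isCore_coreABC1
  · exact properties_of_isCore (mutuallyRestrict_ABC2 hn) isCore_coreABC2
  · exact properties_of_isCore (mutuallyRestrict_ABC3 hn) isCore_coreABC3
  · exact properties_of_isCore (mutuallyRestrict_ABC4 hn) isCore_coreABC4
  · exact properties_of_isCore (mutuallyRestrict_ABC5 hn) isCore_coreABC5
  · exact properties_of_isCore (mutuallyRestrict_ABC6 hn) isCore_coreABC6
  · exact properties_of_isCore (mutuallyRestrict_ABC7 hn) isCore_coreABC7
  · exact properties_of_isCore (mutuallyRestrict_ABC8 hn) isCore_coreABC8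
  · exact properties_of_isCore (mutuallyRestrict_ABC9 hn) isCore_coreABC9
  · exact properties_of_isCore (mutuallyRestrict_A_BC2 hn) isCore_coreA_BC2
  · exact properties_of_isCore (mutuallyRestrict_ABC10 hn) isCore_coreABC10
  · exact properties_of_isCore (mutuallyRestrict_ABC11 hn) isCore_coreABC11
  · exact properties_of_isCore (mutuallyRestrict_ABC12 hn) isCore_coreABC12
  · exact properties_of_isCore (mutuallyRestrict_ABC13 hn) isCore_coreABC13
  · exact properties_of_isCore (mutuallyRestrict_ABC14 hn) isCore_coreABC14
  · exact properties_of_isCore (mutuallyRestrict_ABC15 hn) isCore_coreABC15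
  · exact properties_of_isCore (mutuallyRestrict_ABC16 hn) isCore_coreABC16
  · exact properties_of_isCore (mutuallyRestrict_ABC17 hn) isCore_coreABC17
  · exact properties_of_isCore (mutuallyRestrict_ABC18 hn) isCore_coreABC18
  · exact properties_of_isCore (mutuallyRestrict_ABC19 hn) isCore_coreABC19
  · exact properties_of_isCore (mutuallyRestrict_ABC20 hn) isCore_coreABC20
  · exact properties_of_isCore (mutuallyRestrict_ABC21 hn) isCore_coreABC21

theorem not_mutuallyRestrict_ABC3_ABC4 : ¬MutuallyRestrict coreABC3 coreABC4 := fun h =>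
  not_hasAnnihilator_coreABC4 (h.1.hasAnnihilator isCore_coreABC4.conciseA
    isCore_coreABC4.conciseB hasAnnihilator_coreABC3)

theorem not_mutuallyRestrict_ABC14_ABC18 : ¬MutuallyRestrict coreABC14 coreABC18 := fun h =>
  not_hasAnnihilator_coreABC18 (h.1.hasAnnihilator isCore_coreABC18.conciseA
    isCore_coreABC18.conciseB hasAnnihilator_coreABC14)

theorem not_mutuallyRestrict_ABC15_ABC18 : ¬MutuallyRestrict coreABC15 coreABC18 := fun h =>
  not_hasAnnihilator_coreABC18 (h.1.hasAnnihilator isCore_coreABC18.conciseA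
    isCore_coreABC18.conciseB hasAnnihilator_coreABC15)

theorem not_mutuallyRestrict_ABC17_ABC18 : ¬MutuallyRestrict coreABC17 coreABC18 := fun h =>
  not_hasAnnihilator_coreABC18 (h.1.hasAnnihilator isCore_coreABC18.conciseA
    isCore_coreABC18.conciseB hasAnnihilator_coreABC17)

theorem not_mutuallyRestrict_ABC19_ABC20 : ¬MutuallyRestrict coreABC19 coreABC20 := fun h =>
  not_hasAnnihilator_coreABC20 (h.1.hasAnnihilator isCore_coreABC20.conciseA
    isCore_coreABC20.conciseB hasAnnihilator_coreABC19)

theorem not_mutuallyRestrict_ABC6_ABC7 : ¬MutuallyRestrict coreABC6 coreABC7 := fun h =>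
  not_hasDoubleAnnihilator_coreABC7 (h.1.hasDoubleAnnihilator isCore_coreABC7.conciseA
    isCore_coreABC7.conciseB hasDoubleAnnihilator_coreABC6)

theorem not_mutuallyRestrict_ABC9_ABC8 : ¬MutuallyRestrict coreABC9 coreABC8 := fun h =>
  not_hasDoubleAnnihilator_coreABC8 (h.1.hasDoubleAnnihilator isCore_coreABC8.conciseA
    isCore_coreABC8.conciseB hasDoubleAnnihilator_coreABC9)

theorem not_mutuallyRestrict_ABC11_ABC12 : ¬MutuallyRestrict coreABC11 coreABC12 := fun h =>
  not_hasDoubleAnnihilator_coreABC12 (h.1.hasDoubleAnnihilator isCore_coreABC12.conciseA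
    isCore_coreABC12.conciseB hasDoubleAnnihilator_coreABC11)

theorem not_mutuallyRestrict_ABC11_ABC13 : ¬MutuallyRestrict coreABC11 coreABC13 := fun h =>
  not_hasDoubleAnnihilator_coreABC13 (h.1.hasDoubleAnnihilator isCore_coreABC13.conciseA
    isCore_coreABC13.conciseB hasDoubleAnnihilator_coreABC11)

theorem not_mutuallyRestrict_ABC14_ABC15 : ¬MutuallyRestrict coreABC14 coreABC15 := fun h =>
  not_hasDoubleAnnihilator_coreABC15 (h.1.hasDoubleAnnihilator isCore_coreABC15.conciseA
    isCore_coreABC15.conciseB hasDoubleAnnihilator_coreABC14)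

theorem not_mutuallyRestrict_ABC14_ABC17 : ¬MutuallyRestrict coreABC14 coreABC17 := fun h =>
  not_hasDoubleAnnihilator_coreABC17 (h.1.hasDoubleAnnihilator isCore_coreABC17.conciseA
    isCore_coreABC17.conciseB hasDoubleAnnihilator_coreABC14)

theorem not_mutuallyRestrict_ABC10_ABC11 : ¬MutuallyRestrict coreABC10 coreABC11 := fun h =>
  not_hasAllAnnihilators_coreABC11 (h.1.hasAllAnnihilators isCore_coreABC11.conciseA
    isCore_coreABC11.conciseB hasAllAnnihilators_coreABC10)

theorem not_mutuallyRestrict_ABC10_ABC12 : ¬MutuallyRestrict coreABC10 coreABC12 := fun h =>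
  not_hasAllAnnihilators_coreABC12 (h.1.hasAllAnnihilators isCore_coreABC12.conciseA
    isCore_coreABC12.conciseB hasAllAnnihilators_coreABC10)

theorem not_mutuallyRestrict_ABC10_ABC13 : ¬MutuallyRestrict coreABC10 coreABC13 := fun h =>
  not_hasAllAnnihilators_coreABC13 (h.1.hasAllAnnihilators isCore_coreABC13.conciseA
    isCore_coreABC13.conciseB hasAllAnnihilators_coreABC10)

theorem not_mutuallyRestrict_ABC12_ABC13 : ¬MutuallyRestrict coreABC12 coreABC13 := fun h =>
  not_hasTwoAnnihilators_coreABC13 (h.1.hasTwoAnnihilators isCore_coreABC13.conciseA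
    isCore_coreABC13.conciseB hasTwoAnnihilators_coreABC12)

theorem not_mutuallyRestrict_ABC15_ABC17 : ¬MutuallyRestrict coreABC15 coreABC17 := fun h =>
  not_hasTwoAnnihilators_coreABC17 (h.1.hasTwoAnnihilators isCore_coreABC17.conciseA
    isCore_coreABC17.conciseB hasTwoAnnihilators_coreABC15)

/-- Local ranks and tensor rank leave the pairs listed in the proof, which are separated by the
product vectors that annihilate them. -/
theorem eq_of_mutuallyRestrict_representative {n : ℕ} (hn : 6 ≤ n) {s t : ClassName}
    (h : MutuallyRestrict (s.representative n) (t.representative n)) : s = t := by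
  obtain ⟨hs, hsr, hsk⟩ := representative_properties hn s
  obtain ⟨ht, htr, htk⟩ := representative_properties hn t
  have hr : s.ranks = t.ranks := hsr.symm.trans (h.localRanks_eq.trans htr)
  have hk : s.tensorRank = t.tensorRank := hsk.unique (h.hasTensorRank ht htk)
  have sep {x y : ClassName} {a b c d e f : ℕ} {φ : Tensor a b c} {χ : Tensor d e f}
      (hx : MutuallyRestrict (x.representative n) φ)
      (hy : MutuallyRestrict (y.representative n) χ) (hφχ : ¬MutuallyRestrict φ χ)
      (hst : s = x ∧ t = y ∨ s = y ∧ t = x) : False := by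
    rcases hst with ⟨rfl, rfl⟩ | ⟨rfl, rfl⟩
    · exact hφχ ((hx.symm.trans h).trans hy)
    · exact hφχ ((hx.symm.trans h.symm).trans hy)
  have h3_4 := sep (mutuallyRestrict_ABC3 hn) (mutuallyRestrict_ABC4 hn)
    not_mutuallyRestrict_ABC3_ABC4
  have h14_18 := sep (mutuallyRestrict_ABC14 hn) (mutuallyRestrict_ABC18 hn)
    not_mutuallyRestrict_ABC14_ABC18
  have h15_18 := sep (mutuallyRestrict_ABC15 hn) (mutuallyRestrict_ABC18 hn)
    not_mutuallyRestrict_ABC15_ABC18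
  have h17_18 := sep (mutuallyRestrict_ABC17 hn) (mutuallyRestrict_ABC18 hn)
    not_mutuallyRestrict_ABC17_ABC18
  have h19_20 := sep (mutuallyRestrict_ABC19 hn) (mutuallyRestrict_ABC20 hn)
    not_mutuallyRestrict_ABC19_ABC20
  have h6_7 := sep (mutuallyRestrict_ABC6 hn) (mutuallyRestrict_ABC7 hn)
    not_mutuallyRestrict_ABC6_ABC7
  have h9_8 := sep (mutuallyRestrict_ABC9 hn) (mutuallyRestrict_ABC8 hn)
    not_mutuallyRestrict_ABC9_ABC8
  have h11_12 := sep (mutuallyRestrict_ABC11 hn) (mutuallyRestrict_ABC12 hn)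
    not_mutuallyRestrict_ABC11_ABC12
  have h11_13 := sep (mutuallyRestrict_ABC11 hn) (mutuallyRestrict_ABC13 hn)
    not_mutuallyRestrict_ABC11_ABC13
  have h14_15 := sep (mutuallyRestrict_ABC14 hn) (mutuallyRestrict_ABC15 hn)
    not_mutuallyRestrict_ABC14_ABC15
  have h14_17 := sep (mutuallyRestrict_ABC14 hn) (mutuallyRestrict_ABC17 hn)
    not_mutuallyRestrict_ABC14_ABC17
  have h10_11 := sep (mutuallyRestrict_ABC10 hn) (mutuallyRestrict_ABC11 hn)
    not_mutuallyRestrict_ABC10_ABC11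
  have h10_12 := sep (mutuallyRestrict_ABC10 hn) (mutuallyRestrict_ABC12 hn)
    not_mutuallyRestrict_ABC10_ABC12
  have h10_13 := sep (mutuallyRestrict_ABC10 hn) (mutuallyRestrict_ABC13 hn)
    not_mutuallyRestrict_ABC10_ABC13
  have h12_13 := sep (mutuallyRestrict_ABC12 hn) (mutuallyRestrict_ABC13 hn)
    not_mutuallyRestrict_ABC12_ABC13
  have h15_17 := sep (mutuallyRestrict_ABC15 hn) (mutuallyRestrict_ABC17 hn)
    not_mutuallyRestrict_ABC15_ABC17
  clear h hs hsr hsk ht htr htk sep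
  cases s <;> cases t <;> first
    | rfl
    | exact absurd hr (by decide)
    | exact absurd hk (by decide)
    | simp_all

/-! ### The number of classes -/

theorem natCard_className : Nat.card ClassName = 26 := by
  have e : ClassName ≃ Fin 26 := by
    refine Equiv.ofBijective (fun t => ⟨t.ctorIdx, by cases t <;> decide⟩) ⟨?_, ?_⟩
    · intro s t h
      cases s <;> cases t <;> first | rfl | exact absurd h (by decide)
    · intro k
      fin_cases k
      exacts [⟨.A_B_C, rfl⟩, ⟨.AB_C, rfl⟩, ⟨.AC_B, rfl⟩, ⟨.A_BC1, rfl⟩, ⟨.ABC1, rfl⟩, ⟨.ABC2, rfl⟩,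
        ⟨.ABC3, rfl⟩, ⟨.ABC4, rfl⟩, ⟨.ABC5, rfl⟩, ⟨.ABC6, rfl⟩, ⟨.ABC7, rfl⟩, ⟨.ABC8, rfl⟩,
        ⟨.ABC9, rfl⟩, ⟨.A_BC2, rfl⟩, ⟨.ABC10, rfl⟩, ⟨.ABC11, rfl⟩, ⟨.ABC12, rfl⟩, ⟨.ABC13, rfl⟩,
        ⟨.ABC14, rfl⟩, ⟨.ABC15, rfl⟩, ⟨.ABC16, rfl⟩, ⟨.ABC17, rfl⟩, ⟨.ABC18, rfl⟩, ⟨.ABC19, rfl⟩,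
        ⟨.ABC20, rfl⟩, ⟨.ABC21, rfl⟩]
  rw [Nat.card_congr e, Nat.card_fin]

theorem existsUnique_equivalent_representative {n : ℕ} (hn : 6 ≤ n) {ψ : Tensor 2 3 n}
    (hψ : ψ ≠ 0) : ∃! t : ClassName, Equivalent ψ (t.representative n) := by
  obtain ⟨t, ht⟩ := inSomeClass_of_ne_zero ψ hψ
  have ht0 (s : ClassName) := (representative_properties hn s).1
  refine ⟨t, (ht n hn).equivalent (ht0 t), fun s hs => ?_⟩
  exact eq_of_mutuallyRestrict_representative hn (hs.mutuallyRestrict.symm.trans (ht n hn))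

theorem natCard_quotient {n : ℕ} (hn : 6 ≤ n) : Nat.card (Quotient (setoid 2 3 n)) = 26 := by
  rw [← natCard_className]
  refine (Nat.card_eq_of_bijective (fun t : ClassName => (Quotient.mk (setoid 2 3 n)
    ⟨t.representative n, (representative_properties hn t).1⟩)) ⟨fun s t h => ?_, fun q => ?_⟩).symm
  · have h' : Equivalent (s.representative n) (t.representative n) := Quotient.exact h
    exact eq_of_mutuallyRestrict_representative hn h'.mutuallyRestrict
  · obtain ⟨ψ, rfl⟩ := Quotient.exists_rep q
    obtain ⟨t, ht, -⟩ := existsUnique_equivalent_representative hn ψ.2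
    exact ⟨t, Quotient.sound ⟨ht.2, ht.1⟩⟩

end SLOCC

theorem mainTheorem4 (n : ℕ) (hn : 6 ≤ n) :
    Nat.card (Quotient (SLOCC.setoid 2 3 n)) = 26 ∧
    (∀ t : SLOCC.ClassName, t.representative n ≠ 0) ∧
    (∀ ψ : SLOCC.Tensor 2 3 n, ψ ≠ 0 →
      ∃! t : SLOCC.ClassName, SLOCC.Equivalent ψ (t.representative n)) ∧
    (∀ (t : SLOCC.ClassName) (ψ : SLOCC.Tensor 2 3 n),
      SLOCC.Equivalent ψ (t.representative n) →
        SLOCC.localRanks ψ = t.ranks ∧ SLOCC.HasTensorRank ψ t.tensorRank) := by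
  refine ⟨SLOCC.natCard_quotient hn, fun t => (SLOCC.representative_properties hn t).1,
    fun ψ hψ => SLOCC.existsUnique_equivalent_representative hn hψ, fun t ψ h => ?_⟩
  obtain ⟨ht, hr, hk⟩ := SLOCC.representative_properties hn t
  exact ⟨h.mutuallyRestrict.localRanks_eq.trans hr, h.mutuallyRestrict.hasTensorRank ht hk⟩
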